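/- Let $k$ be an algebraically closed field of characteristic $0$, $S:=k[X_0,X_1,X_2]$, $S[[t]]:=S\otimes_k k[[t]]$ and $S((t)):=S\otimes_k k((t))$, graded with $\deg t=0$. For a field $K$ of characteristic $0$ and $P,Q\in K[X_0,X_1,X_2]$ let $\partial_{P,Q}$ be the $K$-derivation given by the formal determinant with rows $\nabla P$, $\nabla Q$, $(\partial_{X_0},\partial_{X_1},\partial_{X_2})$; for a nonzero finite-dimensional $K$-space $V$ of homogeneous polynomials of one degree with basis $a_0,\dots,a_r$ put $W_\partial(V):=\det(\partial^i a_j)_{0\le i,j\le r}$ (well defined up to $K^*$). For a nonzero homogeneous $P$, the ramification scheme $R_P(V)\subset\mathbb P^2_K$ is the closed subscheme that on each open set $X_i\neq0$ is cut out by $P$ and $W_{\partial_{P,X_i}}(V)$ (it is empty if $P$ is a nonzero constant). For a finite closed subscheme $Z\subset\mathbb P^2_k$ let $[Z]$ be its associated $0$-cycle; for coprime homogeneous $P,Q\in S$ let $[P\cdot Q]$ be the $0$-cycle of the scheme cut out by $P$ and $Q$. Let $F(t)=\sum_{i\ge0}F_it^i\in S[[t]]$ be homogeneous of positive degree with $F_0=E^2A$,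 where $E,A\in S$ are square-free and coprime, and let $E=E_1\cdots E_m$ be the decomposition in irreducible factors. For each $j$ put $B_j:=E^2A/E_j^2$, $\Delta_{1,j}:=F_1$ and, for $n\ge0$, as long as $E_j$ divides $\Delta_{1,j},\dots,\Delta_{n+1,j}$, $$\Delta_{n+2,j}:=B_j^{n+1}F_{n+2}-\sum_{\substack{i+l=n+2\\ i,l\ge1}}\frac{\Delta_{i,j}}{2E_j}\cdot\frac{\Delta_{l,j}}{2E_j}.$$ Say that $F(t)$ is of type $n\ge1$ for $E_j$ if $E_j$ divides $\Delta_{1,j},\dots,\Delta_{n-1,j}$ but not $\Delta_{n,j}$. Let $F^*$ be $F(t)$ viewed in $S((t))$ and assume that the generic curve $F^*=0$ in $\mathbb P^2_{k((t))}$ is geometrically reduced. Then for each $j$ there is an integer $n_j$ such that $F(t)$ is of type $n_j$ for $E_j$. Furthermore, let $V(t)\subset S[[t]]$ be a $k[[t]]$-submodule of rank $r+1$, $r\ge0$, consisting of homogeneous elements of one fixed degree, and saturated: $tP(t)\in V(t)$ implies $P(t)\in V(t)$. Let $V(0)\subset S$ be the $k$-space of constant coefficients of elements of $V(t)$, let $V^*:=V(t)[1/t]\subset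 S((t))$, and assume that $V(0)$ is nondegenerate on each component of the curve $E^2A=0$, i.e. no irreducible factor of $E^2A$ divides a nonzero element of $V(0)$. Then the generic ramification scheme $R_{F^*}(V^*)\subset\mathbb P^2_{k((t))}$ is finite, and the $0$-cycle $[R^0_F(V)]$ of its limit $R^0_F(V)\subset\mathbb P^2_k$ (the special fiber of its scheme-theoretic closure in $\mathbb P^2_{k[[t]]}$) satisfies $$[R_F^0(V)]=2\sum_{j=1}^m[R_{E_j}(V(0))]+[R_A(V(0))]+\binom{r+1}{2}[E^2\cdot A]+\sum_{j=1}^m\binom{r+1}{2}[\Delta_{n_j,j}\cdot E_j]-\sum_{j=1}^m\binom{r+1}{2}(n_j-2)[B_j\cdot E_j],$$ all the schemes whose cycles occur here being finite. -/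

import Mathlib

open scoped LaurentSeries PowerSeries LinearAlgebra.Projectivization

noncomputable section

namespace Zeuthen

/-- `R[X₀, X₁, X₂]`.  For `R = k⟦X⟧` this is `S[[t]] = S ⊗ k[[t]]`, and for `R = k⸨X⸩` it is
`S((t)) = S ⊗ k((t))`, where `S = k[X₀, X₁, X₂]`; the variable `t` is `PowerSeries.X`. -/
abbrev Poly3 (R : Type*) [CommSemiring R] := MvPolynomial (Fin 3) R

section Wronskians

variable {K : Type*} [CommRing K]

/-- The derivation `∂_{P,Q}` of `K[X₀, X₁, X₂]`: the formal determinant with rows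
`∇P`, `∇Q` and `(∂_{X₀}, ∂_{X₁}, ∂_{X₂})`. -/
def jacobianDerivation (P Q : Poly3 K) : Derivation K (Poly3 K) (Poly3 K) :=
  (MvPolynomial.pderiv 1 P * MvPolynomial.pderiv 2 Q
      - MvPolynomial.pderiv 2 P * MvPolynomial.pderiv 1 Q) • MvPolynomial.pderiv 0
    - (MvPolynomial.pderiv 0 P * MvPolynomial.pderiv 2 Q
      - MvPolynomial.pderiv 2 P * MvPolynomial.pderiv 0 Q) • MvPolynomial.pderiv 1
    + (MvPolynomial.pderiv 0 P * MvPolynomial.pderiv 1 Q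
      - MvPolynomial.pderiv 1 P * MvPolynomial.pderiv 0 Q) • MvPolynomial.pderiv 2

/-- The Wronskian `W_∂(v)`: the determinant of the matrix with rows `∂ⁱ(v)`, `i = 0, …, n - 1`. -/
def wronskian (D : Derivation K (Poly3 K) (Poly3 K)) {n : ℕ} (v : Fin n → Poly3 K) : Poly3 K :=
  Matrix.det (Matrix.of fun i j : Fin n => (⇑D)^[(i : ℕ)] (v j))

end Wronskians

section Subschemes

variable {K : Type*} [Field K]

/-! A closed subscheme of `ℙ²_K` is represented by a homogeneous ideal of `K[X₀, X₁, X₂]`.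
Its trace on the chart `X_i ≠ 0` is the spectrum of `K[X₀, X₁, X₂] / (I, X_i - 1)`. -/

/-- The ideal of the trace on the chart `X_i ≠ 0`, dehomogenized by `X_i = 1`. -/
def chartIdeal (I : Ideal (Poly3 K)) (i : Fin 3) : Ideal (Poly3 K) :=
  I ⊔ Ideal.span {MvPolynomial.X i - 1}

/-- The closed subscheme of `ℙ²_K` defined by the homogeneous ideal `I` is finite over `K`. -/
def IsFiniteSubscheme (I : Ideal (Poly3 K)) : Prop :=
  ∀ i : Fin 3, Module.Finite K (Poly3 K ⧸ chartIdeal I i)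

/-- The closed subscheme of `ℙ²_K` defined by the homogeneous ideal `I` is geometrically
reduced over `K`. -/
def IsGeometricallyReducedSubscheme (I : Ideal (Poly3 K)) : Prop :=
  ∀ i : Fin 3, Algebra.IsGeometricallyReduced K (Poly3 K ⧸ chartIdeal I i)

/-- The ideal of the ramification scheme of the linear system `V` on the curve `F = 0`: on each
open set `X_i ≠ 0` that scheme is cut out by `F` and by the Wronskian `W_{∂_{F,X_i}}(V)` of a
basis of `V` (which up to a nonzero scalar does not depend on the basis).  An element of
`K[X₀, X₁, X₂]` lies in the ideal when it does so on each of these three open sets. -/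
def ramificationIdeal (F : Poly3 K) (V : Submodule K (Poly3 K)) : Ideal (Poly3 K) :=
  ⨅ i : Fin 3,
    ((Ideal.span ({F} ∪ {w : Poly3 K | ∃ b : Module.Basis (Fin (Module.finrank K V)) K V,
        w = wronskian (jacobianDerivation F (MvPolynomial.X i)) (fun j => (b j : Poly3 K))})).map
      (algebraMap (Poly3 K) (Localization.Away (MvPolynomial.X i : Poly3 K)))).comap
      (algebraMap (Poly3 K) (Localization.Away (MvPolynomial.X i : Poly3 K)))

/-- The ideal of the subscheme `(P · Q)` of `ℙ²_K` cut out by `P` and `Q`. -/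
def intersectionIdeal (P Q : Poly3 K) : Ideal (Poly3 K) := Ideal.span {P, Q}

/-- The linear system `V` is nondegenerate on each component of the curve `F = 0`: no irreducible
factor of `F` divides a nonzero element of `V`.  (Used over algebraically closed fields.) -/
def IsNondegenerateOn (V : Submodule K (Poly3 K)) (F : Poly3 K) : Prop :=
  ∀ G : Poly3 K, Irreducible G → G ∣ F → ∀ P ∈ V, P ≠ 0 → ¬ G ∣ P

end Subschemes

section Cycles

variable {k : Type*} [Field k]

/-- The homogeneous prime ideal of a rational point `p` of the projective plane: the polynomials
all of whose homogeneous components vanish at `p`, that is, those `G` with `G(s a) = 0` in `k[s]`,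
where `a` is a vector representing `p`. -/
def pointIdeal (p : ℙ k (Fin 3 → k)) : Ideal (Poly3 k) :=
  RingHom.ker (MvPolynomial.aeval
    (fun i : Fin 3 => Polynomial.C (p.rep i) * (Polynomial.X : Polynomial k)) :
      Poly3 k →ₐ[k] Polynomial k)

instance (p : ℙ k (Fin 3 → k)) : (pointIdeal p).IsPrime :=
  RingHom.ker_isPrime _

/-- The multiplicity at `p` of the closed subscheme `Z` of `ℙ²_k` defined by the homogeneous
ideal `I`: the length of `(S / I)_𝔭` over `S_𝔭`, where `𝔭` is the homogeneous prime of `p`.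
This is the length of the local ring of `Z` at `p`, because `S_𝔭` is flat and local over
the local ring of `ℙ²_k` at `p`, whose maximal ideal generates that of `S_𝔭`. -/
def pointMultiplicity (I : Ideal (Poly3 k)) (p : ℙ k (Fin 3 → k)) : ℕ∞ :=
  Module.length (Localization.AtPrime (pointIdeal p))
    (Localization.AtPrime (pointIdeal p) ⧸
      I.map (algebraMap (Poly3 k) (Localization.AtPrime (pointIdeal p))))

/-- `0`-cycles on the projective plane over an algebraically closed field. -/
abbrev ZeroCycle (k : Type*) [Field k] := ℙ k (Fin 3 → k) →₀ ℤ

open Classical in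
/-- The `0`-cycle `[Z]` associated to the finite closed subscheme `Z` of `ℙ²_k` defined by the
homogeneous ideal `I` (only meaningful if that subscheme is finite). -/
def cycle (I : Ideal (Poly3 k)) : ZeroCycle k :=
  if h : (Function.support fun p => ((pointMultiplicity I p).toNat : ℤ)).Finite then
    Finsupp.ofSupportFinite (fun p => ((pointMultiplicity I p).toNat : ℤ)) h
  else 0

end Cycles

section Families

variable {k : Type*} [Field k]

/-- `P(0)`, the constant coefficient of `P(t) ∈ S[[t]]`. -/
def atZero (P : Poly3 k⟦X⟧) : Poly3 k :=
  MvPolynomial.map PowerSeries.constantCoeff P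

/-- The coefficient `P_i ∈ S` of `tⁱ` in `P(t) ∈ S[[t]]`. -/
def tCoeff (i : ℕ) (P : Poly3 k⟦X⟧) : Poly3 k :=
  ∑ m ∈ P.support, MvPolynomial.monomial m (PowerSeries.coeff i (P.coeff m))

/-- `P*`: the power series `P(t) ∈ S[[t]]` viewed in `S((t))`. -/
def genericFiber (P : Poly3 k⟦X⟧) : Poly3 k⸨X⸩ :=
  MvPolynomial.map (algebraMap k⟦X⟧ k⸨X⸩) P

/-- `V(t)` is saturated: `t P(t) ∈ V(t)` implies `P(t) ∈ V(t)`. -/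
def IsSaturated (V : Submodule k⟦X⟧ (Poly3 k⟦X⟧)) : Prop :=
  ∀ P : Poly3 k⟦X⟧, (PowerSeries.X : k⟦X⟧) • P ∈ V → P ∈ V

/-- `V(0)`, the `k`-vector space of constant coefficients of the elements of `V(t)`. -/
def specialSystem (V : Submodule k⟦X⟧ (Poly3 k⟦X⟧)) : Submodule k (Poly3 k) :=
  Submodule.span k (atZero '' (V : Set (Poly3 k⟦X⟧)))

/-- `V* = V(t)[1/t]`, as a `k((t))`-vector subspace of `S((t))`. -/
def genericSystem (V : Submodule k⟦X⟧ (Poly3 k⟦X⟧)) : Submodule k⸨X⸩ (Poly3 k⸨X⸩) :=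
  Submodule.span k⸨X⸩ (genericFiber '' (V : Set (Poly3 k⟦X⟧)))

/-- The limit (schematic boundary) in `ℙ²_k` of the closed subscheme of `ℙ²_{k((t))}` defined by
the homogeneous ideal `I`: its scheme-theoretic closure in `ℙ²_{k[[t]]}` is defined by
`I ∩ S[[t]]`, and the limit is the special fiber of that closure. -/
def limitIdeal (I : Ideal (Poly3 k⸨X⸩)) : Ideal (Poly3 k) :=
  (I.comap (MvPolynomial.map (algebraMap k⟦X⟧ k⸨X⸩))).map
    (MvPolynomial.map (PowerSeries.constantCoeff (R := k)))

open Classical in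
/-- The quotient `P / Q` if `Q` divides `P` (and `0` otherwise). -/
def exactQuotient (P Q : Poly3 k) : Poly3 k :=
  if h : Q ∣ P then h.choose else 0

/-- The discriminants `Δ_i` of `F(t)` associated to a factor `G` of `F(0)`, with
`B = F(0) / G²`: `Δ₁ = F₁` and
`Δ_{n+2} = B^{n+1} F_{n+2} - ∑_{i + r = n + 2, i, r ≥ 1} (Δ_i / G / 2) (Δ_r / G / 2)`.
The value at the index `0` is not used; `Δ_{n+2}` is meaningful if `G` divides
`Δ₁, …, Δ_{n+1}`. -/
def discriminant (F : Poly3 k⟦X⟧) (B G : Poly3 k) : ℕ → Poly3 k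
  | 0 => 0
  | 1 => tCoeff 1 F
  | n + 2 => B ^ (n + 1) * tCoeff (n + 2) F -
      ∑ i : Fin (n + 1),
        (MvPolynomial.C 2⁻¹ * exactQuotient (discriminant F B G (i + 1)) G) *
          (MvPolynomial.C 2⁻¹ * exactQuotient (discriminant F B G (n + 1 - i)) G)
  decreasing_by all_goals omega

/-- `F(t)` is of type `n` for `G`: `G` divides `Δ₁, …, Δ_{n-1}` but not `Δ_n`. -/
def IsOfType (F : Poly3 k⟦X⟧) (B G : Poly3 k) (n : ℕ) : Prop :=
  1 ≤ n ∧ (∀ i, 1 ≤ i → i < n → G ∣ discriminant F B G i) ∧ ¬ G ∣ discriminant F B G n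

end Families

end Zeuthen

end

open Zeuthen

/-!
Near a point of a reduced component of the special curve, the limit of the ramification scheme is
computed directly: for `F₀ = QG` the derivation `∂_{F₀,L}` is `Q ∂_{G,L}` modulo `G`, so that the
Wronskian of `V(0)` for `F₀` is `Q ^ N` times the one for `G` on `G = 0`, where `N = r choose 2`
for a system of rank `r` (`wronskian_mul_sub_mem`). Along a double component `G`, with
`F₀ = G² B`, this Wronskian vanishes and one has to find its leading term in `t`. If `G` divides
the first `n - 1` discriminants, completing the square gives `B^{2n-2} F = B φ² + tⁿ ψ`, where
`φ` reduces to `G B^{n-1}` and `ψ` to `B^{n-1} Δ_n` (`exists_square_expansion`). On `F = 0` one has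
`B φ² = -tⁿ ψ`, and there `φ D` is proportional to `∂_F` for the derivation
`D = φψ ∂_B + 2Bψ ∂_φ - Bφ ∂_ψ`, whose restriction to `G = 0` is `2 Bⁿ ψ ∂_G`. Hence the square of
the Wronskian `w` satisfies `y w² ≡ t^{nN} x` modulo `F`, with `x` and `y` explicit and nonzero on
`G` (`dvd_mul_wronskian_sq_sub`, `exists_wronskian_relation`).

To turn such congruences into multiplicities at a point `p`, the plane is projected from a general
point to a line, and one works over the local ring `D` of the line at the image of `p`, a discrete
valuation ring, and over the corresponding local ring `Λ` of the line over `k[[t]]`. The curves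
become monic polynomials in one variable over `D` and `Λ`, and for a general projection the length
at `p` is the length over `D` (`length_localization_eq`, `pointMultiplicity_eq`). The scheme
`P = x = 0` then has length the order of the norm of `x` modulo `P` (`length_quotient_span_pair`).
The norm of `w` modulo `F` has the form `t^c ω` with `ω` nonzero for `t = 0`, and the length of the
limit of `F = w = 0` is the order of the reduction of `ω`, whatever the exponent `c`
(`length_quotient_saturation`). Finally the congruences above determine this reduction: if
`y_i w ≡ t^{b_i} x_i` modulo `F` for each component `P_i` of `F₀`, of multiplicity `m_i`, then it is
the product of the `(N(x_i) / N(y_i))^{m_i}`, with `N` the norm modulo `P_i`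
(`exists_norm_eq_pow_mul`). Applied to `w²`, and after dividing by two, this is the formula
(`IsDegeneration.pointMultiplicity_limit`, `IsDegeneration.cycle_limit`).

Two facts make these computations legitimate. First, a type exists: if `G` divided all the
discriminants, the squares could be completed to any order, so that the generic curve would be
singular along a whole component, by Krull's intersection theorem (`exists_isOfType`); but a
geometrically reduced curve has a square-free equation (`not_sq_dvd_of_isGeometricallyReduced`).
Second, Wronskians of nondegenerate systems do not vanish identically on an irreducible curve
`G = 0` (`not_dvd_wronskian`): the Taylor series of functions along the flow of `∂_G` embed the
functions on the curve in `k[[s]]`, where `∂_G` is `d/ds`, and there the Wronskian criterion holds.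
The finiteness assertions follow, since coprime forms have a resultant in any two of the variables
(`HasBinaryForms`).
-/

noncomputable section
namespace Zeuthen

section Univariate
open Polynomial IsLocalRing

/-! ### Determinants and norms -/

theorem exists_linearMap_comp_eq_det_smul {R M : Type*} [CommRing R] [AddCommGroup M] [Module R M]
    [Module.Free R M] [Module.Finite R M] (f : M →ₗ[R] M) :
    ∃ g : M →ₗ[R] M, f ∘ₗ g = LinearMap.det f • LinearMap.id ∧
      g ∘ₗ f = LinearMap.det f • LinearMap.id := by
  classical
  let b := Module.Free.chooseBasis R M
  refine ⟨Matrix.toLin b b (LinearMap.toMatrix b b f).adjugate, ?_, ?_⟩ <;>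
  · apply (LinearMap.toMatrix b b).injective
    rw [LinearMap.toMatrix_comp b b b, LinearMap.toMatrix_toLin]
    simp [Matrix.mul_adjugate, Matrix.adjugate_mul]

theorem injective_of_det_ne_zero {R M : Type*} [CommRing R] [IsDomain R] [AddCommGroup M]
    [Module R M] [Module.Free R M] [Module.Finite R M] (f : M →ₗ[R] M)
    (hf : LinearMap.det f ≠ 0) : Function.Injective f := by
  obtain ⟨g, -, hg⟩ := exists_linearMap_comp_eq_det_smul f
  refine (injective_iff_map_eq_zero f).mpr fun x hx => ?_
  have := LinearMap.congr_fun hg x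
  simp only [LinearMap.comp_apply, hx, map_zero, LinearMap.smul_apply, LinearMap.id_apply] at this
  exact (smul_eq_zero.mp this.symm).resolve_left hf

theorem ord_prod {D ι : Type*} [CommRing D] [IsDomain D] (s : Finset ι) (f : ι → D)
    (hf : ∀ i ∈ s, f i ≠ 0) : Ring.ord D (∏ i ∈ s, f i) = ∑ i ∈ s, Ring.ord D (f i) := by
  classical
  induction s using Finset.induction with
  | empty => simp
  | insert a s ha ih =>
    rw [Finset.prod_insert ha, Finset.sum_insert ha, Ring.ord_mul, ih]
    · exact fun i hi => hf i (Finset.mem_insert_of_mem hi)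
    · exact mem_nonZeroDivisors_of_ne_zero (Finset.prod_ne_zero_iff.mpr
        fun i hi => hf i (Finset.mem_insert_of_mem hi))

/-- By the Smith normal form, the cokernel of an injective endomorphism has length the order of its
determinant. -/
theorem length_quotient_range_eq_ord_det {D M : Type*} [CommRing D] [IsDomain D]
    [IsPrincipalIdealRing D] [AddCommGroup M] [Module D M] [Module.Free D M] [Module.Finite D M]
    (f : M →ₗ[D] M) (hf : LinearMap.det f ≠ 0) :
    Module.length D (M ⧸ LinearMap.range f) = Ring.ord D (LinearMap.det f) := by
  classical
  have hinj := injective_of_det_ne_zero f hf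
  let N := LinearMap.range f
  let ef : M ≃ₗ[D] N := LinearEquiv.ofInjective f hinj
  have h : Module.finrank D N = Module.finrank D M := ef.symm.finrank_eq
  let b := Module.Free.chooseBasis D M
  let a := Submodule.smithNormalFormCoeffs b h
  let b' := Submodule.smithNormalFormTopBasis b h
  let ab := Submodule.smithNormalFormBotBasis b h
  have ab_eq := Submodule.smithNormalFormBotBasis_def b h
  let e' : M ≃ₗ[D] N := b'.equiv ab (Equiv.refl _)
  have hass : Associated (LinearMap.det f) (∏ i, a i) := by
    have h1 : Associated (LinearMap.det (N.subtype ∘ₗ (ef : M →ₗ[D] N)))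
        (LinearMap.det (N.subtype ∘ₗ (e' : M →ₗ[D] N))) :=
      LinearMap.associated_det_comp_equiv _ _ _
    have h2 : N.subtype ∘ₗ (ef : M →ₗ[D] N) = f := by ext x; rfl
    rw [h2] at h1
    convert h1
    rw [← LinearMap.det_toMatrix b', ← Matrix.det_diagonal]
    congr 1
    ext i j
    rw [LinearMap.toMatrix_apply]
    have : (N.subtype ∘ₗ (e' : M →ₗ[D] N)) (b' j) = a j • b' j := by
      simp only [LinearMap.comp_apply, LinearEquiv.coe_coe, e', b'.equiv_apply, Equiv.refl_apply]
      exact ab_eq j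
    rw [this, map_smul, Module.Basis.repr_self, Finsupp.smul_single, smul_eq_mul, mul_one]
    by_cases hij : i = j
    · subst hij; simp
    · rw [Matrix.diagonal_apply_ne _ hij, Finsupp.single_eq_of_ne hij]
  have hprod : ∏ i, a i ≠ 0 := fun h0 =>
      hf (by rw [h0] at hass; exact associated_zero_iff_eq_zero _ |>.mp hass)
  rw [(N.quotientEquivPiSpan b h).length_eq, Module.length_pi_of_fintype,
    Ring.ord_eq_of_associated hass, ord_prod]
  · rw [← Finset.sum_congr rfl fun i _ => ?_]
    rw [Ring.ord]
  · exact fun i _ => Finset.prod_ne_zero_iff.mp hprod i (Finset.mem_univ i)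

theorem multiset_exists_split {α β : Type*} (f : α → β) (s : Multiset α) (t t' : Multiset β)
    (h : s.map f = t + t') : ∃ u u', s = u + u' ∧ u.map f = t ∧ u'.map f = t' := by
  classical
  induction t using Multiset.induction generalizing s with
  | empty => exact ⟨0, s, by simp, by simp, by simpa using h⟩
  | cons a t ih =>
    rw [Multiset.cons_add] at h
    obtain ⟨x, hx, rfl, h'⟩ := (Multiset.map_eq_cons f s (t + t') a).mpr h
    obtain ⟨u, u', h1, h2, h3⟩ := ih _ h'
    refine ⟨x ::ₘ u, u', ?_, by simp [h2], h3⟩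
    rw [Multiset.cons_add, ← h1, Multiset.cons_erase hx]

/-- A decomposition of the image of a multiset lifts to the multiset. -/
theorem multiset_exists_split_sum {α β ι : Type*} (f : α → β) (T : Finset ι) (r : ι → Multiset β)
    (s : Multiset α) (h : s.map f = ∑ i ∈ T, r i) :
    ∃ u : ι → Multiset α, s = ∑ i ∈ T, u i ∧ ∀ i ∈ T, (u i).map f = r i := by
  classical
  induction T using Finset.induction generalizing s with
  | empty => exact ⟨fun _ => 0, by simpa using h, by simp⟩
  | insert a T ha ih =>
    rw [Finset.sum_insert ha] at h
    obtain ⟨v, v', rfl, h1, h2⟩ := multiset_exists_split f s _ _ h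
    obtain ⟨u, rfl, hu⟩ := ih v' h2
    refine ⟨Function.update u a v, ?_, ?_⟩
    · rw [Finset.sum_insert ha, Function.update_self]
      congr 1
      refine Finset.sum_congr rfl fun i hi => ?_
      rw [Function.update_of_ne (by rintro rfl; exact ha hi)]
    · intro i hi
      rcases Finset.mem_insert.mp hi with rfl | hi
      · simpa using h1
      · rw [Function.update_of_ne (ne_of_mem_of_not_mem hi ha), hu i hi]

/-- The norm to `R` of the class of `x` in `R[Y] / (P)`. -/
def normMod {R : Type*} [CommRing R] (P x : R[X]) : R := Algebra.norm R (AdjoinRoot.mk P x)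

theorem normMod_mul {R : Type*} [CommRing R] (P x y : R[X]) :
    normMod P (x * y) = normMod P x * normMod P y := by
  simp [normMod]

theorem normMod_pow {R : Type*} [CommRing R] (P x : R[X]) (n : ℕ) :
    normMod P (x ^ n) = normMod P x ^ n := by
  simp [normMod]

theorem normMod_congr {R : Type*} [CommRing R] {P x y : R[X]} (h : P ∣ x - y) :
    normMod P x = normMod P y := by
  rw [normMod, normMod, AdjoinRoot.mk_eq_mk.mpr h]

theorem powerBasis'_repr_mk {R : Type*} [CommRing R] {P : R[X]} (hP : P.Monic) (f : R[X])
    (i : Fin (AdjoinRoot.powerBasis' hP).dim) :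
    (AdjoinRoot.powerBasis' hP).basis.repr (AdjoinRoot.mk P f) i = (f %ₘ P).coeff i := by
  rw [← AdjoinRoot.modByMonicHom_mk hP]
  rfl

theorem normMod_map {R S : Type*} [CommRing R] [CommRing S] (φ : R →+* S) {P : R[X]}
    (hP : P.Monic) (x : R[X]) : normMod (P.map φ) (x.map φ) = φ (normMod P x) := by
  nontriviality S
  have : Nontrivial R := φ.domain_nontrivial
  have hP' := hP.map φ
  rw [normMod, normMod, Algebra.norm_eq_matrix_det (AdjoinRoot.powerBasis' hP).basis,
    Algebra.norm_eq_matrix_det (AdjoinRoot.powerBasis' hP').basis, RingHom.map_det]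
  have hdim : (AdjoinRoot.powerBasis' hP).dim = (AdjoinRoot.powerBasis' hP').dim :=
    (hP.natDegree_map φ).symm
  rw [← Matrix.det_reindex_self (finCongr hdim)]
  congr 1
  ext i j
  simp only [Matrix.reindex_apply, Matrix.submatrix_apply, RingHom.mapMatrix_apply,
    Matrix.map_apply, Algebra.leftMulMatrix_eq_repr_mul, PowerBasis.basis_eq_pow]
  simp only [AdjoinRoot.powerBasis'_gen, ← AdjoinRoot.mk_X, ← map_pow, ← map_mul]
  rw [powerBasis'_repr_mk hP', powerBasis'_repr_mk hP, ← Polynomial.coeff_map,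
      Polynomial.map_modByMonic _ hP]
  simp

theorem normMod_C {R : Type*} [CommRing R] {P : R[X]} (hP : P.Monic) (c : R) :
    normMod P (C c) = c ^ P.natDegree := by
  nontriviality R
  rw [normMod, AdjoinRoot.mk_C]
  have := Algebra.norm_algebraMap_of_basis (AdjoinRoot.powerBasis' hP).basis c
  simpa using this

/-- Over a field, the norm of `β - X` modulo `P` is the value `P(β)`. -/
theorem normMod_C_sub_X {K : Type*} [Field K] {P : K[X]} (hP : P.Monic) (β : K) :
    normMod P (C β - X) = P.eval β := by
  let pb := AdjoinRoot.powerBasis hP.ne_zero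
  have h1 := charpoly_leftMulMatrix pb
  rw [AdjoinRoot.minpoly_powerBasis_gen_of_monic hP] at h1
  have h2 : P.eval β = ((Algebra.leftMulMatrix pb.basis pb.gen).charpoly).eval β := by rw [h1]
  rw [h2, Matrix.eval_charpoly, normMod, Algebra.norm_eq_matrix_det pb.basis, map_sub, map_sub,
    AdjoinRoot.mk_C, AdjoinRoot.mk_X]
  congr 2
  exact AlgHom.commutes (Algebra.leftMulMatrix pb.basis) β

/-- Over an algebraically closed field the norm is the product of the values at the roots. -/
theorem normMod_eq_prod_roots {K : Type*} [Field K] [IsAlgClosed K] {P : K[X]} (hP : P.Monic)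
    (x : K[X]) : normMod P x = (P.roots.map fun a => x.eval a).prod := by
  have hs : P.Splits := IsAlgClosed.splits P
  have hcard : P.natDegree = P.roots.card := hs.natDegree_eq_card_roots
  have key : ∀ β, normMod P (X - C β) = (P.roots.map fun a => (X - C β).eval a).prod := by
    intro β
    have h1 : (X - C β : K[X]) = C (-1) * (C β - X) := by simp
    rw [h1, normMod_mul, normMod_C hP, normMod_C_sub_X hP]
    conv_lhs => rw [hs.eq_prod_roots_of_monic hP]
    rw [eval_multiset_prod, Multiset.map_map, ← hs.eq_prod_roots_of_monic hP, hcard,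
      ← Multiset.prod_replicate, ← Multiset.map_const', ← Multiset.prod_map_mul]
    congr 1
    refine Multiset.map_congr rfl fun a _ => ?_
    simp
  have hx := (IsAlgClosed.splits x).eq_prod_roots
  rw [hx, normMod_mul, normMod_C hP]
  simp only [eval_mul, eval_C, Multiset.prod_map_mul]
  congr 1
  · rw [hcard, Multiset.map_const', Multiset.prod_replicate]
  · generalize x.roots = s
    induction s using Multiset.induction with
    | empty => simp [normMod]
    | cons a s ih =>
      rw [Multiset.map_cons, Multiset.prod_cons, normMod_mul, ih, key]
      simp only [eval_mul, Multiset.prod_map_mul]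

/-- A monic polynomial splits over an integral extension, and its norm is computed there on the
roots. -/
theorem exists_integral_splitting.{u} {Λ : Type u} [CommRing Λ] [IsDomain Λ] {F : Λ[X]}
    (hF : F.Monic) :
    ∃ (O : Type u) (_ : CommRing O) (_ : IsDomain O) (_ : Algebra Λ O) (_ : Algebra.IsIntegral Λ O)
      (s : Multiset O), Function.Injective (algebraMap Λ O) ∧
      F.map (algebraMap Λ _) = (s.map fun a => X - C a).prod ∧
      ∀ x : Λ[X], algebraMap Λ _ (normMod F x) =
          (s.map fun a => (x.map (algebraMap Λ _)).eval a).prod := by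
  classical
  let K := AlgebraicClosure (FractionRing Λ)
  let O := integralClosure Λ K
  let FK := F.map (algebraMap Λ K)
  have hFK : FK.Monic := hF.map _
  have hint : ∀ a ∈ FK.roots, IsIntegral Λ a := fun a ha =>
    ⟨F, hF, by rw [← eval_map]; exact (mem_roots hFK.ne_zero).mp ha⟩
  let s : Multiset O := FK.roots.pmap (fun a ha => ⟨a, ha⟩) hint
  have hs : s.map (algebraMap O K) = FK.roots := by
    refine (Multiset.map_pmap _ _ _ _).trans ?_
    exact (Multiset.pmap_eq_map _ id _ hint).trans (Multiset.map_id _)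
  have hinj : Function.Injective (algebraMap O K) := Subtype.val_injective
  have hcomp : (algebraMap O K).comp (algebraMap Λ O) = algebraMap Λ K :=
    (IsScalarTower.algebraMap_eq Λ O K).symm
  have hinj' : Function.Injective (algebraMap Λ O) := by
    have : Function.Injective (algebraMap Λ K) := by
      rw [IsScalarTower.algebraMap_eq Λ (FractionRing Λ) K]
      exact (algebraMap (FractionRing Λ) K).injective.comp (IsFractionRing.injective Λ _)
    rw [← hcomp] at this
    exact Function.Injective.of_comp (f := algebraMap O K) this
  refine ⟨O, inferInstance, inferInstance, inferInstance, inferInstance, s, hinj', ?_, fun x => ?_⟩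
  · apply Polynomial.map_injective _ hinj
    rw [Polynomial.map_map, hcomp, Polynomial.map_multiset_prod, Multiset.map_map]
    have := (IsAlgClosed.splits FK).eq_prod_roots_of_monic hFK
    rw [← hs, Multiset.map_map] at this
    refine this.trans ?_
    congr 1
    refine Multiset.map_congr rfl fun a _ => ?_
    simp
  · apply hinj
    rw [← RingHom.comp_apply, hcomp, ← normMod_map _ hF, normMod_eq_prod_roots hFK, ← hs,
      Multiset.map_map, map_multiset_prod, Multiset.map_map]
    congr 1
    refine Multiset.map_congr rfl fun a _ => ?_
    simp only [Function.comp_apply]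
    rw [← eval₂_hom, ← eval_map, Polynomial.map_map, hcomp]

/-- The norm of `w` modulo `F` along the special fiber `t = 0`, where `F` is the product of the
`P i ^ m i`: if `y i * w = t ^ b i * x i` modulo `F` with `x i` and `y i` nonzero on `P i = 0`,
then the norm is a power of `t` times an element whose reduction is the product of the norms of the
quotients `x i / y i`, to the power `m i`. Each root of `F` reduces to a root of one of the `P i`,
and the value of `w` at this root is read off from the relation for that `i`. -/
theorem exists_norm_eq_pow_mul {Λ D : Type*} [CommRing Λ] [IsDomain Λ] [CommRing D] [IsDomain D]
    (π : Λ →+* D) (hπ : Function.Surjective π) {t : Λ} (ht : RingHom.ker π = Ideal.span {t})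
    (ht0 : t ≠ 0) {ι : Type*} [Fintype ι] {F : Λ[X]} (hF : F.Monic) {P : ι → D[X]}
    (hP : ∀ i, (P i).Monic) (m : ι → ℕ) (hFP : F.map π = ∏ i, P i ^ m i) (w : Λ[X])
    (x y : ι → Λ[X]) (b : ι → ℕ) (hrel : ∀ i, F ∣ y i * w - C (t ^ b i) * x i)
    (hx : ∀ i, normMod (P i) ((x i).map π) ≠ 0) (hy : ∀ i, normMod (P i) ((y i).map π) ≠ 0) :
    ∃ (c : ℕ) (ω : Λ), normMod F w = t ^ c * ω ∧ π ω ≠ 0 ∧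
      π ω * ∏ i, normMod (P i) ((y i).map π) ^ m i = ∏ i, normMod (P i) ((x i).map π) ^ m i := by
  classical
  obtain ⟨O, _, _, _, _, s, hΛO, hs, hnorm⟩ := exists_integral_splitting hF
  have hprime : (Ideal.span {t}).IsPrime := ht ▸ RingHom.ker_isPrime π
  obtain ⟨Q, hQ, hQc⟩ := Ideal.exists_ideal_over_prime_of_isIntegral_of_isDomain (S := O)
    (Ideal.span {t}) (by
      rw [(RingHom.injective_iff_ker_eq_bot _).mp hΛO]
      exact bot_le)
  let K := AlgebraicClosure (FractionRing (O ⧸ Q))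
  let q : O →+* K := (algebraMap (O ⧸ Q) K).comp (Ideal.Quotient.mk Q)
  have hqker : ∀ a, q a = 0 ↔ a ∈ Q := fun a => by
    rw [← Ideal.Quotient.eq_zero_iff_mem]
    refine map_eq_zero_iff (algebraMap (O ⧸ Q) K) ?_
    rw [IsScalarTower.algebraMap_eq (O ⧸ Q) (FractionRing (O ⧸ Q)) K]
    exact (algebraMap (FractionRing (O ⧸ Q)) K).injective.comp (IsFractionRing.injective _ _)
  have hq : ∀ a : Λ, q (algebraMap Λ O a) = 0 ↔ π a = 0 := fun a => by
    rw [hqker, ← RingHom.mem_ker, ht, ← hQc, Ideal.mem_comap]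
  let ψ : D →+* K := RingHom.liftOfSurjective π hπ ⟨q.comp (algebraMap Λ O), fun a ha =>
    (hq a).mpr ha⟩
  have hψ : ∀ a, ψ (π a) = q (algebraMap Λ O a) := fun a =>
    RingHom.liftOfRightInverse_comp_apply π _ _ ⟨q.comp (algebraMap Λ O), _⟩ a
  have hψπ : ψ.comp π = q.comp (algebraMap Λ O) := RingHom.ext hψ
  have hψinj : Function.Injective ψ := by
    refine (injective_iff_map_eq_zero ψ).mpr fun d hd => ?_
    obtain ⟨a, rfl⟩ := hπ d
    rw [hψ] at hd
    exact (hq a).mp hd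
  -- the roots of `F` reduce to the roots of the `P i`, with multiplicities
  have hroots : s.map q = ∑ i, m i • ((P i).map ψ).roots := by
    have h1 : ((s.map q).map fun a => X - C a).prod = ∏ i, ((P i).map ψ) ^ m i := by
      have := congrArg (Polynomial.map ψ) hFP
      rw [Polynomial.map_map, hψπ, ← Polynomial.map_map, hs, Polynomial.map_multiset_prod,
        Multiset.map_map, Polynomial.map_prod] at this
      simp only [Polynomial.map_pow] at this
      rw [← this, Multiset.map_map]
      congr 1
      refine Multiset.map_congr rfl fun a _ => ?_
      simp
    have h2 := congrArg Polynomial.roots h1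
    rw [roots_multiset_prod_X_sub_C, roots_prod] at h2
    · rw [h2]
      simp only [roots_pow]
      rfl
    · exact Finset.prod_ne_zero_iff.mpr fun i _ => pow_ne_zero _ ((hP i).map ψ).ne_zero
  obtain ⟨u, hu, hur⟩ := multiset_exists_split_sum q Finset.univ _ s hroots
  let ev : Λ[X] → O → O := fun f a => (f.map (algebraMap Λ O)).eval a
  have hevrel : ∀ i, ∀ a ∈ s, ev (y i) a * ev w a = algebraMap Λ O (t ^ b i) * ev (x i) a := by
    intro i a ha
    obtain ⟨g, hg⟩ := hrel i
    have h1 : (F.map (algebraMap Λ O)).eval a = 0 := by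
      rw [hs, eval_multiset_prod, Multiset.map_map]
      exact Multiset.prod_eq_zero (Multiset.mem_map.mpr ⟨a, ha, by simp⟩)
    have h2 := congrArg (fun f => ev f a) hg
    simp only [ev, Polynomial.map_sub, Polynomial.map_mul, eval_sub, eval_mul, h1, zero_mul,
      Polynomial.map_C, eval_C] at h2
    exact sub_eq_zero.mp h2
  have hbar : ∀ (z : ι → Λ[X]), q (∏ i, ((u i).map (ev (z i))).prod) =
      ψ (∏ i, normMod (P i) ((z i).map π) ^ m i) := by
    intro z
    rw [map_prod, map_prod]
    refine Finset.prod_congr rfl fun i _ => ?_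
    rw [map_pow, ← normMod_map ψ (hP i), normMod_eq_prod_roots ((hP i).map ψ),
      ← Multiset.prod_nsmul, ← Multiset.map_nsmul, ← hur i (Finset.mem_univ i),
      map_multiset_prod, Multiset.map_map, Multiset.map_map]
    congr 1
    refine Multiset.map_congr rfl fun a _ => ?_
    simp only [Function.comp_apply, ev]
    rw [Polynomial.map_map, hψπ, ← Polynomial.map_map, eval_map_apply]
  have htot : (∏ i, ((u i).map (ev (y i))).prod) * algebraMap Λ O (normMod F w) =
      algebraMap Λ O t ^ (∑ i, b i * (u i).card) * ∏ i, ((u i).map (ev (x i))).prod := by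
    have h1 : algebraMap Λ O (normMod F w) = ∏ i, ((u i).map (ev w)).prod := by
      rw [hnorm w]
      conv_lhs => rw [hu]
      rw [← Multiset.coe_mapAddMonoidHom, map_sum, Multiset.prod_sum]
    rw [h1, ← Finset.prod_mul_distrib, ← Finset.prod_pow_eq_pow_sum, ← Finset.prod_mul_distrib]
    refine Finset.prod_congr rfl fun i _ => ?_
    rw [← Multiset.prod_map_mul, pow_mul, ← Multiset.prod_replicate, ← Multiset.map_const',
        ← Multiset.prod_map_mul]
    congr 1
    refine Multiset.map_congr rfl fun a ha => ?_
    rw [hevrel i a, map_pow]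
    rw [hu]
    exact Multiset.mem_sum.mpr ⟨i, Finset.mem_univ i, ha⟩
  have hyne : (∏ i, ((u i).map (ev (y i))).prod) ∉ Q := by
    rw [← hqker, hbar, map_eq_zero_iff _ hψinj]
    exact Finset.prod_ne_zero_iff.mpr fun i _ => pow_ne_zero _ (hy i)
  have htQ : algebraMap Λ O t ∈ Q := by
    rw [← Ideal.mem_comap, hQc]; exact Ideal.mem_span_singleton_self t
  have htO : algebraMap Λ O t ≠ 0 := by
    rwa [Ne, map_eq_zero_iff _ hΛO]
  have main : ∀ (c : ℕ) (z : Λ), (∏ i, ((u i).map (ev (y i))).prod) * algebraMap Λ O z =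
      algebraMap Λ O t ^ c * ∏ i, ((u i).map (ev (x i))).prod → ∃ ω, z = t ^ c * ω ∧
      (∏ i, ((u i).map (ev (y i))).prod) * algebraMap Λ O ω = ∏ i, ((u i).map (ev (x i))).prod := by
    intro c
    induction c with
    | zero => exact fun z hz => ⟨z, by simp, by simpa using hz⟩
    | succ c ih =>
      intro z hz
      have hzQ : algebraMap Λ O z ∈ Q := by
        refine (hQ.mem_or_mem ?_).resolve_left hyne
        rw [hz, pow_succ']
        exact Ideal.mul_mem_right _ _ (Ideal.mul_mem_right _ _ htQ)
      rw [← Ideal.mem_comap, hQc, Ideal.mem_span_singleton] at hzQ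
      obtain ⟨z', rfl⟩ := hzQ
      obtain ⟨ω, rfl, h⟩ := ih z' (mul_left_cancel₀ htO (by
        rw [map_mul] at hz; rw [pow_succ] at hz; linear_combination hz))
      exact ⟨ω, by ring, h⟩
  obtain ⟨ω, h1, h2⟩ := main _ _ htot
  have h3 : π ω * ∏ i, normMod (P i) ((y i).map π) ^ m i =
      ∏ i, normMod (P i) ((x i).map π) ^ m i := by
    apply hψinj
    rw [map_mul, ← hbar x, ← h2, map_mul, ← hbar y, hψ, mul_comm]
  refine ⟨_, ω, h1, fun h0 => ?_, h3⟩
  rw [h0, zero_mul] at h3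
  exact Finset.prod_ne_zero_iff.mpr (fun i _ => pow_ne_zero _ (hx i)) h3.symm

/-! ### Lengths of special fibers -/

theorem exists_comp_eq_of_range_le {R ι M : Type*} [CommRing R] [Finite ι] [AddCommGroup M]
    [Module R M] (f : (ι → R) →ₗ[R] M) (g : (ι → R) →ₗ[R] M)
    (h : ∀ x, g x ∈ LinearMap.range f) : ∃ u : (ι → R) →ₗ[R] (ι → R), f ∘ₗ u = g := by
  classical
  choose v hv using fun i => h (Pi.basisFun R ι i)
  refine ⟨(Pi.basisFun R ι).constr R v, (Pi.basisFun R ι).ext fun i => ?_⟩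
  rw [LinearMap.comp_apply, Module.Basis.constr_basis, hv]

/-- If `H` is the `t`-saturation of the image of `g`, then the cokernel of the reduction of `H` has
length the order of the reduction of `ω`, where `det g = t ^ c * ω`. A lift of a basis of the
reduction generates `H`, by Nakayama's lemma, and the determinant of `g` is that of this basis up
to a divisor of a power of `t`. -/
theorem length_quotient_of_saturated {Λ D : Type*} [CommRing Λ] [IsDomain Λ] [IsLocalRing Λ]
    [IsNoetherianRing Λ] [CommRing D] [IsDomain D] [IsPrincipalIdealRing D]
    (π : Λ →+* D) (hπ : Function.Surjective π) {t : Λ} (ht : RingHom.ker π = Ideal.span {t})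
    (ht0 : t ≠ 0) {ι : Type*} [Fintype ι] (g : (ι → Λ) →ₗ[Λ] (ι → Λ))
    (H : Submodule Λ (ι → Λ)) (hgH : LinearMap.range g ≤ H)
    (hH : ∀ x ∈ H, ∃ n : ℕ, t ^ n • x ∈ LinearMap.range g) (hsat : ∀ x, t • x ∈ H → x ∈ H)
    {c : ℕ} {ω : Λ} (hdet : LinearMap.det g = t ^ c * ω) (hω : π ω ≠ 0)
    (Hbar : Submodule D (ι → D)) (hHbar : ∀ y, y ∈ Hbar ↔ ∃ x ∈ H, (fun i => π (x i)) = y) :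
    Module.length D ((ι → D) ⧸ Hbar) = Ring.ord D (π ω) := by
  classical
  have hprimeI : (Ideal.span {t}).IsPrime := ht ▸ RingHom.ker_isPrime π
  have htp : Prime t := (Ideal.span_singleton_prime ht0).mp hprimeI
  have htπ : ∀ a, π a = 0 ↔ t ∣ a := fun a => by
    rw [← RingHom.mem_ker, ht, Ideal.mem_span_singleton]
  have hsat' : ∀ (n : ℕ) x, t ^ n • x ∈ H → x ∈ H := by
    intro n
    induction n with
    | zero => intro x hx; simpa using hx
    | succ n ih =>
      intro x hx
      rw [pow_succ', mul_smul] at hx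
      exact ih x (hsat _ hx)
  have hωH : ∀ x, ω • x ∈ H := by
    intro x
    apply hsat' c
    obtain ⟨g', hg', -⟩ := exists_linearMap_comp_eq_det_smul g
    rw [smul_smul, ← hdet]
    have : g (g' x) = LinearMap.det g • x := LinearMap.congr_fun hg' x
    rw [← this]
    exact hgH (LinearMap.mem_range_self _ _)
  have hlift : ∀ y : ι → D, ∃ x : ι → Λ, (fun i => π (x i)) = y := fun y => by
    choose x hx using fun i => hπ (y i)
    exact ⟨x, funext hx⟩
  have hωHbar : ∀ y, π ω • y ∈ Hbar := by
    intro y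
    obtain ⟨x, rfl⟩ := hlift y
    exact (hHbar _).mpr ⟨ω • x, hωH x, by ext i; simp⟩
  have hrank : Module.finrank D Hbar = Module.finrank D (ι → D) := by
    apply le_antisymm (Submodule.finrank_le _)
    let f : (ι → D) →ₗ[D] Hbar := (LinearMap.lsmul D (ι → D) (π ω)).codRestrict Hbar hωHbar
    refine LinearMap.finrank_le_finrank_of_injective (f := f) ?_
    intro y z hyz
    have := congrArg Subtype.val hyz
    exact smul_right_injective _ hω this
  obtain ⟨-, -, e, -⟩ := Submodule.exists_smith_normal_form_of_rank_eq (Pi.basisFun D ι) hrank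
  choose h hhH hhe using fun i => (hHbar _).mp (e i).2
  -- by Nakayama the lifts `h i` of a basis of the reduction generate `H`
  have hspan : Submodule.span Λ (Set.range h) = H := by
    apply le_antisymm
    · rw [Submodule.span_le]
      rintro _ ⟨i, rfl⟩
      exact hhH i
    · refine Submodule.le_of_le_smul_of_le_jacobson_bot (I := Ideal.span {t})
        (IsNoetherian.noetherian H) ?_ ?_
      · rw [IsLocalRing.jacobson_eq_maximalIdeal ⊥ bot_ne_top, Ideal.span_le,
          Set.singleton_subset_iff]
        exact (IsLocalRing.mem_maximalIdeal _).mpr htp.not_isUnit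
      · intro x hx
        have hxb : (fun i => π (x i)) ∈ Hbar := (hHbar _).mpr ⟨x, hx, rfl⟩
        choose a ha using fun i => hπ (e.repr ⟨_, hxb⟩ i)
        have hz : ∀ j, t ∣ (x - ∑ i, a i • h i) j := by
          intro j
          rw [← htπ]
          have h1 := congrArg (fun v : Hbar => (v : ι → D) j) (e.sum_repr ⟨_, hxb⟩)
          simp only [Submodule.coe_sum, Submodule.coe_smul, Finset.sum_apply, Pi.smul_apply,
            smul_eq_mul] at h1
          simp only [Pi.sub_apply, Finset.sum_apply, Pi.smul_apply, smul_eq_mul, map_sub, map_sum,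
            map_mul, ← h1, ha]
          rw [sub_eq_zero]
          refine Finset.sum_congr rfl fun i _ => ?_
          rw [← hhe i]
        choose z hz using hz
        have hz' : x - ∑ i, a i • h i = t • z := funext hz
        have hS : ∑ i, a i • h i ∈ Submodule.span Λ (Set.range h) :=
          Submodule.sum_mem _ fun i _ => Submodule.smul_mem _ _ (Submodule.subset_span ⟨i, rfl⟩)
        have hzH : z ∈ H := by
          apply hsat
          rw [← hz']
          exact H.sub_mem hx (Submodule.sum_mem _ fun i _ => Submodule.smul_mem _ _ (hhH i))
        rw [← sub_add_cancel x (∑ i, a i • h i), add_comm, hz']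
        exact Submodule.add_mem_sup hS
          (Submodule.smul_mem_smul (Ideal.mem_span_singleton_self t) hzH)
  let g' : (ι → Λ) →ₗ[Λ] (ι → Λ) := (Pi.basisFun Λ ι).constr Λ h
  have hg'i : ∀ i, g' (Pi.basisFun Λ ι i) = h i := fun i => Module.Basis.constr_basis _ _ _ _
  have hg'range : LinearMap.range g' = H := by rw [Module.Basis.constr_range, hspan]
  obtain ⟨u, hu⟩ := exists_comp_eq_of_range_le g' g fun x => hg'range ▸ hgH ⟨x, rfl⟩
  choose n hn using fun i => hH (h i) (hhH i)
  let N := ∑ i, n i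
  obtain ⟨u', hu'⟩ := exists_comp_eq_of_range_le g (t ^ N • g') fun x => by
    rw [LinearMap.smul_apply]
    have h1 : g' x ∈ LinearMap.range g' := ⟨x, rfl⟩
    rw [hg'range, ← hspan] at h1
    generalize g' x = z at h1
    induction h1 using Submodule.span_induction with
    | mem _ hx =>
      obtain ⟨i, rfl⟩ := hx
      obtain ⟨r, hr⟩ := Nat.exists_eq_add_of_le (Finset.single_le_sum (f := n)
        (fun _ _ => Nat.zero_le _) (Finset.mem_univ i))
      change t ^ (∑ i, n i) • h i ∈ _
      rw [hr, pow_add, mul_comm, mul_smul]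
      exact Submodule.smul_mem _ _ (hn i)
    | zero => simp
    | add a b _ _ ha hb => rw [smul_add]; exact Submodule.add_mem _ ha hb
    | smul a b _ hb => rw [smul_comm]; exact Submodule.smul_mem _ _ hb
  have hω0 : ω ≠ 0 := fun h0 => hω (by rw [h0, map_zero])
  have hd1 : LinearMap.det g' * LinearMap.det u = t ^ c * ω := by
    rw [← LinearMap.det_comp, hu, hdet]
  have hd2 : t ^ c * ω * LinearMap.det u' = (t ^ N) ^ Fintype.card ι * LinearMap.det g' := by
    rw [← hdet, ← LinearMap.det_comp, hu', LinearMap.det_smul, Module.finrank_fintype_fun_eq_card]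
  have hg'0 : LinearMap.det g' ≠ 0 := fun h0 => by
    rw [h0, zero_mul] at hd1
    exact mul_ne_zero (pow_ne_zero _ ht0) hω0 hd1.symm
  have hd3 : LinearMap.det u ∣ t ^ (N * Fintype.card ι) := by
    refine ⟨LinearMap.det u', mul_left_cancel₀ hg'0 ?_⟩
    rw [pow_mul, ← mul_assoc, hd1, hd2, mul_comm]
  obtain ⟨a, -, v, hv⟩ := (dvd_prime_pow htp _).mp hd3
  let gbar : (ι → D) →ₗ[D] (ι → D) := (Pi.basisFun D ι).constr D fun i => (e i : ι → D)
  have hgbar : LinearMap.range gbar = Hbar := by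
    rw [Module.Basis.constr_range]
    have := congrArg (Submodule.map Hbar.subtype) e.span_eq
    rw [Submodule.map_span, ← Set.range_comp, Submodule.map_top, Submodule.range_subtype] at this
    exact this
  have hdetbar : LinearMap.det gbar = π (LinearMap.det g') := by
    rw [← LinearMap.det_toMatrix (Pi.basisFun D ι), ← LinearMap.det_toMatrix (Pi.basisFun Λ ι),
      RingHom.map_det]
    congr 1
    ext i j
    rw [RingHom.mapMatrix_apply, Matrix.map_apply, LinearMap.toMatrix_apply,
      LinearMap.toMatrix_apply, Module.Basis.constr_basis, hg'i, ← hhe j]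
    simp
  have hgbarinj : Function.Injective gbar := by
    rw [← LinearMap.ker_eq_bot]
    apply LinearMap.ker_eq_bot_of_injective
    intro y z hyz
    have h1 : ∀ y, gbar y = ((∑ i, y i • e i : Hbar) : ι → D) := fun y => by
      rw [Module.Basis.constr_apply_fintype]
      simp
    rw [h1, h1] at hyz
    have h2 := Subtype.ext hyz
    have h3 := congrArg e.equivFun h2
    rw [← Module.Basis.equivFun_symm_apply, ← Module.Basis.equivFun_symm_apply,
      LinearEquiv.apply_symm_apply, LinearEquiv.apply_symm_apply] at h3
    exact h3
  have hdetbar0 : LinearMap.det gbar ≠ 0 := by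
    intro h0
    rw [← LinearMap.det_toMatrix (Pi.basisFun D ι), ← Matrix.exists_mulVec_eq_zero_iff] at h0
    obtain ⟨y, hy0, hy⟩ := h0
    have h1 := LinearMap.toMatrix_mulVec_repr (Pi.basisFun D ι) (Pi.basisFun D ι) gbar y
    have h2 : ((Pi.basisFun D ι).repr y : ι → D) = y := by ext i; simp
    rw [h2, hy] at h1
    apply hy0
    apply hgbarinj
    rw [map_zero]
    ext i
    have := congrFun h1 i
    simpa using this.symm
  have htg' : ¬ t ∣ LinearMap.det g' := by rwa [← htπ, ← hdetbar]
  have htω : ¬ t ∣ ω := by rwa [← htπ]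
  have hmain : t ^ c * ω * v = LinearMap.det g' * t ^ a := by
    rw [← hd1, ← hv]; ring
  have hca : ω * v = LinearMap.det g' := by
    rcases lt_trichotomy c a with h | rfl | h
    · obtain ⟨s, rfl⟩ := Nat.exists_eq_add_of_lt h
      exfalso
      have : ω * v = t * (t ^ s * LinearMap.det g') :=
        mul_left_cancel₀ (pow_ne_zero c ht0) (by linear_combination hmain)
      exact htω ((Units.dvd_mul_right).mp ⟨_, this⟩)
    · exact mul_left_cancel₀ (pow_ne_zero c ht0) (by linear_combination hmain)
    · obtain ⟨s, rfl⟩ := Nat.exists_eq_add_of_lt h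
      exfalso
      have : LinearMap.det g' = t * (t ^ s * ω * v) :=
        mul_left_cancel₀ (pow_ne_zero a ht0) (by linear_combination -hmain)
      exact htg' ⟨_, this⟩
  rw [← hgbar, length_quotient_range_eq_ord_det gbar hdetbar0, hdetbar, ← hca, map_mul]
  exact Ring.ord_mul_of_isUnit_right (v.isUnit.map π) _

theorem powerBasisAux'_equivFun_symm {R : Type*} [CommRing R] {P : R[X]} (hP : P.Monic)
    (c : Fin P.natDegree → R) :
    (AdjoinRoot.powerBasisAux' hP).equivFun.symm c =
      AdjoinRoot.mk P (∑ i : Fin P.natDegree, monomial (i : ℕ) (c i)) :=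
  rfl

theorem mk_mem_span_mk_iff {R : Type*} [CommRing R] (P w f : R[X]) :
    AdjoinRoot.mk P f ∈ Ideal.span {AdjoinRoot.mk P w} ↔ f ∈ Ideal.span {P, w} := by
  rw [Ideal.mem_span_singleton, Ideal.mem_span_pair]
  constructor
  · rintro ⟨q, hq⟩
    obtain ⟨q, rfl⟩ := AdjoinRoot.mk_surjective q
    rw [← map_mul, AdjoinRoot.mk_eq_mk] at hq
    obtain ⟨s, hs⟩ := hq
    exact ⟨s, q, by linear_combination -hs⟩
  · rintro ⟨a, b, rfl⟩
    exact ⟨AdjoinRoot.mk P b, by simp [mul_comm]⟩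

/-- The length of the special fiber of the closure of the generic fiber of `F = w = 0`: it depends
only on the part of the norm of `w` that is prime to `t`. -/
theorem length_quotient_saturation {Λ D : Type*} [CommRing Λ] [IsDomain Λ] [IsLocalRing Λ]
    [IsNoetherianRing Λ] [CommRing D] [IsDomain D] [IsPrincipalIdealRing D]
    (π : Λ →+* D) (hπ : Function.Surjective π) {t : Λ} (ht : RingHom.ker π = Ideal.span {t})
    (ht0 : t ≠ 0) {F : Λ[X]} (hF : F.Monic) (w : Λ[X]) {c : ℕ} {ω : Λ}
    (hdet : normMod F w = t ^ c * ω) (hω : π ω ≠ 0) (I : Ideal D[X])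
    (hI : ∀ f, f ∈ I ↔ ∃ (g : Λ[X]) (n : ℕ), g.map π = f ∧ C (t ^ n) * g ∈ Ideal.span {F, w}) :
    Module.length D (D[X] ⧸ I) = Ring.ord D (π ω) := by
  classical
  have : Nontrivial D := inferInstance
  let φ := (AdjoinRoot.powerBasisAux' hF).equivFun
  let pD : (Fin F.natDegree → D) →ₗ[D] D[X] := ∑ i : Fin F.natDegree,
      (monomial (i : ℕ)) ∘ₗ LinearMap.proj i
  have hpD : ∀ y, pD y = ∑ i : Fin F.natDegree, monomial (i : ℕ) (y i) := fun y => by simp [pD]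
  have hφs : ∀ x, φ.symm x = AdjoinRoot.mk F (∑ i : Fin F.natDegree, monomial (i : ℕ) (x i)) :=
      fun x =>
    powerBasisAux'_equivFun_symm hF x
  let g : (Fin F.natDegree → Λ) →ₗ[Λ] (Fin F.natDegree → Λ) :=
    φ.toLinearMap ∘ₗ (LinearMap.mulLeft Λ (AdjoinRoot.mk F w)) ∘ₗ φ.symm.toLinearMap
  have hg : LinearMap.det g = t ^ c * ω := by
    rw [← hdet]
    exact LinearMap.det_conj _ φ
  have hrange : ∀ x, x ∈ LinearMap.range g ↔ φ.symm x ∈ Ideal.span {AdjoinRoot.mk F w} := by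
    intro x
    rw [Ideal.mem_span_singleton]
    constructor
    · rintro ⟨y, rfl⟩
      exact ⟨φ.symm y, by simp [g]⟩
    · rintro ⟨q, hq⟩
      refine ⟨φ q, ?_⟩
      rw [LinearMap.comp_apply, LinearMap.comp_apply, LinearEquiv.coe_coe, LinearEquiv.coe_coe,
        LinearEquiv.symm_apply_apply, LinearMap.mulLeft_apply, ← hq, LinearEquiv.apply_symm_apply]
  let H : Submodule Λ (Fin F.natDegree → Λ) :=
    { carrier := {x | ∃ n : ℕ, t ^ n • x ∈ LinearMap.range g}
      zero_mem' := ⟨0, by simp⟩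
      add_mem' := by
        rintro x y ⟨n, hn⟩ ⟨m, hm⟩
        refine ⟨n + m, ?_⟩
        rw [smul_add]
        refine Submodule.add_mem _ ?_ ?_
        · rw [add_comm, pow_add, mul_smul]; exact Submodule.smul_mem _ _ hn
        · rw [pow_add, mul_smul]; exact Submodule.smul_mem _ _ hm
      smul_mem' := by
        rintro a x ⟨n, hn⟩
        exact ⟨n, by rw [smul_comm]; exact Submodule.smul_mem _ _ hn⟩ }
  have hHmem : ∀ x, x ∈ H ↔ ∃ n : ℕ, C (t ^ n) * (∑ i : Fin F.natDegree, monomial (i : ℕ) (x i)) ∈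
      Ideal.span {F, w} := by
    intro x
    refine exists_congr fun n => ?_
    rw [hrange, map_smul, hφs, ← mk_mem_span_mk_iff, map_mul, AdjoinRoot.mk_C, Algebra.smul_def]
    rfl
  let Hbar : Submodule D (Fin F.natDegree → D) := (I.restrictScalars D).comap pD
  have hmapp : ∀ x : Fin F.natDegree → Λ, (∑ i : Fin F.natDegree, monomial (i : ℕ) (x i)).map π =
      pD fun i => π (x i) := by
    intro x
    rw [hpD, Polynomial.map_sum]
    simp
  have hFI : F.map π ∈ I := (hI _).mpr ⟨F, 0, rfl, by
    simpa using Ideal.subset_span (by simp)⟩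
  have hcoeff : ∀ y (i : Fin F.natDegree), (pD y).coeff i = y i := fun y i => by
    rw [hpD, finsetSum_coeff, Finset.sum_eq_single i]
    · simp
    · intro j _ hj
      rw [coeff_monomial, if_neg (by simpa [Fin.ext_iff] using hj)]
    · simp
  have hpdeg : ∀ y, (pD y).degree < (F.map π).degree := fun y => by
    rw [degree_eq_natDegree (hF.map π).ne_zero, hF.natDegree_map, hpD]
    simp_rw [← C_mul_X_pow_eq_monomial]
    exact degree_sum_fin_lt _
  have hlen := length_quotient_of_saturated π hπ ht ht0 g H
    (fun x hx => ⟨0, by simpa using hx⟩) (fun x hx => hx)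
    (fun x ⟨n, hn⟩ => ⟨n + 1, by rwa [pow_succ, mul_smul]⟩) hg hω Hbar (fun y => by
      rw [Submodule.mem_comap, Submodule.restrictScalars_mem, hI]
      constructor
      · rintro ⟨f, n, hf, hfn⟩
        refine ⟨fun i => (f %ₘ F).coeff i, (hHmem _).mpr ⟨n, ?_⟩, ?_⟩
        · rw [sum_modByMonic_coeff hF degree_le_natDegree, modByMonic_eq_sub_mul_div f F, mul_sub]
          refine Ideal.sub_mem _ hfn (Ideal.mul_mem_left _ _ (Ideal.mul_mem_right _ _ ?_))
          exact Ideal.subset_span (by simp)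
        · funext i
          rw [← hcoeff y i, ← Polynomial.coeff_map, map_modByMonic π hF, hf,
            (modByMonic_eq_self_iff (hF.map π)).mpr (hpdeg y)]
      · rintro ⟨x, hx, rfl⟩
        obtain ⟨n, hn⟩ := (hHmem x).mp hx
        exact ⟨_, n, hmapp x, hn⟩)
  rw [← hlen]
  let f : (Fin F.natDegree → D) →ₗ[D] D[X] ⧸ I.restrictScalars D := (I.restrictScalars D).mkQ ∘ₗ pD
  have hker : LinearMap.ker f = Hbar := by
    rw [LinearMap.ker_comp, Submodule.ker_mkQ]
  have hsurj : Function.Surjective f := by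
    intro z
    obtain ⟨z, rfl⟩ := Submodule.mkQ_surjective _ z
    refine ⟨fun i => (z %ₘ F.map π).coeff i, ?_⟩
    rw [LinearMap.comp_apply, hpD, sum_modByMonic_coeff (hF.map π)
        (degree_map_le.trans degree_le_natDegree),
      Submodule.mkQ_apply, Submodule.mkQ_apply, Submodule.Quotient.eq,
      modByMonic_eq_sub_mul_div z (F.map π), sub_sub_cancel_left]
    exact I.neg_mem (I.mul_mem_right _ hFI)
  rw [← hker, (LinearMap.quotKerEquivOfSurjective f hsurj).length_eq]
  exact (Submodule.Quotient.restrictScalarsEquiv D I).length_eq.symm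

/-- The colength of the ideal of a monic polynomial `P` and another one `x` is the order of the
norm of `x` modulo `P`. -/
theorem length_quotient_span_pair {D : Type*} [CommRing D] [IsDomain D] [IsPrincipalIdealRing D]
    {P : D[X]} (hP : P.Monic) (x : D[X]) (hx : normMod P x ≠ 0) :
    Module.length D (D[X] ⧸ Ideal.span {P, x}) = Ring.ord D (normMod P x) := by
  have := hP.free_adjoinRoot
  have := hP.finite_adjoinRoot
  have h := length_quotient_range_eq_ord_det (LinearMap.mulLeft D (AdjoinRoot.mk P x)) hx
  refine Eq.trans ?_ h
  let N := LinearMap.range (LinearMap.mulLeft D (AdjoinRoot.mk P x))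
  let f : D[X] →ₗ[D] AdjoinRoot P ⧸ N := N.mkQ ∘ₗ (AdjoinRoot.mkₐ P).toLinearMap
  have hker : LinearMap.ker f = (Ideal.span {P, x}).restrictScalars D := by
    ext y
    rw [LinearMap.ker_comp, Submodule.ker_mkQ, Submodule.mem_comap, Submodule.restrictScalars_mem,
      ← mk_mem_span_mk_iff, Ideal.mem_span_singleton]
    constructor
    · rintro ⟨q, hq⟩
      exact ⟨q, hq.symm⟩
    · rintro ⟨q, hq⟩
      exact ⟨q, hq.symm⟩
  have hsurj : Function.Surjective f :=
    (Submodule.mkQ_surjective N).comp AdjoinRoot.mk_surjective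
  rw [← (LinearMap.quotKerEquivOfSurjective f hsurj).length_eq, hker]
  exact (Submodule.Quotient.restrictScalarsEquiv D (Ideal.span {P, x})).length_eq.symm

/-! ### Localization at a point of a fiber -/

/-- If `X = 0` is the only point of the scheme of `J` over the closed point of `D`, then functions
nonzero at this point are units on the scheme. -/
theorem isUnit_mk_of_coeff_zero {D : Type*} [CommRing D] [IsLocalRing D] {J : Ideal D[X]}
    {P : D[X]} (hP : P.Monic) (hPJ : P ∈ J) {e : ℕ}
    (he : X ^ e ∈ J ⊔ (maximalIdeal D).map C) {f : D[X]} (hf : IsUnit (f.coeff 0)) :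
    IsUnit (Ideal.Quotient.mk J f) := by
  let I := Ideal.span {f} ⊔ J
  have hfin : Module.Finite D (D[X] ⧸ I) := by
    have := hP.finite_quotient
    have hle : Ideal.span {P} ≤ I := by
      rw [Ideal.span_le, Set.singleton_subset_iff]
      exact Ideal.mem_sup_right hPJ
    exact Module.Finite.of_surjective (Ideal.Quotient.factorₐ D hle).toLinearMap
      (Ideal.Quotient.factor_surjective hle)
  have h1 : (1 : D[X]) ∈ I ⊔ (maximalIdeal D).map C := by
    let L := I ⊔ (maximalIdeal D).map C
    have hX : Ideal.Quotient.mk L X ^ e = 0 := by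
      rw [← map_pow, Ideal.Quotient.eq_zero_iff_mem]
      exact (sup_le_sup_right (le_sup_right : J ≤ I) ((maximalIdeal D).map C) :) he
    have hfL : Ideal.Quotient.mk L f = 0 := by
      rw [Ideal.Quotient.eq_zero_iff_mem]
      exact Ideal.mem_sup_left (Ideal.mem_sup_left (Ideal.mem_span_singleton_self f))
    rw [← Ideal.Quotient.eq_zero_iff_mem, map_one]
    have h2 : Ideal.Quotient.mk L (C (f.coeff 0)) =
        - (Ideal.Quotient.mk L X * Ideal.Quotient.mk L f.divX) := by
      rw [← f.X_mul_divX_add] at hfL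
      rw [map_add, map_mul] at hfL
      exact eq_neg_of_add_eq_zero_right hfL
    have h3 : Ideal.Quotient.mk L (C (f.coeff 0)) ^ e = 0 := by
      rw [h2, neg_pow, mul_pow, hX, zero_mul, mul_zero]
    have h4 : IsUnit (0 : D[X] ⧸ L) := h3 ▸ ((hf.map C).map (Ideal.Quotient.mk L)).pow e
    exact (isUnit_zero_iff.mp h4).symm
  have htop : I = ⊤ := by
    rw [← Ideal.Quotient.subsingleton_iff, ← Submodule.subsingleton_iff D,
        ← subsingleton_iff_bot_eq_top, eq_comm]
    refine Submodule.eq_bot_of_le_smul_of_le_jacobson_bot (maximalIdeal D) ⊤ hfin.1 ?_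
      (by rw [IsLocalRing.jacobson_eq_maximalIdeal ⊥ bot_ne_top])
    rw [Ideal.smul_top_eq_map]
    have h5 : (maximalIdeal D).map (algebraMap D (D[X] ⧸ I)) = ⊤ := by
      rw [Ideal.eq_top_iff_one]
      obtain ⟨i, hi, m, hm, him⟩ := Submodule.mem_sup.mp h1
      have : (1 : D[X] ⧸ I) = Ideal.Quotient.mk I m := by
        rw [← map_one (Ideal.Quotient.mk I), ← him, map_add, Ideal.Quotient.eq_zero_iff_mem.mpr hi,
          zero_add]
      rw [this, IsScalarTower.algebraMap_eq D D[X] (D[X] ⧸ I), ← Ideal.map_map]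
      exact Ideal.mem_map_of_mem _ hm
    rw [h5]
    exact fun _ _ => trivial
  have hmem : (1 : D[X]) ∈ I := htop ▸ trivial
  obtain ⟨a, ha, b, hb, hab⟩ := Submodule.mem_sup.mp hmem
  obtain ⟨r, rfl⟩ := Ideal.mem_span_singleton'.mp ha
  refine IsUnit.of_mul_eq_one (Ideal.Quotient.mk J r) ?_
  rw [← map_mul, ← map_one (Ideal.Quotient.mk J), ← hab, map_add,
    Ideal.Quotient.eq_zero_iff_mem.mpr hb, add_zero, mul_comm]

/-- The length of the local ring of a subscheme at the point `p` equals its length over the local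
ring `D` of the image of `p` under a projection, if `p` is the only point over that image. -/
theorem length_localization_eq {S D : Type*} [CommRing S] [CommRing D] [IsLocalRing D]
    (j : S →+* D[X]) (hj : Function.Injective j)
    (hloc : ∀ f : D[X], ∃ s m : S, IsUnit (j m) ∧ f * j m = j s)
    (p : Ideal S) [p.IsPrime] (hp : ∀ s, s ∈ p ↔ (j s).coeff 0 ∈ maximalIdeal D)
    (J : Ideal S) {P : D[X]} (hP : P.Monic) (hPJ : P ∈ J.map j) {e : ℕ}
    (he : X ^ e ∈ J.map j ⊔ (maximalIdeal D).map C) :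
    Module.length (Localization.AtPrime p)
      (Localization.AtPrime p ⧸ J.map (algebraMap S (Localization.AtPrime p))) =
    Module.length D (D[X] ⧸ J.map j) := by
  let B := D[X] ⧸ J.map j
  let q : D[X] →+* B := Ideal.Quotient.mk _
  have hunit : ∀ m, IsUnit (j m) → m ∈ p.primeCompl := fun m hm hmp =>
    (IsLocalRing.mem_maximalIdeal _).mp ((hp m).mp hmp)
      (by simpa [coeff_zero_eq_eval_zero] using hm.map (evalRingHom 0))
  have hJmap : ∀ f, f ∈ J.map j → ∃ m a, IsUnit (j m) ∧ a ∈ J ∧ f * j m = j a := by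
    intro f hf
    induction hf using Submodule.span_induction with
    | mem x hx =>
      obtain ⟨a, ha, rfl⟩ := hx
      exact ⟨1, a, by simp, ha, by simp⟩
    | zero => exact ⟨1, 0, by simp, J.zero_mem, by simp⟩
    | add x y _ _ hx hy =>
      obtain ⟨m, a, hm, ha, h1⟩ := hx
      obtain ⟨m', a', hm', ha', h2⟩ := hy
      refine ⟨m * m', a * m' + a' * m, by rw [map_mul]; exact hm.mul hm',
        J.add_mem (J.mul_mem_right _ ha) (J.mul_mem_right _ ha'), ?_⟩
      simp only [map_mul, map_add, ← h1, ← h2]; ring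
    | smul r x _ hx =>
      obtain ⟨m, a, hm, ha, h1⟩ := hx
      obtain ⟨s, m', hm', h2⟩ := hloc r
      refine ⟨m * m', s * a, by rw [map_mul]; exact hm.mul hm', J.mul_mem_left _ ha, ?_⟩
      simp only [map_mul, ← h1, ← h2, smul_eq_mul]; ring
  have hpunit : ∀ s : p.primeCompl, IsUnit ((q.comp j) s) := fun s => by
    refine isUnit_mk_of_coeff_zero hP hPJ he ?_
    have : (s : S) ∉ p := s.2
    rw [hp, IsLocalRing.mem_maximalIdeal, mem_nonunits_iff, not_not] at this
    exact this
  let σ : Localization.AtPrime p →+* B := IsLocalization.lift hpunit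
  have hσ : ∀ s, σ (algebraMap S _ s) = q (j s) := fun s => IsLocalization.lift_eq hpunit s
  have hσsurj : Function.Surjective σ := by
    intro b
    obtain ⟨f, rfl⟩ := Ideal.Quotient.mk_surjective b
    obtain ⟨s, m, hm, hf⟩ := hloc f
    refine ⟨IsLocalization.mk' _ s ⟨m, hunit m hm⟩, ?_⟩
    rw [IsLocalization.lift_mk'_spec]
    change q (j s) = q (j m) * q f
    rw [← map_mul, mul_comm, hf]
  have hσker : RingHom.ker σ = J.map (algebraMap S (Localization.AtPrime p)) := by
    apply le_antisymm
    · intro x hx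
      obtain ⟨s, u, rfl⟩ := IsLocalization.exists_mk'_eq p.primeCompl x
      rw [RingHom.mem_ker, IsLocalization.lift_mk'_spec, mul_zero] at hx
      obtain ⟨m, a, hm, ha, h1⟩ := hJmap (j s) (Ideal.Quotient.eq_zero_iff_mem.mp hx)
      rw [← map_mul] at h1
      have h2 : s * m = a := hj h1
      rw [IsLocalization.mk'_mem_iff, ← Ideal.mul_unit_mem_iff_mem _
        (IsLocalization.map_units (Localization.AtPrime p) ⟨m, hunit m hm⟩), ← map_mul, h2]
      exact Ideal.mem_map_of_mem _ ha
    · rw [Ideal.map_le_iff_le_comap]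
      intro a ha
      rw [Ideal.mem_comap, RingHom.mem_ker, hσ, Ideal.Quotient.eq_zero_iff_mem]
      exact Ideal.mem_map_of_mem _ ha
  algebraize [σ]
  have hlen1 : Module.length (Localization.AtPrime p)
      (Localization.AtPrime p ⧸ J.map (algebraMap S (Localization.AtPrime p))) =
      Module.length B B := by
    rw [← hσker, ← Module.length_eq_of_surjective (S := Localization.AtPrime p) (R := B) (M := B)
      hσsurj]
    exact (LinearMap.quotKerEquivOfSurjective (Algebra.linearMap (Localization.AtPrime p) B)
      hσsurj).length_eq
  rw [hlen1]
  change _ = Module.length D B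
  rcases subsingleton_or_nontrivial B with hB | hB
  · simp [Module.length_eq_zero]
  have hBlocal : IsLocalRing B := IsLocalRing.of_surjective' σ hσsurj
  have hBfin : Module.Finite D B := by
    have := hP.finite_quotient
    have hle : Ideal.span {P} ≤ J.map j := by
      rwa [Ideal.span_le, Set.singleton_subset_iff]
    exact Module.Finite.of_surjective (Ideal.Quotient.factorₐ D hle).toLinearMap
      (Ideal.Quotient.factor_surjective hle)
  have hmB : ∀ d ∈ maximalIdeal D, algebraMap D B d ∈ maximalIdeal B := by
    intro d hd
    rw [IsLocalRing.mem_maximalIdeal, mem_nonunits_iff]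
    intro hu
    have h1 : (⊤ : Submodule D B) = ⊥ := by
      refine Submodule.eq_bot_of_le_smul_of_le_jacobson_bot (maximalIdeal D) ⊤ hBfin.1 ?_
        (by rw [IsLocalRing.jacobson_eq_maximalIdeal ⊥ bot_ne_top])
      intro b _
      obtain ⟨c, rfl⟩ := hu.dvd (a := b)
      rw [← Algebra.smul_def]
      exact Submodule.smul_mem_smul hd trivial
    exact not_subsingleton B
        ((Submodule.subsingleton_iff D).mp (subsingleton_of_bot_eq_top h1.symm))
  have : IsLocalHom (algebraMap D B) := ⟨fun d hd => by
    by_contra h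
    exact (IsLocalRing.mem_maximalIdeal _).mp (hmB d ((IsLocalRing.mem_maximalIdeal d).mpr h)) hd⟩
  have hXB : q X ∈ maximalIdeal B := by
    refine (maximalIdeal.isMaximal B).isPrime.mem_of_pow_mem e ?_
    rw [← map_pow]
    obtain ⟨i, hi, m, hm, him⟩ := Submodule.mem_sup.mp he
    rw [← him, map_add, Ideal.Quotient.eq_zero_iff_mem.mpr hi, zero_add]
    have : (maximalIdeal D).map C ≤ (maximalIdeal B).comap q := by
      rw [Ideal.map_le_iff_le_comap]
      exact fun d hd => hmB d hd
    exact this hm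
  have hres : Function.Surjective (algebraMap (ResidueField D) (ResidueField B)) := by
    intro b
    obtain ⟨b, rfl⟩ := residue_surjective b
    obtain ⟨f, rfl⟩ := Ideal.Quotient.mk_surjective b
    refine ⟨residue D (f.coeff 0), ?_⟩
    change residue B (algebraMap D B (f.coeff 0)) = residue B (q f)
    rw [eq_comm, ← sub_eq_zero, ← map_sub, residue_eq_zero_iff]
    have h1 : q f - algebraMap D B (f.coeff 0) = q X * q f.divX := by
      change q f - q (C (f.coeff 0)) = _
      rw [← map_sub, ← map_mul]
      congr 1
      rw [sub_eq_iff_eq_add, f.X_mul_divX_add]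
    rw [h1]
    exact Ideal.mul_mem_right _ _ hXB
  rw [IsLocalRing.length_restrictScalars D B B, Module.length_eq_of_surjective hres,
    Module.length_eq_one (ResidueField B) (ResidueField B), mul_one]

end Univariate

open MvPolynomial

/-! ### Wronskians of derivations -/

/-- The iterates of a derivation `D`, modulo a stable ideal, in terms of the sequence `u` that is
obtained by dividing by `f` after each step: the matrix of the expansion is triangular, with the
powers of `f` on the diagonal. -/
theorem exists_iterate_expansion {K A ι : Type*} [CommRing K] [CommRing A] [Algebra K A]
    (I : Ideal A) (D : Derivation K A A) (hI : ∀ a ∈ I, D a ∈ I) (f : A) (u : ℕ → ι → A)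
    (γ : ℕ → A) (h : ∀ l j, D (u l j) - (f * u (l + 1) j + γ l * u l j) ∈ I) (i : ℕ) :
    ∃ c : ℕ → A, c i = f ^ i ∧ (∀ l, i < l → c l = 0) ∧
      ∀ j, (⇑D)^[i] (u 0 j) - ∑ l ∈ Finset.range (i + 1), c l * u l j ∈ I := by
  induction i with
  | zero =>
    refine ⟨fun l => if l = 0 then 1 else 0, by simp, fun l hl => by simp [hl.ne'], fun j => ?_⟩
    simp
  | succ i ih =>
    obtain ⟨c, hc, hc0, hcj⟩ := ih
    refine ⟨fun l => D (c l) + c l * γ l + (if l = 0 then 0 else c (l - 1) * f), ?_, ?_, fun j =>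
        ?_⟩
    · simp [hc0 (i + 1) (Nat.lt_succ_self i), hc, pow_succ]
    · intro l hl
      simp [hc0 l (by omega), hc0 (l - 1) (by omega)]
    · rw [Function.iterate_succ_apply']
      have h1 : D ((⇑D)^[i] (u 0 j)) - D (∑ l ∈ Finset.range (i + 1), c l * u l j) ∈ I := by
        rw [← map_sub]; exact hI _ (hcj j)
      have h2 : D (∑ l ∈ Finset.range (i + 1), c l * u l j) -
          ∑ l ∈ Finset.range (i + 1), (D (c l) * u l j + c l * (f * u (l + 1) j + γ l * u l j)) ∈
              I := by
        rw [map_sum, ← Finset.sum_sub_distrib]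
        refine I.sum_mem fun l _ => ?_
        rw [Derivation.leibniz]
        have : c l • D (u l j) + u l j • D (c l) -
            (D (c l) * u l j + c l * (f * u (l + 1) j + γ l * u l j)) =
            c l * (D (u l j) - (f * u (l + 1) j + γ l * u l j)) := by
          simp only [smul_eq_mul]; ring
        rw [this]
        exact I.mul_mem_left _ (h l j)
      have h3 : ∑ l ∈ Finset.range (i + 1),
          (D (c l) * u l j + c l * (f * u (l + 1) j + γ l * u l j)) =
          ∑ l ∈ Finset.range (i + 1 + 1),
            (D (c l) + c l * γ l + (if l = 0 then 0 else c (l - 1) * f)) * u l j := by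
        simp only [add_mul _ _ (u _ j), Finset.sum_add_distrib]
        rw [Finset.sum_range_succ (fun l => D (c l) * u l j) (i + 1),
          Finset.sum_range_succ (fun l => c l * γ l * u l j) (i + 1),
          Finset.sum_range_succ' (fun l => (if l = 0 then 0 else c (l - 1) * f) * u l j) (i + 1)]
        simp only [hc0 (i + 1) (Nat.lt_succ_self i), map_zero, zero_mul, add_zero, mul_add,
          Finset.sum_add_distrib, if_true, Nat.add_sub_cancel, Nat.succ_ne_zero, if_false]
        have e1 : ∀ l, c l * (f * u (l + 1) j) = c l * f * u (l + 1) j := fun l => by ring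
        have e2 : ∀ l, c l * (γ l * u l j) = c l * γ l * u l j := fun l => by ring
        simp only [e1, e2]
        ring
      rw [← h3]
      simpa using I.add_mem h1 h2

theorem sum_fin_val (n : ℕ) : ∑ i : Fin n, (i : ℕ) = n.choose 2 := by
  rw [Fin.sum_univ_eq_sum_range (fun i => i), Finset.sum_range_id, Nat.choose_two_right]

/-- If `D u_l ≡ f u_{l+1} + γ_l u_l` modulo a `D`-stable ideal, the Wronskian of `u_0` is
`f ^ (n choose 2)` times the determinant of the `u_l`. -/
theorem wronskian_sub_mem {K : Type*} [CommRing K] (I : Ideal (Poly3 K))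
    (D : Derivation K (Poly3 K) (Poly3 K)) (hI : ∀ a ∈ I, D a ∈ I) (f : Poly3 K) {n : ℕ}
    (u : ℕ → Fin n → Poly3 K) (γ : ℕ → Poly3 K)
    (h : ∀ l j, D (u l j) - (f * u (l + 1) j + γ l * u l j) ∈ I) :
    wronskian D (u 0) - f ^ (n.choose 2) * Matrix.det (Matrix.of fun i j : Fin n => u i j) ∈ I := by
  choose c hc hc0 hcj using exists_iterate_expansion I D hI f u γ h
  let q := Ideal.Quotient.mk I
  rw [← Ideal.Quotient.eq_zero_iff_mem, map_sub, sub_eq_zero, map_mul, wronskian, RingHom.map_det,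
    RingHom.map_det]
  let Cm : Matrix (Fin n) (Fin n) (Poly3 K) := Matrix.of fun i l => c i l
  have hCm : Cm.det = f ^ (n.choose 2) := by
    rw [Matrix.det_of_isLowerTriangular]
    · simp only [Cm, Matrix.of_apply, hc, Finset.prod_pow_eq_pow_sum, sum_fin_val]
    · intro i l hil
      exact hc0 i l hil
  rw [← hCm, RingHom.map_det, ← Matrix.det_mul]
  congr 1
  ext i j
  simp only [RingHom.mapMatrix_apply, Matrix.map_apply, Matrix.of_apply, Matrix.mul_apply, Cm]
  rw [← sub_eq_zero]
  have h1 := Ideal.Quotient.eq_zero_iff_mem.mpr (hcj i j)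
  rw [map_sub, map_sum] at h1
  rw [← h1]
  congr 1
  simp only [← map_mul]
  rw [Fin.sum_univ_eq_sum_range (fun l => (Ideal.Quotient.mk I) (c i l * u l j)) n]
  symm
  apply Finset.sum_subset
  · intro l hl
    rw [Finset.mem_range] at hl ⊢
    omega
  · intro l _ hl
    rw [Finset.mem_range, not_lt] at hl
    rw [hc0 i l (by omega), zero_mul, map_zero]

theorem wronskian_sub_mem_of_forall {K : Type*} [CommRing K] (I : Ideal (Poly3 K))
    (D D' : Derivation K (Poly3 K) (Poly3 K)) (hI : ∀ a ∈ I, D a ∈ I) (f : Poly3 K)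
    (h : ∀ a, D a - f * D' a ∈ I) {n : ℕ} (v : Fin n → Poly3 K) :
    wronskian D v - f ^ (n.choose 2) * wronskian D' v ∈ I := by
  have := wronskian_sub_mem I D hI f (fun l j => (⇑D')^[l] (v j)) (fun _ => 0) (fun l j => by
    simpa only [zero_mul, add_zero, Function.iterate_succ_apply'] using h _)
  exact this

theorem wronskian_smul {K : Type*} [CommRing K] (D : Derivation K (Poly3 K) (Poly3 K))
    (f : Poly3 K) {n : ℕ} (v : Fin n → Poly3 K) :
    wronskian (f • D) v = f ^ (n.choose 2) * wronskian D v := by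
  have := wronskian_sub_mem_of_forall ⊥ (f • D) D (fun a ha => by
    rw [Ideal.mem_bot.mp ha, map_zero]; exact Ideal.zero_mem _) f (fun a => by simp) v
  exact sub_eq_zero.mp (Ideal.mem_bot.mp this)

/-! ### The derivations `∂_{P,L}` -/

/-- The linear form with coefficients `a`. -/
def linearForm {K : Type*} [CommRing K] (a : Fin 3 → K) : Poly3 K := ∑ i, C (a i) * X i

theorem pderiv_linearForm {K : Type*} [CommRing K] (a : Fin 3 → K) (i : Fin 3) :
    pderiv i (linearForm a) = C (a i) := by
  simp only [linearForm, map_sum, pderiv_C_mul, pderiv_X, Pi.single_apply]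
  simp

theorem linearForm_isHomogeneous {K : Type*} [CommRing K] (a : Fin 3 → K) :
    (linearForm a).IsHomogeneous 1 := by
  refine IsHomogeneous.sum _ _ _ fun i _ => ?_
  simpa using (isHomogeneous_C (Fin 3) (a i)).mul (isHomogeneous_X K i)

theorem X_eq_linearForm {K : Type*} [CommRing K] (i : Fin 3) :
    (X i : Poly3 K) = linearForm (Pi.single i 1) := by
  simp only [linearForm, Pi.single_apply]
  simp

theorem jacobianDerivation_apply {K : Type*} [CommRing K] (P Q G : Poly3 K) :
    jacobianDerivation P Q G =
      (pderiv 1 P * pderiv 2 Q - pderiv 2 P * pderiv 1 Q) * pderiv 0 G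
      - (pderiv 0 P * pderiv 2 Q - pderiv 2 P * pderiv 0 Q) * pderiv 1 G
      + (pderiv 0 P * pderiv 1 Q - pderiv 1 P * pderiv 0 Q) * pderiv 2 G := rfl

theorem jacobianDerivation_self {K : Type*} [CommRing K] (P Q : Poly3 K) :
    jacobianDerivation P Q P = 0 := by
  rw [jacobianDerivation_apply]; ring

theorem jacobianDerivation_mul_left {K : Type*} [CommRing K] (P P' Q G : Poly3 K) :
    jacobianDerivation (P * P') Q G =
      P * jacobianDerivation P' Q G + P' * jacobianDerivation P Q G := by
  simp only [jacobianDerivation_apply, Derivation.leibniz, smul_eq_mul]; ring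

theorem jacobianDerivation_add_left {K : Type*} [CommRing K] (P P' Q G : Poly3 K) :
    jacobianDerivation (P + P') Q G = jacobianDerivation P Q G + jacobianDerivation P' Q G := by
  simp only [jacobianDerivation_apply, map_add]; ring

theorem jacobianDerivation_mem_span {K : Type*} [CommRing K] (P Q : Poly3 K) :
    ∀ a ∈ Ideal.span {P}, jacobianDerivation P Q a ∈ Ideal.span {P} := by
  intro a ha
  obtain ⟨b, rfl⟩ := Ideal.mem_span_singleton'.mp ha
  rw [Derivation.leibniz, jacobianDerivation_self, smul_zero, zero_add, smul_eq_mul]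
  exact Ideal.mul_mem_right _ _ (Ideal.mem_span_singleton_self P)

theorem isHomogeneous_linearForm_mul_jacobianDerivation {K : Type*} [CommRing K] {P G : Poly3 K}
    {e g : ℕ} (hP : P.IsHomogeneous e) (hG : G.IsHomogeneous g) (a a' : Fin 3 → K) :
    (linearForm a' * jacobianDerivation P (linearForm a) G).IsHomogeneous (g + (e - 1)) := by
  rcases Nat.eq_zero_or_pos g with rfl | hg
  · have : jacobianDerivation P (linearForm a) G = 0 := by
      obtain ⟨c, rfl⟩ : ∃ c, G = C c := ⟨G.coeff 0, (totalDegree_eq_zero_iff_eq_C).mp (by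
        exact Nat.le_zero.mp hG.totalDegree_le)⟩
      exact Derivation.map_algebraMap _ c
    rw [this, mul_zero]
    exact isHomogeneous_zero _ _ _
  · have h1 : g + (e - 1) = 1 + ((e - 1) + (g - 1)) := by omega
    rw [h1]
    refine (linearForm_isHomogeneous a').mul ?_
    rw [jacobianDerivation_apply]
    simp only [pderiv_linearForm]
    have key : ∀ i j l : Fin 3, (pderiv i P * C (a j)).IsHomogeneous (e - 1) := fun i j l => by
      simpa using (hP.pderiv (i := i)).mul (isHomogeneous_C (Fin 3) (a j))
    exact ((((key 1 2 0).sub (key 2 1 0)).mul hG.pderiv).sub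
      (((key 0 2 0).sub (key 2 0 0)).mul hG.pderiv)).add
      (((key 0 1 0).sub (key 1 0 0)).mul hG.pderiv)

/-- By Euler's identity the derivations attached to two linear forms agree on `P = 0`, up to the
linear forms and a multiple of the identity depending on the degree only. -/
theorem linearForm_mul_jacobianDerivation_sub {K : Type*} [CommRing K] {P G : Poly3 K} {e g : ℕ}
    (hP : P.IsHomogeneous e) (hG : G.IsHomogeneous g) (a a' : Fin 3 → K) :
    ∃ s, linearForm a * jacobianDerivation P (linearForm a') G -
      linearForm a' * jacobianDerivation P (linearForm a) G =
      (g : Poly3 K) * (pderiv 0 P * (C (a 2) * C (a' 1) - C (a 1) * C (a' 2))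
        + pderiv 1 P * (C (a 0) * C (a' 2) - C (a 2) * C (a' 0))
        + pderiv 2 P * (C (a 1) * C (a' 0) - C (a 0) * C (a' 1))) * G + s * P := by
  have h1 := hP.sum_X_mul_pderiv
  have h2 := hG.sum_X_mul_pderiv
  rw [Fin.sum_univ_three, nsmul_eq_mul] at h1 h2
  refine ⟨- (e : Poly3 K) * (pderiv 0 G * (C (a 2) * C (a' 1) - C (a 1) * C (a' 2))
        + pderiv 1 G * (C (a 0) * C (a' 2) - C (a 2) * C (a' 0))
        + pderiv 2 G * (C (a 1) * C (a' 0) - C (a 0) * C (a' 1))), ?_⟩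
  have e1 : ∀ b : Fin 3 → K, linearForm b = C (b 0) * X 0 + C (b 1) * X 1 + C (b 2) * X 2 :=
    fun b => by rw [linearForm, Fin.sum_univ_three]
  rw [jacobianDerivation_apply, jacobianDerivation_apply]
  simp only [pderiv_linearForm]
  rw [e1, e1]
  linear_combination (pderiv 0 P * (C (a 2) * C (a' 1) - C (a 1) * C (a' 2))
        + pderiv 1 P * (C (a 0) * C (a' 2) - C (a 2) * C (a' 0))
        + pderiv 2 P * (C (a 1) * C (a' 0) - C (a 0) * C (a' 1))) *
            h2 - (pderiv 0 G * (C (a 2) * C (a' 1) - C (a 1) * C (a' 2))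
        + pderiv 1 G * (C (a 0) * C (a' 2) - C (a 2) * C (a' 0))
        + pderiv 2 G * (C (a 1) * C (a' 0) - C (a 0) * C (a' 1))) * h1

/-- On the curve `P = 0` the Wronskians with respect to `∂_{P,L}` and `∂_{P,L'}` differ by a power
of `L / L'`. -/
theorem linearForm_pow_mul_wronskian_sub_mem {K : Type*} [CommRing K] {P : Poly3 K} {e d n : ℕ}
    (hP : P.IsHomogeneous e) {v : Fin n → Poly3 K} (hv : ∀ j, (v j).IsHomogeneous d)
    (a a' : Fin 3 → K) :
    linearForm a ^ (n.choose 2) * wronskian (jacobianDerivation P (linearForm a')) v -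
      linearForm a' ^ (n.choose 2) * wronskian (jacobianDerivation P (linearForm a)) v ∈
      Ideal.span {P} := by
  rw [← wronskian_smul, ← wronskian_smul]
  set D := linearForm a • jacobianDerivation P (linearForm a')
  set D' := linearForm a' • jacobianDerivation P (linearForm a)
  have hhom : ∀ l j, ((⇑D')^[l] (v j)).IsHomogeneous (d + l * (e - 1)) := by
    intro l j
    induction l with
    | zero => simpa using hv j
    | succ l ih =>
      rw [Function.iterate_succ_apply', Nat.succ_mul, ← add_assoc]
      exact isHomogeneous_linearForm_mul_jacobianDerivation hP ih a a'
  have h := wronskian_sub_mem (Ideal.span {P}) D (fun x hx =>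
      Ideal.mul_mem_left _ _ (jacobianDerivation_mem_span P _ x hx)) 1
    (fun l j => (⇑D')^[l] (v j)) (fun l => ((d + l * (e - 1) : ℕ) : Poly3 K) *
      (pderiv 0 P * (C (a 2) * C (a' 1) - C (a 1) * C (a' 2))
        + pderiv 1 P * (C (a 0) * C (a' 2) - C (a 2) * C (a' 0))
        + pderiv 2 P * (C (a 1) * C (a' 0) - C (a 0) * C (a' 1)))) (fun l j => by
      obtain ⟨s, hs⟩ := linearForm_mul_jacobianDerivation_sub hP (hhom l j) a a'
      rw [Ideal.mem_span_singleton']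
      refine ⟨s, ?_⟩
      rw [Function.iterate_succ_apply']
      simp only [D, Derivation.smul_apply, smul_eq_mul] at hs ⊢
      change _ = _ - (1 * (linearForm a' * jacobianDerivation P (linearForm a) _) + _)
      linear_combination -hs)
  rw [one_pow, one_mul] at h
  exact h

/-! ### Ramification ideals -/

theorem iterate_derivation_sum {K ι : Type*} [CommRing K] [Fintype ι]
    (D : Derivation K (Poly3 K) (Poly3 K)) (v : ι → Poly3 K) (c : ι → K) (i : ℕ) :
    (⇑D)^[i] (∑ l, C (c l) * v l) = ∑ l, C (c l) * (⇑D)^[i] (v l) := by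
  induction i with
  | zero => rfl
  | succ i ih =>
    rw [Function.iterate_succ_apply', ih, map_sum]
    refine Finset.sum_congr rfl fun l _ => ?_
    rw [Function.iterate_succ_apply', C_mul', C_mul', Derivation.map_smul]

theorem wronskian_linear_combination {K : Type*} [CommRing K]
    (D : Derivation K (Poly3 K) (Poly3 K)) {n : ℕ} (v : Fin n → Poly3 K)
    (M : Matrix (Fin n) (Fin n) K) :
    wronskian D (fun j => ∑ l, C (M l j) * v l) = wronskian D v * C M.det := by
  rw [wronskian, wronskian, RingHom.map_det, ← Matrix.det_mul]
  congr 1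
  ext1 i j
  rw [Matrix.of_apply, iterate_derivation_sum, Matrix.mul_apply]
  exact Finset.sum_congr rfl fun l _ => mul_comm _ _

theorem exists_wronskian_basis_eq {K : Type*} [Field K] {V : Submodule K (Poly3 K)} {n : ℕ}
    (D : Derivation K (Poly3 K) (Poly3 K)) (b b' : Module.Basis (Fin n) K V) :
    ∃ c : K, IsUnit c ∧ wronskian D (fun j => (b' j : Poly3 K)) =
      wronskian D (fun j => (b j : Poly3 K)) * C c := by
  refine ⟨(b.toMatrix b').det, ?_, ?_⟩
  · rw [← Module.Basis.det_apply]
    exact b.isUnit_det b'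
  · rw [← wronskian_linear_combination]
    congr 1
    funext j
    have := b.sum_toMatrix_smul_self b' j
    conv_lhs => rw [← this]
    simp only [Submodule.coe_sum, Submodule.coe_smul, C_mul']

theorem wronskian_cast {K : Type*} [CommRing K] (D : Derivation K (Poly3 K) (Poly3 K)) {n m : ℕ}
    (h : n = m) (v : Fin m → Poly3 K) :
    wronskian D (fun j => v (Fin.cast h j)) = wronskian D v := by
  subst h; rfl

/-- The ramification ideal in terms of one basis: it is the saturation of the ideals of the affine
charts. -/
theorem mem_ramificationIdeal_iff {K : Type*} [Field K] {V : Submodule K (Poly3 K)} {n : ℕ}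
    (F : Poly3 K) (b : Module.Basis (Fin n) K V) (g : Poly3 K) :
    g ∈ ramificationIdeal F V ↔ ∀ i : Fin 3, ∃ a : ℕ, X i ^ a * g ∈ Ideal.span {F,
      wronskian (jacobianDerivation F (X i)) (fun j => (b j : Poly3 K))} := by
  have hn : Module.finrank K V = n := by rw [Module.finrank_eq_card_basis b, Fintype.card_fin]
  rw [ramificationIdeal, Submodule.mem_iInf]
  refine forall_congr' fun i => ?_
  have h1 : Ideal.span ({F} ∪ {w : Poly3 K | ∃ b : Module.Basis (Fin (Module.finrank K V)) K V,
        w = wronskian (jacobianDerivation F (MvPolynomial.X i)) (fun j => (b j : Poly3 K))}) =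
      Ideal.span {F, wronskian (jacobianDerivation F (X i)) (fun j => (b j : Poly3 K))} := by
    apply le_antisymm
    · rw [Ideal.span_le]
      rintro x (rfl | ⟨b', rfl⟩)
      · exact Ideal.subset_span (by simp)
      · obtain ⟨c, -, hc⟩ := exists_wronskian_basis_eq (jacobianDerivation F (X i)) b
          (b'.reindex (finCongr hn))
        have : wronskian (jacobianDerivation F (X i)) (fun j => (b' j : Poly3 K)) =
            wronskian (jacobianDerivation F (X i))
              (fun j => (b'.reindex (finCongr hn) j : Poly3 K)) := by
          rw [← wronskian_cast _ hn]
          simp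
        rw [this, hc]
        exact Ideal.mul_mem_right _ _ (Ideal.subset_span (by simp))
    · rw [Ideal.span_le]
      rintro x (rfl | rfl)
      · exact Ideal.subset_span (by simp)
      · refine Ideal.subset_span (Or.inr ⟨b.reindex (finCongr hn.symm), ?_⟩)
        rw [← wronskian_cast _ hn]
        simp
  rw [h1, Ideal.mem_comap, IsLocalization.algebraMap_mem_map_algebraMap_iff
    (Submonoid.powers (X i : Poly3 K))]
  constructor
  · rintro ⟨_, ⟨a, rfl⟩, h⟩
    exact ⟨a, h⟩
  · rintro ⟨a, h⟩
    exact ⟨_, ⟨a, rfl⟩, h⟩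

theorem span_pair_mem_of_sub_mem {R : Type*} [CommRing R] {F x y : R} {J : Ideal R}
    (hF : F ∈ J) (hx : x ∈ J) (h : x - y ∈ Ideal.span {F}) : y ∈ J := by
  have h1 : x - y ∈ J := (Ideal.span_le.mpr (Set.singleton_subset_iff.mpr hF)) h
  simpa using J.sub_mem hx h1

/-- The Wronskian of any linear form lies in the ramification ideal. -/
theorem span_le_ramificationIdeal {K : Type*} [Field K] {V : Submodule K (Poly3 K)} {n e d : ℕ}
    {F : Poly3 K} (hF : F.IsHomogeneous e) (b : Module.Basis (Fin n) K V)
    (hV : V ≤ homogeneousSubmodule (Fin 3) K d) (a : Fin 3 → K) :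
    Ideal.span {F, wronskian (jacobianDerivation F (linearForm a)) (fun j => (b j : Poly3 K))} ≤
      ramificationIdeal F V := by
  rw [Ideal.span_le]
  rintro x (rfl | rfl)
  · exact (mem_ramificationIdeal_iff _ b _).mpr fun i =>
      ⟨0, Ideal.mul_mem_left _ _ (Ideal.subset_span (by simp))⟩
  · refine (mem_ramificationIdeal_iff _ b _).mpr fun i => ⟨n.choose 2, ?_⟩
    have h := linearForm_pow_mul_wronskian_sub_mem hF (v := fun j => (b j : Poly3 K))
      (fun j => hV (b j).2) a (Pi.single i 1)
    rw [← X_eq_linearForm] at h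
    refine span_pair_mem_of_sub_mem (F := F) (Ideal.subset_span (by simp))
      (Ideal.mul_mem_left _ _ (Ideal.subset_span ?_)) h
    exact Or.inr rfl

/-- Away from the line `L = 0` the ramification scheme is cut out by the Wronskian of `L`. -/
theorem exists_pow_mul_mem_span {K : Type*} [Field K] {V : Submodule K (Poly3 K)} {n e d : ℕ}
    {F : Poly3 K} (hF : F.IsHomogeneous e) (b : Module.Basis (Fin n) K V)
    (hV : V ≤ homogeneousSubmodule (Fin 3) K d) (a : Fin 3 → K) {g : Poly3 K}
    (hg : g ∈ ramificationIdeal F V) :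
    ∃ c : ℕ, linearForm a ^ c * g ∈ Ideal.span {F,
      wronskian (jacobianDerivation F (linearForm a)) (fun j => (b j : Poly3 K))} := by
  set L := linearForm a
  set J := Ideal.span {F, wronskian (jacobianDerivation F L) (fun j => (b j : Poly3 K))}
  let Q : Ideal (Poly3 K) := J.colon {L ^ (n.choose 2) * g}
  have hQ : ∀ x, x ∈ Q ↔ x * (L ^ (n.choose 2) * g) ∈ J := fun x => by
    simp [Q, Submodule.mem_colon_singleton]
  have hX : ∀ i, X i ∈ Q.radical := by
    intro i
    obtain ⟨c, hc⟩ := (mem_ramificationIdeal_iff _ b _).mp hg i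
    refine ⟨c, (hQ _).mpr ?_⟩
    obtain ⟨x, y, hxy⟩ := Ideal.mem_span_pair.mp hc
    have h := linearForm_pow_mul_wronskian_sub_mem hF (v := fun j => (b j : Poly3 K))
      (fun j => hV (b j).2) (Pi.single i 1) a
    rw [← X_eq_linearForm] at h
    have h2 : L ^ (n.choose 2) * wronskian (jacobianDerivation F (X i))
        (fun j => (b j : Poly3 K)) ∈ J :=
      span_pair_mem_of_sub_mem (F := F) (Ideal.subset_span (by simp))
        (Ideal.mul_mem_left _ _ (Ideal.subset_span (by simp [L]))) h
    have h3 : X i ^ c * (L ^ (n.choose 2) * g) = L ^ (n.choose 2) * x * F + y *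
        (L ^ (n.choose 2) * wronskian (jacobianDerivation F (X i))
        (fun j => (b j : Poly3 K))) := by
      linear_combination -L ^ (n.choose 2) * hxy
    rw [h3]
    exact J.add_mem (Ideal.mul_mem_left _ _ (Ideal.subset_span (by simp)))
      (Ideal.mul_mem_left _ _ h2)
  have hL : L ∈ Q.radical := Ideal.sum_mem _ fun i _ => Ideal.mul_mem_left _ _ (hX i)
  obtain ⟨c, hc⟩ := hL
  refine ⟨c + n.choose 2, ?_⟩
  rw [pow_add, mul_assoc]
  exact (hQ _).mp hc

/-! ### Base change -/

section Map
variable {R R' : Type*} [CommRing R] [CommRing R'] (f : R →+* R')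

theorem map_jacobianDerivation (P Q G : Poly3 R) :
    map f (jacobianDerivation P Q G) = jacobianDerivation (map f P) (map f Q) (map f G) := by
  simp only [jacobianDerivation_apply, map_sub, map_add, map_mul, pderiv_map]

theorem map_wronskian (P Q : Poly3 R) {n : ℕ} (v : Fin n → Poly3 R) :
    map f (wronskian (jacobianDerivation P Q) v) =
      wronskian (jacobianDerivation (map f P) (map f Q)) (fun j => map f (v j)) := by
  have h : ∀ i G, map f ((⇑(jacobianDerivation P Q))^[i] G) =
      (⇑(jacobianDerivation (map f P) (map f Q)))^[i] (map f G) := by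
    intro i G
    induction i with
    | zero => rfl
    | succ i ih =>
      rw [Function.iterate_succ_apply', Function.iterate_succ_apply', map_jacobianDerivation, ih]
  rw [wronskian, wronskian, RingHom.map_det]
  congr 1
  ext1 i j
  exact h _ _

theorem map_linearForm (a : Fin 3 → R) :
    map f (linearForm a) = linearForm (fun i => f (a i)) := by
  simp [linearForm]

end Map

/-! ### Homogeneous factors -/

/-- `P(X) ↦ P(sX)`, whose coefficients are the homogeneous components of `P`. -/
def scaling (R σ : Type*) [CommRing R] :
    MvPolynomial σ R →ₐ[R] Polynomial (MvPolynomial σ R) :=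
  aeval fun i => Polynomial.C (X i) * Polynomial.X

theorem scaling_coeff {R σ : Type*} [CommRing R] (P : MvPolynomial σ R) (d : ℕ) :
    (scaling R σ P).coeff d = homogeneousComponent d P := by
  induction P using MvPolynomial.induction_on' with
  | add p q hp hq => rw [map_add, map_add, Polynomial.coeff_add, hp, hq]
  | monomial m c =>
    have h1 : scaling R σ (monomial m c) =
        Polynomial.C (monomial m c) * Polynomial.X ^ (Finsupp.degree m) := by
      rw [scaling, aeval_monomial, monomial_eq, Finsupp.prod, Finsupp.prod]
      simp only [mul_pow, Finset.prod_mul_distrib, Finset.prod_pow_eq_pow_sum]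
      rw [Finsupp.degree_apply, map_mul, map_prod, mul_assoc]
      simp only [map_pow]
      rfl
    rw [h1, Polynomial.coeff_C_mul, Polynomial.coeff_X_pow,
      homogeneousComponent_of_mem (m := d) (isHomogeneous_monomial (n := Finsupp.degree m) c rfl)]
    split_ifs <;> simp

theorem isHomogeneous_iff_scaling {R σ : Type*} [CommRing R] {P : MvPolynomial σ R} {n : ℕ} :
    P.IsHomogeneous n ↔ scaling R σ P = Polynomial.C P * Polynomial.X ^ n := by
  constructor
  · intro h
    ext1 d
    rw [scaling_coeff, Polynomial.coeff_C_mul, Polynomial.coeff_X_pow,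
      homogeneousComponent_of_mem (m := d) h]
    split_ifs <;> simp
  · intro h
    have := scaling_coeff P n
    rw [h, Polynomial.coeff_C_mul, Polynomial.coeff_X_pow, if_pos rfl, mul_one] at this
    rw [this]
    exact homogeneousComponent_isHomogeneous n P

theorem IsHomogeneous_aeval_mul {R σ A : Type*} [CommRing R] [CommRing A] [Algebra R A]
    {P : MvPolynomial σ R} {n : ℕ} (h : P.IsHomogeneous n) (c : A) (x : σ → A) :
    aeval (fun i => c * x i) P = c ^ n * aeval x P := by
  have h1 : ∀ Q, aeval (fun i => c * x i) Q =
      Polynomial.eval₂ (aeval (R := R) x).toRingHom c (scaling R σ Q) := by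
    intro Q
    induction Q using MvPolynomial.induction_on with
    | C r => simp [scaling]
    | add p q hp hq => simp only [map_add, hp, hq, Polynomial.eval₂_add]
    | mul_X p i hp =>
      simp only [map_mul, hp, Polynomial.eval₂_mul]
      simp [scaling, mul_comm c]
  rw [h1, isHomogeneous_iff_scaling.mp h, Polynomial.eval₂_mul, Polynomial.eval₂_C,
    Polynomial.eval₂_X_pow, mul_comm]
  rfl

/-- A factor of a nonzero homogeneous polynomial is homogeneous: its image under `scaling` divides
a monomial, so that it is one. -/
theorem exists_isHomogeneous_of_mul {R σ : Type*} [CommRing R] [IsDomain R] {P Q : MvPolynomial σ R}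
    {n : ℕ} (h : (P * Q).IsHomogeneous n) (h0 : P * Q ≠ 0) : ∃ a, P.IsHomogeneous a := by
  have hinj : ∀ p : MvPolynomial σ R, p ≠ 0 → scaling R σ p ≠ 0 := by
    intro p hp h
    apply hp
    rw [← sum_homogeneousComponent p]
    exact Finset.sum_eq_zero fun i _ => by rw [← scaling_coeff, h, Polynomial.coeff_zero]
  have hP := left_ne_zero_of_mul h0
  have hQ := right_ne_zero_of_mul h0
  have h1 := isHomogeneous_iff_scaling.mp h
  rw [map_mul] at h1
  have h2 := Polynomial.natDegree_mul (hinj P hP) (hinj Q hQ)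
  have h3 := Polynomial.natTrailingDegree_mul (hinj P hP) (hinj Q hQ)
  rw [h1, Polynomial.natDegree_C_mul_X_pow _ _ h0] at h2
  rw [h1, Polynomial.C_mul_X_pow_eq_monomial, Polynomial.natTrailingDegree_monomial h0] at h3
  have h4 := Polynomial.natTrailingDegree_le_natDegree (scaling R σ P)
  have h5 := Polynomial.natTrailingDegree_le_natDegree (scaling R σ Q)
  have h6 : (scaling R σ P).natTrailingDegree = (scaling R σ P).natDegree := by omega
  refine ⟨(scaling R σ P).natDegree, ?_⟩
  have h7 : homogeneousComponent (scaling R σ P).natDegree P = P := by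
    have h8 : ∀ i, i ≠ (scaling R σ P).natDegree → homogeneousComponent i P = 0 := by
      intro i hi
      rw [← scaling_coeff]
      rcases lt_or_gt_of_ne hi with hi | hi
      · exact Polynomial.coeff_eq_zero_of_lt_natTrailingDegree (by omega)
      · exact Polynomial.coeff_eq_zero_of_natDegree_lt hi
    by_cases h9 : (scaling R σ P).natDegree ∈ Finset.range (P.totalDegree + 1)
    · conv_rhs => rw [← sum_homogeneousComponent P]
      rw [Finset.sum_eq_single_of_mem _ h9 fun i _ hi => h8 i hi]
    · exfalso
      apply hP
      rw [← sum_homogeneousComponent P]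
      exact Finset.sum_eq_zero fun i hi => h8 i fun h => h9 (h ▸ hi)
  have h10 := homogeneousComponent_isHomogeneous (scaling R σ P).natDegree P
  rwa [h7] at h10

theorem exists_isHomogeneous_of_dvd {R σ : Type*} [CommRing R] [IsDomain R] {P Q : MvPolynomial σ R}
    {n : ℕ} (h : Q.IsHomogeneous n) (h0 : Q ≠ 0) (hPQ : P ∣ Q) : ∃ a, P.IsHomogeneous a := by
  obtain ⟨u, rfl⟩ := hPQ
  exact exists_isHomogeneous_of_mul h h0

/-! ### A finiteness criterion for subschemes of the plane -/

/-- The ideal contains, for any two of the variables, a nonzero binary form in them: its zero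
locus in the plane is finite. -/
def HasBinaryForms {K : Type*} [CommRing K] (J : Ideal (Poly3 K)) : Prop :=
  ∀ i l : Fin 3, i ≠ l → ∃ (h : MvPolynomial (Fin 2) K) (N : ℕ), h ≠ 0 ∧ h.IsHomogeneous N ∧
    rename ![i, l] h ∈ J

theorem HasBinaryForms.mono {K : Type*} [CommRing K] {I J : Ideal (Poly3 K)} (h : HasBinaryForms I)
    (hIJ : I ≤ J) : HasBinaryForms J := fun i l hil => by
  obtain ⟨g, N, h0, h1, h2⟩ := h i l hil
  exact ⟨g, N, h0, h1, hIJ h2⟩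

theorem HasBinaryForms.mul {K : Type*} [CommRing K] [IsDomain K] {I J : Ideal (Poly3 K)}
    (h : HasBinaryForms I)
    (h' : HasBinaryForms J) : HasBinaryForms (I * J) := fun i l hil => by
  obtain ⟨g, N, h0, h1, h2⟩ := h i l hil
  obtain ⟨g', N', h0', h1', h2'⟩ := h' i l hil
  exact ⟨g * g', N + N', mul_ne_zero h0 h0', h1.mul h1', by
    rw [map_mul]; exact Ideal.mul_mem_mul h2 h2'⟩

theorem hasBinaryForms_top {K : Type*} [CommRing K] [IsDomain K] :
    HasBinaryForms (⊤ : Ideal (Poly3 K)) :=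
  fun _ _ _ => ⟨1, 0, one_ne_zero, isHomogeneous_one _ _, Submodule.mem_top⟩

/-- A nonzero binary form does not vanish identically on an affine line off the origin. -/
theorem aeval_binaryForm_ne_zero {K : Type*} [Field K] [Infinite K] {h : MvPolynomial (Fin 2) K}
    {N : ℕ} (h0 : h ≠ 0) (hh : h.IsHomogeneous N) {u : K} (hu : u ≠ 0) :
    aeval ![Polynomial.C u, Polynomial.X] h ≠ 0 := by
  intro hz
  have h1 : X 0 * h = 0 := by
    apply MvPolynomial.funext
    intro x
    rw [map_mul, eval_X, map_zero]
    by_cases hx : x 0 = 0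
    · rw [hx, zero_mul]
    · have h2 := congrArg (Polynomial.eval (u * x 1 / x 0)) hz
      rw [Polynomial.eval_zero, ← Polynomial.coe_aeval_eq_eval,
        ← AlgHom.comp_apply, comp_aeval] at h2
      have h3 : (fun i => (Polynomial.aeval (u * x 1 / x 0)) (![Polynomial.C u, Polynomial.X] i)) =
          fun i => (u / x 0) * x i := by
        funext i
        fin_cases i
        · simp; field_simp
        · simp; ring
      rw [h3, IsHomogeneous_aeval_mul hh] at h2
      rw [← coe_aeval_eq_eval]
      have h5 : (u / x 0) ^ N ≠ 0 := pow_ne_zero _ (div_ne_zero hu hx)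
      exact mul_eq_zero_of_right _ ((mul_eq_zero.mp h2).resolve_left h5)
  exact h0 ((mul_eq_zero.mp h1).resolve_left (X_ne_zero 0))


theorem exists_perm_fin_three : ∀ i l : Fin 3, i ≠ l →
    ∃ σ : Equiv.Perm (Fin 3), σ 1 = i ∧ σ 2 = l := by decide

/-- A multiple of the resultant, for `P` prime: coprimality over the fraction field, after clearing
denominators. -/
theorem exists_C_mem_span_pair {R : Type*} [CommRing R] [IsDomain R] {P Q : Polynomial R}
    (hP : Prime P) (hPQ : ¬ P ∣ Q) :
    ∃ r : R, r ≠ 0 ∧ Polynomial.C r ∈ Ideal.span {P, Q} := by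
  by_cases h : ∃ r : R, r ≠ 0 ∧ P ∣ Polynomial.C r
  · obtain ⟨r, hr, u, hu⟩ := h
    exact ⟨r, hr, hu ▸ Ideal.mul_mem_right _ _ (Ideal.subset_span (by simp))⟩
  · push Not at h
    let M := Submonoid.map (Polynomial.C : R →+* Polynomial R) (nonZeroDivisors R)
    let A := Polynomial (FractionRing R)
    let _ : Algebra (Polynomial R) A := Polynomial.algebra R (FractionRing R)
    have : IsLocalization M A := Polynomial.isLocalization (nonZeroDivisors R) (FractionRing R)
    have hM : Disjoint (M : Set (Polynomial R)) (Ideal.span {P} : Set (Polynomial R)) := by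
      rw [Set.disjoint_left]
      rintro _ ⟨r, hr, rfl⟩ hx
      exact h r (nonZeroDivisors.ne_zero hr) (Ideal.mem_span_singleton.mp hx)
    have hprime := IsLocalization.isPrime_of_isPrime_disjoint M A (Ideal.span {P})
      ((Ideal.span_singleton_prime hP.ne_zero).mpr hP) hM
    by_contra! hcon
    have hJ : Disjoint (M : Set (Polynomial R)) (Ideal.span {P, Q} : Set (Polynomial R)) := by
      rw [Set.disjoint_left]
      rintro _ ⟨r, hr, rfl⟩ hx
      exact hcon r (nonZeroDivisors.ne_zero hr) hx
    have h1 := (IsLocalization.map_algebraMap_ne_top_iff_disjoint M A _).mpr hJ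
    have hne : Ideal.map (algebraMap (Polynomial R) A) (Ideal.span {P}) ≠ ⊥ := by
      rw [Ideal.map_span, Set.image_singleton, Ne, Ideal.span_singleton_eq_bot]
      have hinj : Function.Injective (algebraMap (Polynomial R) A) :=
        IsLocalization.injective A (M := M) (by
          rintro _ ⟨r, hr, rfl⟩
          exact mem_nonZeroDivisors_of_ne_zero
            (Polynomial.C_ne_zero.mpr (nonZeroDivisors.ne_zero hr)))
      exact (map_ne_zero_iff _ hinj).mpr hP.ne_zero
    have hmax := IsPrime.to_maximal_ideal (hpi := hprime) hne
    have h2 := hmax.eq_of_le h1 (Ideal.map_mono (Ideal.span_mono (by simp)))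
    have h3 : algebraMap (Polynomial R) A Q ∈
        Ideal.map (algebraMap (Polynomial R) A) (Ideal.span {P}) := by
      rw [h2]
      exact Ideal.mem_map_of_mem _ (Ideal.subset_span (by simp))
    rw [IsLocalization.algebraMap_mem_map_algebraMap_iff M] at h3
    obtain ⟨_, ⟨r, hr, rfl⟩, h3⟩ := h3
    rcases hP.dvd_or_dvd (Ideal.mem_span_singleton.mp h3) with h4 | h4
    · exact h r (nonZeroDivisors.ne_zero hr) h4
    · exact hPQ h4

theorem finSuccEquiv_rename_succ {K : Type*} [CommRing K] {n : ℕ} (h : MvPolynomial (Fin n) K) :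
    MvPolynomial.finSuccEquiv K n (rename Fin.succ h) = Polynomial.C h := by
  induction h using MvPolynomial.induction_on with
  | C r => rw [rename_C, finSuccEquiv_apply, eval₂Hom_C]; rfl
  | add p q hp hq => simp only [map_add, hp, hq]
  | mul_X p j hp => rw [map_mul, map_mul, hp, map_mul, rename_X, finSuccEquiv_X_succ]

attribute [local instance] MvPolynomial.gradedAlgebra in
/-- The resultant with respect to the third variable, made homogeneous by taking a homogeneous
component. -/
theorem hasBinaryForms_of_prime {K : Type*} [CommRing K] [IsDomain K] {P Q : Poly3 K} {a b : ℕ}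
    (hPh : P.IsHomogeneous a) (hQh : Q.IsHomogeneous b) (hP : Prime P) (hPQ : ¬ P ∣ Q) :
    HasBinaryForms (Ideal.span {P, Q}) := by
  intro i l hil
  obtain ⟨σ, h1, h2⟩ := exists_perm_fin_three i l hil
  let T : Poly3 K ≃ₐ[K] Polynomial (MvPolynomial (Fin 2) K) :=
    (renameEquiv K σ.symm).trans (MvPolynomial.finSuccEquiv K 2)
  have hT : ∀ h : MvPolynomial (Fin 2) K, T (rename ![i, l] h) = Polynomial.C h := by
    intro h
    have h3 : σ.symm ∘ ![i, l] = Fin.succ := by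
      rw [Equiv.symm_comp_eq]
      funext j
      fin_cases j
      · exact h1.symm
      · exact h2.symm
    rw [← finSuccEquiv_rename_succ, ← h3, ← rename_rename]
    rfl
  obtain ⟨r, hr, hmem⟩ := exists_C_mem_span_pair (P := T P) (Q := T Q)
    ((MulEquiv.prime_iff T).mpr hP) (fun h => hPQ ((map_dvd_iff T).mp h))
  have hmem' : rename ![i, l] r ∈ Ideal.span {P, Q} := by
    rw [← hT, Ideal.mem_span_pair] at hmem
    obtain ⟨x, y, hxy⟩ := hmem
    rw [Ideal.mem_span_pair]
    refine ⟨T.symm x, T.symm y, T.injective ?_⟩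
    rw [map_add, map_mul, map_mul, T.apply_symm_apply, T.apply_symm_apply, hxy]
  obtain ⟨N, hN⟩ : ∃ N, homogeneousComponent N r ≠ 0 := by
    by_contra! hcon
    apply hr
    rw [← sum_homogeneousComponent r]
    exact Finset.sum_eq_zero fun i _ => hcon i
  refine ⟨homogeneousComponent N r, N, hN, homogeneousComponent_isHomogeneous _ _, ?_⟩
  rw [rename_homogeneousComponent]
  refine homogeneousComponent_mem_of_mem (Ideal.homogeneous_span _ _ ?_) hmem' N
  rintro x (rfl | rfl)
  · exact ⟨a, hPh⟩
  · exact ⟨b, hQh⟩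

theorem span_pair_mul_le {R : Type*} [CommRing R] (P P' Q : R) :
    Ideal.span {P, Q} * Ideal.span {P', Q} ≤ Ideal.span {P * P', Q} := by
  rw [Ideal.span_pair_mul_span_pair, Ideal.span_le]
  rintro x (rfl | rfl | rfl | rfl)
  · exact Ideal.subset_span (by simp)
  · exact Ideal.mul_mem_left _ _ (Ideal.subset_span (by simp))
  · exact Ideal.mul_mem_right _ _ (Ideal.subset_span (by simp))
  · exact Ideal.mul_mem_right _ _ (Ideal.subset_span (by simp))

theorem hasBinaryForms_of_isUnit {K : Type*} [CommRing K] [IsDomain K] {J : Ideal (Poly3 K)}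
    {u : Poly3 K}
    (hu : IsUnit u) (h : u ∈ J) : HasBinaryForms J := by
  rw [Ideal.eq_top_of_isUnit_mem _ h hu]; exact hasBinaryForms_top

/-- Two forms without common factor have finitely many common zeros. -/
theorem hasBinaryForms_of_isRelPrime {K : Type*} [CommRing K] [IsDomain K]
    [UniqueFactorizationMonoid K] {P Q : Poly3 K} {a b : ℕ}
    (hPh : P.IsHomogeneous a) (hQh : Q.IsHomogeneous b) (hP0 : P ≠ 0) (hPQ : IsRelPrime P Q) :
    HasBinaryForms (Ideal.span {P, Q}) := by
  induction P using WfDvdMonoid.induction_on_irreducible generalizing a with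
  | zero => exact absurd rfl hP0
  | unit u hu => exact hasBinaryForms_of_isUnit hu (Ideal.subset_span (by simp))
  | mul P G hP0' hG ih =>
    obtain ⟨a1, ha1⟩ := exists_isHomogeneous_of_dvd hPh hP0 (Dvd.intro _ rfl)
    obtain ⟨a2, ha2⟩ := exists_isHomogeneous_of_dvd hPh hP0 (Dvd.intro_left _ rfl)
    refine HasBinaryForms.mono (HasBinaryForms.mul (hasBinaryForms_of_prime ha1 hQh hG.prime ?_)
      (ih ha2 hP0' (hPQ.of_mul_left_right))) (span_pair_mul_le _ _ _)
    intro h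
    exact hG.not_isUnit (hPQ (Dvd.intro _ rfl) h)

theorem HasBinaryForms.map {R R' : Type*} [CommRing R] [CommRing R'] {f : R →+* R'}
    (hf : Function.Injective f) {J : Ideal (Poly3 R)} (h : HasBinaryForms J) :
    HasBinaryForms (J.map (MvPolynomial.map f)) := fun i l hil => by
  obtain ⟨g, N, h0, h1, h2⟩ := h i l hil
  refine ⟨MvPolynomial.map f g, N, ?_, h1.map f, ?_⟩
  · exact fun h => h0 (map_injective f hf (by rw [h, map_zero]))
  · rw [← map_rename]
    exact Ideal.mem_map_of_mem _ h2

theorem sup_span_mul_le {R : Type*} [CommRing R] (I : Ideal R) (P Q : R) :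
    (I ⊔ Ideal.span {P}) * (I ⊔ Ideal.span {Q}) ≤ I ⊔ Ideal.span {P * Q} := by
  refine Ideal.mul_le.mpr fun x hx y hy => ?_
  obtain ⟨a, ha, b, hb, rfl⟩ := Submodule.mem_sup.mp hx
  obtain ⟨c, hc, d, hd, rfl⟩ := Submodule.mem_sup.mp hy
  rw [show (a + b) * (c + d) = (a * (c + d) + b * c) + b * d by ring]
  refine Submodule.add_mem_sup (I.add_mem (I.mul_mem_right _ ha) (I.mul_mem_left _ hc)) ?_
  rw [← Ideal.span_singleton_mul_span_singleton]
  exact Ideal.mul_mem_mul hb hd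

theorem HasBinaryForms.sup_span_mul {K : Type*} [CommRing K] [IsDomain K] {I : Ideal (Poly3 K)}
    {P Q : Poly3 K} (hP : HasBinaryForms (I ⊔ Ideal.span {P}))
    (hQ : HasBinaryForms (I ⊔ Ideal.span {Q})) : HasBinaryForms (I ⊔ Ideal.span {P * Q}) :=
  (hP.mul hQ).mono (sup_span_mul_le I P Q)

theorem HasBinaryForms.sup_span_prod {K ι : Type*} [CommRing K] [IsDomain K] {I : Ideal (Poly3 K)}
    (s : Finset ι) {P : ι → Poly3 K} (h : ∀ i ∈ s, HasBinaryForms (I ⊔ Ideal.span {P i})) :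
    HasBinaryForms (I ⊔ Ideal.span {∏ i ∈ s, P i}) := by
  classical
  induction s using Finset.induction_on with
  | empty => rw [Finset.prod_empty, Ideal.span_singleton_one, sup_top_eq]; exact hasBinaryForms_top
  | insert a s ha ih =>
    rw [Finset.prod_insert ha]
    exact (h a (Finset.mem_insert_self _ _)).sup_span_mul
      (ih fun i hi => h i (Finset.mem_insert_of_mem hi))

theorem HasBinaryForms.isFiniteSubscheme {K : Type*} [Field K] [Infinite K] {J : Ideal (Poly3 K)}
    (h : HasBinaryForms J) : IsFiniteSubscheme J := by
  intro i
  let q := Ideal.Quotient.mkₐ K (chartIdeal J i)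
  have hi : q (X i) = 1 := by
    rw [← sub_eq_zero, ← map_one q, ← map_sub]
    exact Ideal.Quotient.eq_zero_iff_mem.mpr
      (Ideal.mem_sup_right (Ideal.mem_span_singleton_self _))
  have hint : ∀ l, IsIntegral K (q (X l)) := by
    intro l
    by_cases hl : l = i
    · rw [hl, hi]; exact isIntegral_one
    obtain ⟨g, N, h0, h1, h2⟩ := h i l (Ne.symm hl)
    rw [← isAlgebraic_iff_isIntegral]
    refine ⟨aeval ![Polynomial.C 1, Polynomial.X] g, aeval_binaryForm_ne_zero h0 h1 one_ne_zero, ?_⟩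
    rw [← AlgHom.comp_apply, comp_aeval]
    have h3 : q (rename ![i, l] g) = 0 :=
      Ideal.Quotient.eq_zero_iff_mem.mpr (Ideal.mem_sup_left h2)
    rw [← h3, ← aeval_X_left_apply (rename ![i, l] g), ← AlgHom.comp_apply, comp_aeval,
      aeval_rename]
    congr 2
    funext j
    fin_cases j
    · simpa using hi.symm
    · simp
  have : Algebra.IsIntegral K (Poly3 K ⧸ chartIdeal J i) := by
    refine ⟨fun x => ?_⟩
    obtain ⟨p, rfl⟩ := Ideal.Quotient.mk_surjective x
    change IsIntegral K (q p)
    induction p using MvPolynomial.induction_on with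
    | C r =>
      have : q (C r) = algebraMap K _ r := q.commutes r
      rw [this]; exact isIntegral_algebraMap
    | add p q' hp hq => rw [map_add]; exact hp.add hq
    | mul_X p j hp => rw [map_mul]; exact hp.mul (hint j)
  exact Algebra.IsIntegral.finite

/-! ### Wronskians on an irreducible curve -/

/-- Wronskian criterion over a domain with a derivation whose field of constants in the fraction
field is the ground field: if `c' d = c d'` only for proportional `c`, `d`, then the Wronskian of
linearly independent elements is nonzero. -/
theorem det_iterate_derivation_ne_zero {k R : Type*} [Field k] [CommRing R] [IsDomain R]
    [Algebra k R]
    (D : Derivation k R R)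
    (hD : ∀ c d : R, d ≠ 0 → D c * d = c * D d → ∃ a : k, c = algebraMap k R a * d) {n : ℕ}
    (v : Fin n → R) (hv : LinearIndependent k v) :
    Matrix.det (Matrix.of fun i j : Fin n => (⇑D)^[(i : ℕ)] (v j)) ≠ 0 := by
  induction n with
  | zero => simp
  | succ n ih =>
    intro hdet
    obtain ⟨c, hc0, hc⟩ := Matrix.exists_mulVec_eq_zero_iff.mpr hdet
    have hrel : ∀ i : ℕ, i < n + 1 → ∑ j, (⇑D)^[i] (v j) * c j = 0 := fun i hi => by
      have := congrFun hc ⟨i, hi⟩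
      simpa [Matrix.mulVec, dotProduct] using this
    have hv' : LinearIndependent k (fun j : Fin n => v j.castSucc) :=
      hv.comp _ (Fin.castSucc_injective n)
    have hW := ih _ hv'
    have hlast : ∀ x : Fin (n + 1) → R,
        (∀ i : ℕ, i < n → ∑ j, (⇑D)^[i] (v j) * x j = 0) → x (Fin.last n) = 0 → x = 0 := by
      intro x hx hxl
      have h1 : (fun j : Fin n => x j.castSucc) = 0 := by
        by_contra hne
        refine hW (Matrix.exists_mulVec_eq_zero_iff.mp ⟨_, hne, ?_⟩)
        funext i
        have := hx i i.2
        rw [Fin.sum_univ_castSucc, hxl, mul_zero, add_zero] at this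
        simpa [Matrix.mulVec, dotProduct] using this
      funext j
      refine Fin.lastCases hxl (fun j => congrFun h1 j) j
    have hcl : c (Fin.last n) ≠ 0 := fun h =>
      hc0 (hlast c (fun i hi => hrel i (by omega)) h)
    set d := c (Fin.last n)
    have hrel' : ∀ i : ℕ, i < n → ∑ j, (⇑D)^[i] (v j) * D (c j) = 0 := by
      intro i hi
      have h1 := congrArg D (hrel i (by omega))
      rw [map_sum, map_zero] at h1
      have h2 := hrel (i + 1) (by omega)
      rw [← h1]
      rw [← sub_eq_zero, ← Finset.sum_sub_distrib, ← neg_eq_zero, ← Finset.sum_neg_distrib, ← h2]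
      refine Finset.sum_congr rfl fun j _ => ?_
      rw [Derivation.leibniz, Function.iterate_succ_apply', smul_eq_mul, smul_eq_mul]
      ring
    have h3 := hlast (fun j => d * D (c j) - D d * c j) (fun i hi => by
      have : ∀ j, (⇑D)^[i] (v j) * (d * D (c j) - D d * c j) =
        d * ((⇑D)^[i] (v j) * D (c j)) - D d * ((⇑D)^[i] (v j) * c j) := fun j => by ring
      simp only [this, Finset.sum_sub_distrib, ← Finset.mul_sum]
      rw [hrel' i hi, hrel i (by omega), mul_zero, mul_zero, sub_zero]) (by simp only [d]; ring)
    have h4 : ∀ j, ∃ a : k, c j = algebraMap k R a * d := fun j => by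
      refine hD _ _ hcl ?_
      have := congrFun h3 j
      simp only [Pi.zero_apply] at this
      linear_combination this
    choose a ha using h4
    have h5 := hrel 0 (by omega)
    have h6 : ∑ j, a j • v j = 0 := by
      have : d * ∑ j, a j • v j = 0 := by
        rw [← h5, Finset.mul_sum]
        refine Finset.sum_congr rfl fun j _ => ?_
        rw [ha j, Algebra.smul_def]
        simp only [Function.iterate_zero, id_eq]
        ring
      exact (mul_eq_zero.mp this).resolve_left hcl
    have h7 := Fintype.linearIndependent_iff.mp hv a h6
    apply hcl
    change c (Fin.last n) = 0
    rw [ha, h7, map_zero, zero_mul]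

open PowerSeries in
/-- In characteristic zero the only constants among quotients of power series are scalars. -/
theorem exists_eq_C_mul_of_derivative {k : Type*} [Field k] [CharZero k] (c d : k⟦X⟧) (hd : d ≠ 0)
    (h : PowerSeries.derivative k c * d = c * PowerSeries.derivative k d) :
    ∃ a : k, c = algebraMap k k⟦X⟧ a * d := by
  have key : ∀ c d : k⟦X⟧, c ≠ 0 → d ≠ 0 →
      PowerSeries.derivative k c * d = c * PowerSeries.derivative k d →
      c.order.toNat = d.order.toNat := by
    intro c d hc hd h
    obtain ⟨u, hu⟩ : ∃ u, c = PowerSeries.X ^ c.order.toNat * u := PowerSeries.X_pow_order_dvd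
    obtain ⟨w, hw⟩ : ∃ w, d = PowerSeries.X ^ d.order.toNat * w := PowerSeries.X_pow_order_dvd
    set p := c.order.toNat
    set q := d.order.toNat
    have hu0 : constantCoeff u ≠ 0 := by
      have : coeff p c ≠ 0 := coeff_order hc
      rwa [hu, coeff_X_pow_mul', if_pos le_rfl, Nat.sub_self, coeff_zero_eq_constantCoeff] at this
    have hw0 : constantCoeff w ≠ 0 := by
      have : coeff q d ≠ 0 := coeff_order hd
      rwa [hw, coeff_X_pow_mul', if_pos le_rfl, Nat.sub_self, coeff_zero_eq_constantCoeff] at this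
    have hX : ∀ (p : ℕ) (u : k⟦X⟧), PowerSeries.X * PowerSeries.derivative k (PowerSeries.X ^ p * u)
        =
        PowerSeries.X ^ p * ((p : k⟦X⟧) * u + PowerSeries.X * PowerSeries.derivative k u) := by
      intro p u
      rw [Derivation.leibniz, Derivation.leibniz_pow, smul_eq_mul, smul_eq_mul, smul_eq_mul,
        nsmul_eq_mul]
      rw [show PowerSeries.derivative k PowerSeries.X = 1 from PowerSeries.derivative_X]
      rcases p with _ | p
      · simp
      · rw [Nat.add_sub_cancel]; ring
    have h1 : PowerSeries.X * PowerSeries.derivative k c * d =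
        c * (PowerSeries.X * PowerSeries.derivative k d) := by
      rw [mul_assoc, h]; ring
    rw [hu, hw, hX, hX] at h1
    have h2 : PowerSeries.X ^ p * PowerSeries.X ^ q *
        (((p : k⟦X⟧) * u + PowerSeries.X * PowerSeries.derivative k u) * w) =
        PowerSeries.X ^ p * PowerSeries.X ^ q *
            (u * ((q : k⟦X⟧) * w + PowerSeries.X * PowerSeries.derivative k w)) := by
      linear_combination h1
    have h3 := mul_left_cancel₀ (mul_ne_zero (pow_ne_zero _ PowerSeries.X_ne_zero)
      (pow_ne_zero _ PowerSeries.X_ne_zero)) h2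
    have h4 := congrArg PowerSeries.constantCoeff h3
    simp only [map_mul, map_add, map_natCast, PowerSeries.constantCoeff_X, zero_mul, add_zero] at h4
    have h5 : ((p : k) - q) * (constantCoeff u * constantCoeff w) = 0 := by
      linear_combination h4
    have h6 := (mul_eq_zero.mp h5).resolve_right (mul_ne_zero hu0 hw0)
    exact_mod_cast sub_eq_zero.mp h6
  let q := d.order.toNat
  let a := coeff q c / coeff q d
  refine ⟨a, ?_⟩
  by_contra hne
  have hne' : c - algebraMap k k⟦X⟧ a * d ≠ 0 := sub_ne_zero.mpr hne
  have hda : PowerSeries.derivative k (algebraMap k k⟦X⟧ a * d) =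
      algebraMap k k⟦X⟧ a * PowerSeries.derivative k d := by
    rw [← Algebra.smul_def, Derivation.map_smul, Algebra.smul_def]
  have h1 := key _ d hne' hd (by
    rw [map_sub, hda]
    linear_combination h)
  have h2 := coeff_order hne'
  rw [h1] at h2
  apply h2
  rw [map_sub, ← Algebra.smul_def, PowerSeries.coeff_smul, smul_eq_mul]
  change coeff q c - coeff q c / coeff q d * coeff q d = 0
  rw [div_mul_cancel₀ _ (coeff_order hd), sub_self]

/-- The Taylor expansion along the flow of `D` starting at the point `ev`. -/
def taylorSeries {k A : Type*} [Field k] [CommRing A] [Algebra k A] (D : Derivation k A A)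
    (ev : A →ₐ[k] k) (g : A) : k⟦X⟧ :=
  PowerSeries.mk fun n => ev ((⇑D)^[n] g) / (n.factorial : k)

section Taylor
variable {k A : Type*} [Field k] [CommRing A] [Algebra k A] (D : Derivation k A A)
    (ev : A →ₐ[k] k)

theorem taylorSeries_add (f g : A) :
    taylorSeries D ev (f + g) = taylorSeries D ev f + taylorSeries D ev g := by
  ext n
  simp only [taylorSeries, PowerSeries.coeff_mk, map_add, ← add_div]
  congr 1
  rw [← map_add]
  congr 1
  induction n generalizing f g with
  | zero => rfl
  | succ n ih => simp only [Function.iterate_succ_apply, map_add, ih]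

theorem constantCoeff_taylorSeries (g : A) :
    PowerSeries.constantCoeff (taylorSeries D ev g) = ev g := by
  rw [← PowerSeries.coeff_zero_eq_constantCoeff_apply, taylorSeries, PowerSeries.coeff_mk]
  simp

theorem taylorSeries_algebraMap (c : k) :
    taylorSeries D ev (algebraMap k A c) = PowerSeries.C c := by
  ext n
  rw [taylorSeries, PowerSeries.coeff_mk, PowerSeries.coeff_C]
  rcases n with _ | n
  · simp
  · rw [Function.iterate_succ_apply, Derivation.map_algebraMap]
    have : (⇑D)^[n] 0 = 0 := by
      induction n with
      | zero => rfl
      | succ n ih => rw [Function.iterate_succ_apply, map_zero, ih]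
    simp [this]

variable [CharZero k]

theorem derivative_taylorSeries (g : A) :
    PowerSeries.derivative k (taylorSeries D ev g) = taylorSeries D ev (D g) := by
  ext n
  rw [PowerSeries.coeff_derivative, taylorSeries, taylorSeries, PowerSeries.coeff_mk,
    PowerSeries.coeff_mk, Function.iterate_succ_apply, Nat.factorial_succ]
  have h1 : (n.factorial : k) ≠ 0 := Nat.cast_ne_zero.mpr n.factorial_ne_zero
  have h2 : (n : k) + 1 ≠ 0 := Nat.cast_add_one_ne_zero n
  push_cast
  field_simp

theorem taylorSeries_mul (f g : A) :
    taylorSeries D ev (f * g) = taylorSeries D ev f * taylorSeries D ev g := by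
  ext n
  induction n generalizing f g with
  | zero =>
    rw [PowerSeries.coeff_zero_eq_constantCoeff_apply,
        PowerSeries.coeff_zero_eq_constantCoeff_apply,
      map_mul]
    simp only [constantCoeff_taylorSeries, map_mul]
  | succ n ih =>
    have h2 : (n : k) + 1 ≠ 0 := Nat.cast_add_one_ne_zero n
    refine mul_right_cancel₀ h2 ?_
    rw [← PowerSeries.coeff_derivative, ← PowerSeries.coeff_derivative, derivative_taylorSeries,
      Derivation.leibniz, Derivation.leibniz, derivative_taylorSeries, derivative_taylorSeries]
    simp only [smul_eq_mul, taylorSeries_add, map_add, ih]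

/-- The Taylor expansion as an algebra homomorphism. -/
def taylorHom : A →ₐ[k] k⟦X⟧ where
  toFun := taylorSeries D ev
  map_one' := by rw [← map_one (algebraMap k A), taylorSeries_algebraMap, map_one]
  map_mul' := taylorSeries_mul D ev
  map_zero' := by rw [← map_zero (algebraMap k A), taylorSeries_algebraMap, map_zero]
  map_add' := taylorSeries_add D ev
  commutes' := taylorSeries_algebraMap D ev

theorem derivative_taylorHom (g : A) :
    PowerSeries.derivative k (taylorHom D ev g) = taylorHom D ev (D g) :=
  derivative_taylorSeries D ev g

end Taylor

theorem mem_range_algebraMap_of_isAlgebraic {k R : Type*} [Field k] [IsAlgClosed k] [CommRing R]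
    [IsDomain R] [Algebra k R] {x : R} {p : Polynomial k} (hp : p ≠ 0)
    (hx : Polynomial.aeval x p = 0) : ∃ c, x = algebraMap k R c := by
  have h1 : p.Splits := IsAlgClosed.splits p
  rw [h1.eq_prod_roots, map_mul, Polynomial.aeval_C, mul_eq_zero, map_multiset_prod] at hx
  rcases hx with hx | hx
  · exact absurd ((map_eq_zero_iff _ (algebraMap k R).injective).mp hx)
      (Polynomial.leadingCoeff_ne_zero.mpr hp)
  · rw [Multiset.prod_eq_zero_iff, Multiset.map_map, Multiset.mem_map] at hx
    obtain ⟨c, -, hc⟩ := hx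
    refine ⟨c, ?_⟩
    simpa [sub_eq_zero] using hc


theorem jacobianDerivation_self_right {K : Type*} [CommRing K] (P Q : Poly3 K) :
    jacobianDerivation P Q Q = 0 := by
  rw [jacobianDerivation_apply]; ring

theorem not_dvd_of_isHomogeneous_lt {R σ : Type*} [CommRing R] [IsDomain R] {G H : MvPolynomial σ R}
    {a b : ℕ} (hG : G.IsHomogeneous a) (hH : H.IsHomogeneous b) (hba : b < a) (hH0 : H ≠ 0) :
    ¬ G ∣ H := by
  rintro ⟨u, rfl⟩
  have h1 := hH.totalDegree hH0
  rw [totalDegree_mul_of_isDomain (left_ne_zero_of_mul hH0) (right_ne_zero_of_mul hH0),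
    hG.totalDegree (left_ne_zero_of_mul hH0)] at h1
  omega

theorem pos_degree_of_irreducible {K : Type*} [Field K] {G : Poly3 K} {e : ℕ} (hG : Irreducible G)
    (hGh : G.IsHomogeneous e) : 0 < e := by
  rcases Nat.eq_zero_or_pos e with rfl | h
  · exfalso
    have h1 := totalDegree_eq_zero_iff_eq_C.mp (Nat.le_zero.mp hGh.totalDegree_le)
    have h2 : G.coeff 0 ≠ 0 := fun h => hG.ne_zero (by rw [h1, h, map_zero])
    exact hG.not_isUnit (h1 ▸ (isUnit_iff_ne_zero.mpr h2).map C)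
  · exact h

theorem pderiv_eq_zero_of_dvd {K : Type*} [Field K] {G : Poly3 K} {e : ℕ} (hG : Irreducible G)
    (hGh : G.IsHomogeneous e) {l : Fin 3} (h : G ∣ pderiv l G) : pderiv l G = 0 := by
  by_contra hne
  have := pos_degree_of_irreducible hG hGh
  exact not_dvd_of_isHomogeneous_lt hGh hGh.pderiv (by omega) hne h

theorem exists_not_dvd_pderiv {K : Type*} [Field K] [CharZero K] {G : Poly3 K} {e : ℕ}
    (hG : Irreducible G) (hGh : G.IsHomogeneous e) : ∃ l, ¬ G ∣ pderiv l G := by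
  by_contra! h
  have h1 := hGh.sum_X_mul_pderiv
  simp only [pderiv_eq_zero_of_dvd hG hGh (h _), mul_zero, Finset.sum_const_zero] at h1
  have h2 := pos_degree_of_irreducible hG hGh
  exact hG.ne_zero ((smul_eq_zero.mp h1.symm).resolve_left (by omega))

/-- In characteristic `0` the derivation `∂_{G,X_i}` does not vanish identically on `G = 0`. -/
theorem exists_not_dvd_jacobianDerivation {K : Type*} [Field K] [CharZero K] {G : Poly3 K} {e : ℕ}
    (hG : Irreducible G) (hGh : G.IsHomogeneous e) {i : Fin 3} (hi : ¬ G ∣ X i) :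
    ∃ l, ¬ G ∣ jacobianDerivation G (X i) (X l) := by
  by_contra! h
  have h1 : ∀ l, l ≠ i → pderiv l G = 0 := by
    intro l hl
    apply pderiv_eq_zero_of_dvd hG hGh
    obtain rfl | rfl | rfl : i = 0 ∨ i = 1 ∨ i = 2 := by omega
    · obtain rfl | rfl : l = 1 ∨ l = 2 := by omega
      · simpa [jacobianDerivation_apply, pderiv_X, Pi.single_apply] using h 2
      · simpa [jacobianDerivation_apply, pderiv_X, Pi.single_apply] using h 1
    · obtain rfl | rfl : l = 0 ∨ l = 2 := by omega
      · simpa [jacobianDerivation_apply, pderiv_X, Pi.single_apply] using h 2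
      · simpa [jacobianDerivation_apply, pderiv_X, Pi.single_apply] using h 0
    · obtain rfl | rfl : l = 0 ∨ l = 1 := by omega
      · simpa [jacobianDerivation_apply, pderiv_X, Pi.single_apply] using h 1
      · simpa [jacobianDerivation_apply, pderiv_X, Pi.single_apply] using h 0
  have h2 := hGh.sum_X_mul_pderiv
  rw [Finset.sum_eq_single i (fun l _ hl => by rw [h1 l hl, mul_zero]) (by simp)] at h2
  have h3 : G ∣ X i * pderiv i G := h2 ▸ (Dvd.intro_left (e : Poly3 K) (by rw [nsmul_eq_mul]))
  have h4 := (hG.prime.dvd_or_dvd h3).resolve_left hi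
  obtain ⟨l, hl⟩ := exists_not_dvd_pderiv hG hGh
  by_cases hli : l = i
  · exact hl (hli ▸ h4)
  · exact hl (by rw [h1 l hli]; exact dvd_zero _)

/-- The Nullstellensatz for a prime principal ideal. -/
theorem dvd_of_forall_eval {k : Type*} [Field k] [IsAlgClosed k] {G H : Poly3 k} (hG : Prime G)
    (h : ∀ x : Fin 3 → k, eval x G = 0 → eval x H = 0) : G ∣ H := by
  have h1 : H ∈ vanishingIdeal k (zeroLocus k (Ideal.span {G})) := by
    rw [mem_vanishingIdeal_iff]
    intro x hx
    rw [mem_zeroLocus_iff] at hx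
    have e1 : ∀ p : Poly3 k, aeval x p = eval x p := fun p => by rw [← coe_aeval_eq_eval]; rfl
    rw [e1]
    exact h x (by rw [← e1]; exact hx G (Ideal.mem_span_singleton_self G))
  rw [vanishingIdeal_zeroLocus_eq_radical,
    ((Ideal.span_singleton_prime hG.ne_zero).mpr hG).radical, Ideal.mem_span_singleton] at h1
  exact h1

/-- The Wronskian of a linear system is not identically zero on an irreducible curve on which the
system is nondegenerate: along an analytic arc of the curve the system stays linearly independent.
    -/
theorem not_dvd_wronskian {k : Type*} [Field k] [IsAlgClosed k] [CharZero k] {G : Poly3 k}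
    {e d n : ℕ}
    (hG : Irreducible G) (hGh : G.IsHomogeneous e) {v : Fin n → Poly3 k}
    (hvh : ∀ j, (v j).IsHomogeneous d)
    (hv : ∀ c : Fin n → k, c ≠ 0 → ¬ G ∣ ∑ j, C (c j) * v j) {a : Fin 3 → k}
    (ha : ¬ G ∣ linearForm a) : ¬ G ∣ wronskian (jacobianDerivation G (linearForm a)) v := by
  obtain ⟨i, hi⟩ : ∃ i, ¬ G ∣ X i := by
    by_contra! h
    exact ha (Finset.dvd_sum fun i _ => Dvd.dvd.mul_left (h i) _)
  suffices h : ¬ G ∣ wronskian (jacobianDerivation G (X i)) v by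
    intro hW
    have h1 := linearForm_pow_mul_wronskian_sub_mem hGh hvh (Pi.single i 1) a
    rw [← X_eq_linearForm, Ideal.mem_span_singleton] at h1
    have h2 := (dvd_sub_right (Dvd.dvd.mul_left hW _)).mp h1
    rcases hG.prime.dvd_or_dvd h2 with h3 | h3
    · exact ha (hG.prime.dvd_of_dvd_pow h3)
    · exact h h3
  set D := jacobianDerivation G (X i) with hDdef
  obtain ⟨l, hl⟩ := exists_not_dvd_jacobianDerivation hG hGh hi
  obtain ⟨x, hxG, hxi, hxl⟩ : ∃ x : Fin 3 → k, eval x G = 0 ∧ x i ≠ 0 ∧ eval x (D (X l)) ≠ 0 := by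
    by_contra! h
    have h1 : G ∣ X i * D (X l) := dvd_of_forall_eval hG.prime fun x hx => by
      rw [map_mul, eval_X]
      by_cases hxi : x i = 0
      · rw [hxi, zero_mul]
      · rw [h x hx hxi, mul_zero]
    exact (hG.prime.dvd_or_dvd h1).elim hi hl
  let θ := taylorHom D (aeval (R := k) x)
  have hθc : ∀ g, PowerSeries.constantCoeff (θ g) = eval x g := fun g => by
    rw [← coe_aeval_eq_eval]
    exact constantCoeff_taylorSeries D _ g
  have hθG : θ G = 0 := by
    apply PowerSeries.derivative.ext
    · rw [derivative_taylorHom, hDdef, jacobianDerivation_self, map_zero, map_zero]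
    · rw [hθc, hxG, map_zero]
  have hθi : θ (X i) = PowerSeries.C (x i) := by
    apply PowerSeries.derivative.ext
    · rw [derivative_taylorHom, hDdef, jacobianDerivation_self_right, map_zero,
        PowerSeries.derivative_C]
    · rw [hθc, eval_X, PowerSeries.constantCoeff_C]
  have hil : i ≠ l := by
    rintro rfl
    exact hxl (by rw [hDdef, jacobianDerivation_self_right, map_zero])
  have hinj : ∀ c : Fin n → k, c ≠ 0 → θ (∑ j, C (c j) * v j) ≠ 0 := by
    intro c hc hz
    have hhom : (∑ j, C (c j) * v j).IsHomogeneous d :=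
      IsHomogeneous.sum _ _ _ fun j _ => (hvh j).C_mul _
    obtain ⟨h, N, h0, h1, h2⟩ := hasBinaryForms_of_prime hGh hhom hG.prime (hv c hc) i l hil
    have h3 : θ (rename ![i, l] h) = 0 := by
      obtain ⟨p, q, hpq⟩ := Ideal.mem_span_pair.mp h2
      rw [← hpq, map_add, map_mul, map_mul, hθG, hz, mul_zero, mul_zero, add_zero]
    have h4 : Polynomial.aeval (θ (X l)) (aeval ![Polynomial.C (x i), Polynomial.X] h) = 0 := by
      rw [← h3, ← AlgHom.comp_apply, comp_aeval, ← aeval_X_left_apply (rename ![i, l] h),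
        ← AlgHom.comp_apply θ, comp_aeval, aeval_rename]
      congr 2
      funext j
      fin_cases j
      · simpa using hθi.symm
      · simp
    obtain ⟨c', hc'⟩ := mem_range_algebraMap_of_isAlgebraic (aeval_binaryForm_ne_zero h0 h1 hxi) h4
    apply hxl
    rw [← hθc, ← derivative_taylorHom]
    change PowerSeries.constantCoeff (PowerSeries.derivative k (θ (X l))) = 0
    rw [hc', Derivation.map_algebraMap, map_zero]
  have hli : LinearIndependent k (fun j => θ (v j)) := by
    rw [Fintype.linearIndependent_iff]
    intro c hc
    by_contra! hne
    refine hinj c (fun h => ?_) ?_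
    · obtain ⟨j, hj⟩ := hne
      exact hj (congrFun h j)
    · rw [map_sum, ← hc]
      refine Finset.sum_congr rfl fun j _ => ?_
      rw [C_mul', map_smul]
  have hdet := det_iterate_derivation_ne_zero (PowerSeries.derivative k)
    (fun c d hd h => exists_eq_C_mul_of_derivative c d hd h) _ hli
  rintro ⟨u, hu⟩
  apply hdet
  have h1 : θ (wronskian D v) = 0 := by rw [hu, map_mul, hθG, zero_mul]
  rw [← h1]
  change _ = (θ : Poly3 k →+* k⟦X⟧) _
  rw [wronskian, RingHom.map_det]
  congr 1
  ext1 p j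
  have h2 : ∀ (p : ℕ) g, (⇑(PowerSeries.derivative k))^[p] (θ g) = θ ((⇑D)^[p] g) := by
    intro p g
    induction p with
    | zero => rfl
    | succ p ih =>
      rw [Function.iterate_succ_apply', ih, Function.iterate_succ_apply']
      exact derivative_taylorHom _ _ _
  exact h2 p (v j)

/-! ### Wronskians on reducible curves -/

theorem exists_wronskian_isHomogeneous {K : Type*} [CommRing K] [IsDomain K] {P : Poly3 K}
    {e d n : ℕ} (hP : P.IsHomogeneous e) {v : Fin n → Poly3 K} (hv : ∀ j, (v j).IsHomogeneous d)
    (a : Fin 3 → K) :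
    ∃ b, (wronskian (jacobianDerivation P (linearForm a)) v).IsHomogeneous b := by
  rcases eq_or_ne (wronskian (jacobianDerivation P (linearForm a)) v) 0 with h0 | h0
  · exact ⟨0, h0 ▸ isHomogeneous_zero _ _ _⟩
  set D' := (X 0 : Poly3 K) • jacobianDerivation P (linearForm a)
  have hhom : ∀ l j, ((⇑D')^[l] (v j)).IsHomogeneous (d + l * (e - 1)) := by
    intro l j
    induction l with
    | zero => simpa using hv j
    | succ l ih =>
      rw [Function.iterate_succ_apply', Nat.succ_mul, ← add_assoc]
      have := isHomogeneous_linearForm_mul_jacobianDerivation hP ih a (Pi.single 0 1)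
      rw [← X_eq_linearForm] at this
      exact this
  have h1 : (wronskian D' v).IsHomogeneous (∑ i : Fin n, (d + i * (e - 1))) := by
    rw [wronskian, Matrix.det_apply]
    refine IsHomogeneous.sum _ _ _ fun σ _ => ?_
    have h2 : (∏ i, Matrix.of (fun i j : Fin n => (⇑D')^[(i : ℕ)] (v j)) (σ i) i).IsHomogeneous
        (∑ i : Fin n, (d + (σ i : ℕ) * (e - 1))) :=
      IsHomogeneous.prod _ _ _ fun i _ => hhom _ _
    rw [Equiv.sum_comp σ (fun i : Fin n => d + (i : ℕ) * (e - 1))] at h2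
    rcases Int.units_eq_one_or (Equiv.Perm.sign σ) with hs | hs
    · rw [hs, one_smul]; exact h2
    · rw [hs, Units.neg_smul, one_smul]; exact h2.neg
  rw [wronskian_smul] at h1
  exact exists_isHomogeneous_of_dvd h1 (mul_ne_zero (pow_ne_zero _ (X_ne_zero 0)) h0)
    (Dvd.intro_left _ rfl)

/-- On a component `G` of the curve `GQ = 0` the Wronskian is, up to a power of `Q`, that of `G`. -/
theorem wronskian_mul_sub_mem {K : Type*} [CommRing K] (G Q L : Poly3 K) {n : ℕ}
    (v : Fin n → Poly3 K) :
    wronskian (jacobianDerivation (Q * G) L) v -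
      Q ^ (n.choose 2) * wronskian (jacobianDerivation G L) v ∈ Ideal.span {G} := by
  refine wronskian_sub_mem_of_forall _ _ _ (fun x hx => ?_) _ (fun x => ?_) v
  · obtain ⟨b, rfl⟩ := Ideal.mem_span_singleton'.mp hx
    rw [jacobianDerivation_mul_left, Derivation.leibniz, jacobianDerivation_self, smul_zero,
      zero_add, smul_eq_mul]
    exact Ideal.add_mem _ (Ideal.mul_mem_left _ _ (Ideal.mul_mem_right _ _
      (Ideal.mem_span_singleton_self G)))
          (Ideal.mul_mem_right _ _ (Ideal.mem_span_singleton_self G))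
  · rw [jacobianDerivation_mul_left, add_sub_cancel_left]
    exact Ideal.mul_mem_right _ _ (Ideal.mem_span_singleton_self G)

/-- The Wronskian of a nondegenerate system does not vanish on a component `G` of multiplicity one
of the curve `QG = 0`. -/
theorem not_dvd_wronskian_mul {k : Type*} [Field k] [IsAlgClosed k] [CharZero k] {G Q : Poly3 k}
    {e d n : ℕ} (hG : Irreducible G) (hGh : G.IsHomogeneous e) (hQ : ¬ G ∣ Q) {v : Fin n → Poly3 k}
    (hvh : ∀ j, (v j).IsHomogeneous d)
    (hv : ∀ c : Fin n → k, c ≠ 0 → ¬ G ∣ ∑ j, C (c j) * v j) {a : Fin 3 → k}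
    (ha : ¬ G ∣ linearForm a) :
    ¬ G ∣ wronskian (jacobianDerivation (Q * G) (linearForm a)) v := by
  intro h
  have h1 := wronskian_mul_sub_mem G Q (linearForm a) v
  rw [Ideal.mem_span_singleton] at h1
  rcases hG.prime.dvd_or_dvd ((dvd_sub_right h).mp h1) with h2 | h2
  · exact hQ (hG.prime.dvd_of_dvd_pow h2)
  · exact not_dvd_wronskian hG hGh hvh hv ha h2

/-! ### Coefficients of the parameter -/

section Families
variable {k : Type*} [Field k]

theorem coeff_tCoeff (i : ℕ) (P : Poly3 k⟦X⟧) (m : Fin 3 →₀ ℕ) :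
    (tCoeff i P).coeff m = PowerSeries.coeff i (P.coeff m) := by
  classical
  rw [tCoeff, coeff_sum]
  simp only [coeff_monomial]
  rw [Finset.sum_ite_eq' P.support m]
  split_ifs with h
  · rfl
  · rw [notMem_support_iff.mp h, map_zero]

/-- The expansion of a family in powers of the parameter. -/
def expansion (k : Type*) [Field k] : Poly3 k⟦X⟧ →+* (Poly3 k)⟦X⟧ :=
  eval₂Hom (PowerSeries.map C) fun i => PowerSeries.C (X i)

theorem coeff_expansion (i : ℕ) (P : Poly3 k⟦X⟧) :
    PowerSeries.coeff i (expansion k P) = tCoeff i P := by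
  induction P using MvPolynomial.induction_on' with
  | add p q hp hq =>
    rw [map_add, map_add, hp, hq]
    ext m
    simp only [coeff_add, coeff_tCoeff, map_add]
  | monomial m c =>
    have h1 : expansion k (monomial m c) = PowerSeries.map C c *
        PowerSeries.C (monomial m (1 : k)) := by
      rw [expansion, coe_eval₂Hom, eval₂_monomial, monomial_eq (s := m), map_one, one_mul,
        Finsupp.prod, Finsupp.prod, map_prod]
      simp only [map_pow]
    ext m'
    rw [h1, coeff_tCoeff, PowerSeries.coeff_mul_C, PowerSeries.coeff_map, coeff_C_mul,
        coeff_monomial,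
      coeff_monomial]
    split_ifs <;> simp

/-- The constant family. -/
abbrev constFamily (k : Type*) [Field k] : Poly3 k →+* Poly3 k⟦X⟧ := MvPolynomial.map PowerSeries.C

theorem expansion_constFamily (g : Poly3 k) :
    expansion k (constFamily k g) = PowerSeries.C g := by
  induction g using MvPolynomial.induction_on with
  | C r => simp [expansion, constFamily]
  | add p q hp hq => rw [map_add, map_add, hp, hq, map_add]
  | mul_X p j hp => rw [map_mul, map_mul, hp, map_mul]; simp [expansion, constFamily]

theorem expansion_parameter : expansion k (C PowerSeries.X) = PowerSeries.X := by
  simp [expansion]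

theorem atZero_eq_tCoeff (P : Poly3 k⟦X⟧) : atZero P = tCoeff 0 P := by
  ext m
  rw [coeff_tCoeff, atZero, coeff_map, PowerSeries.coeff_zero_eq_constantCoeff]

theorem atZero_constFamily (g : Poly3 k) : atZero (constFamily k g) = g := by
  rw [atZero_eq_tCoeff, ← coeff_expansion, expansion_constFamily, PowerSeries.coeff_zero_C]

theorem parameter_pow_dvd {P : Poly3 k⟦X⟧} {n : ℕ} (h : ∀ i < n, tCoeff i P = 0) :
    C PowerSeries.X ^ n ∣ P := by
  rw [← C_pow, C_dvd_iff_dvd_coeff]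
  intro m
  rw [PowerSeries.X_pow_dvd_iff]
  intro i hi
  rw [← coeff_tCoeff, h i hi, coeff_zero]

theorem parameter_dvd_iff {P : Poly3 k⟦X⟧} : C PowerSeries.X ∣ P ↔ atZero P = 0 := by
  constructor
  · rintro ⟨u, rfl⟩
    simp [atZero]
  · intro h
    have := parameter_pow_dvd (P := P) (n := 1) (fun i hi => by
      rw [Nat.lt_one_iff.mp hi, ← atZero_eq_tCoeff, h])
    rwa [pow_one] at this

theorem atZero_mul (P Q : Poly3 k⟦X⟧) : atZero (P * Q) = atZero P * atZero Q := map_mul _ _ _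
theorem atZero_pow (P : Poly3 k⟦X⟧) (n : ℕ) : atZero (P ^ n) = atZero P ^ n := map_pow _ _ _
theorem atZero_parameter : atZero (C PowerSeries.X : Poly3 k⟦X⟧) = 0 := by simp [atZero]

theorem exactQuotient_mul {P Q : Poly3 k} (h : Q ∣ P) : exactQuotient P Q * Q = P := by
  rw [exactQuotient, dif_pos h, mul_comm]
  exact h.choose_spec.symm

/-! ### The discriminants -/

/-- The coefficients `δ_0 = G`, `δ_i = Δ_i / 2G` of the approximate square root of `F / B`. -/
def rootCoeff (F : Poly3 k⟦X⟧) (B G : Poly3 k) (i : ℕ) : Poly3 k :=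
  if i = 0 then G else C 2⁻¹ * exactQuotient (discriminant F B G i) G

theorem discriminant_add_sum (F : Poly3 k⟦X⟧) (B G : Poly3 k) (q : ℕ) :
    discriminant F B G (q + 1) + ∑ i ∈ Finset.range q,
      rootCoeff F B G (i + 1) * rootCoeff F B G (q - i) = B ^ q * tCoeff (q + 1) F := by
  rcases q with _ | q
  · simp [discriminant]
  · rw [discriminant, ← Fin.sum_univ_eq_sum_range
      (fun i => rootCoeff F B G (i + 1) * rootCoeff F B G (q + 1 - i)), sub_add_eq_add_sub,
      sub_eq_iff_eq_add]
    congr 1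
    refine Finset.sum_congr rfl fun i _ => ?_
    have := i.2
    rw [rootCoeff, rootCoeff, if_neg (by omega), if_neg (by omega)]

theorem sum_antidiagonal_rootCoeff {F : Poly3 k⟦X⟧} {B G : Poly3 k} (q : ℕ) :
    ∑ p ∈ Finset.HasAntidiagonal.antidiagonal (q + 1), rootCoeff F B G p.1 * rootCoeff F B G p.2 =
      2 * G * rootCoeff F B G (q + 1) + ∑ i ∈ Finset.range q,
      rootCoeff F B G (i + 1) * rootCoeff F B G (q - i) := by
  rw [Finset.Nat.sum_antidiagonal_eq_sum_range_succ
    (fun i j => rootCoeff F B G i * rootCoeff F B G j), Finset.sum_range_succ,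
    Finset.sum_range_succ']
  have h0 : rootCoeff F B G 0 = G := if_pos rfl
  rw [Nat.sub_self, Nat.sub_zero, h0]
  have : ∀ i, q + 1 - (i + 1) = q - i := fun i => by omega
  simp only [this]
  ring

/-- The approximate square root `φ = ∑_{i<n} δ_i B^{n-1-i} tⁱ`. -/
def approxRoot (F : Poly3 k⟦X⟧) (B G : Poly3 k) (n : ℕ) : Poly3 k⟦X⟧ :=
  ∑ i ∈ Finset.range n, constFamily k (rootCoeff F B G i * B ^ (n - 1 - i)) * C PowerSeries.X ^ i

theorem tCoeff_approxRoot (F : Poly3 k⟦X⟧) (B G : Poly3 k) (n q : ℕ) :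
    tCoeff q (approxRoot F B G n) =
      if q < n then rootCoeff F B G q * B ^ (n - 1 - q) else 0 := by
  rw [← coeff_expansion, approxRoot, map_sum, map_sum]
  simp only [map_mul (expansion k), map_pow (expansion k), expansion_constFamily,
    expansion_parameter, PowerSeries.coeff_C_mul, PowerSeries.coeff_X_pow, mul_ite, mul_one,
        mul_zero]
  rw [Finset.sum_ite_eq (Finset.range n) q]
  simp only [Finset.mem_range]

variable [CharZero k]

theorem two_mul_rootCoeff {F : Poly3 k⟦X⟧} {B G : Poly3 k} {q : ℕ} (hq : q ≠ 0)
    (h : G ∣ discriminant F B G q) : 2 * G * rootCoeff F B G q = discriminant F B G q := by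
  rw [rootCoeff, if_neg hq, ← exactQuotient_mul h]
  have h2 : (2 : Poly3 k) * C 2⁻¹ = 1 := by
    rw [← map_ofNat C 2, ← C_mul, mul_inv_cancel₀ two_ne_zero, C_1]
  rw [exactQuotient_mul h]
  linear_combination (G * exactQuotient (discriminant F B G q) G) * h2 + exactQuotient_mul h

/-- Completing the square: if `G` divides the first `n - 1` discriminants, then
`B^{2n-2} F = B φ² + tⁿ ψ`, and `ψ` starts with the `n`-th discriminant. -/
theorem exists_square_expansion {F : Poly3 k⟦X⟧} {B G : Poly3 k} (hF0 : atZero F = G ^ 2 * B)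
    {n : ℕ}
    (hn : 1 ≤ n) (h : ∀ i, 1 ≤ i → i < n → G ∣ discriminant F B G i) :
    ∃ ψ, constFamily k B ^ (2 * n - 2) * F =
      constFamily k B * approxRoot F B G n ^ 2 + C PowerSeries.X ^ n * ψ ∧
      atZero ψ = B ^ (n - 1) * discriminant F B G n := by
  obtain ⟨n, rfl⟩ : ∃ p, n = p + 1 := ⟨n - 1, by omega⟩
  have hnn : 2 * (n + 1) - 2 = 2 * n := by omega
  rw [hnn, Nat.add_sub_cancel]
  have hcoef : ∀ q, tCoeff q (constFamily k B ^ (2 * n) * F -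
      constFamily k B * approxRoot F B G (n + 1) ^ 2) = B ^ (2 * n) * tCoeff q F -
      B * ∑ p ∈ Finset.HasAntidiagonal.antidiagonal q, tCoeff p.1 (approxRoot F B G (n + 1)) *
        tCoeff p.2 (approxRoot F B G (n + 1)) := by
    intro q
    rw [← coeff_expansion, map_sub, map_mul, map_pow, map_mul, map_pow, map_sub,
      expansion_constFamily, ← map_pow, PowerSeries.coeff_C_mul, PowerSeries.coeff_C_mul, sq,
      PowerSeries.coeff_mul]
    simp only [coeff_expansion]
  have hlow : ∀ q, q < n + 1 → ∑ p ∈ Finset.HasAntidiagonal.antidiagonal q,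
      tCoeff p.1 (approxRoot F B G (n + 1)) *
        tCoeff p.2 (approxRoot F B G (n + 1)) =
      B ^ (2 * n - q) * ∑ p ∈ Finset.HasAntidiagonal.antidiagonal q, rootCoeff F B G p.1 *
          rootCoeff F B G p.2 := by
    intro q hq
    rw [Finset.mul_sum]
    refine Finset.sum_congr rfl fun p hp => ?_
    rw [Finset.HasAntidiagonal.mem_antidiagonal] at hp
    rw [tCoeff_approxRoot, tCoeff_approxRoot, if_pos (by omega), if_pos (by omega)]
    have : 2 * n - q = (n + 1 - 1 - p.1) + (n + 1 - 1 - p.2) := by omega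
    rw [this, pow_add]; ring
  have hdvd : C PowerSeries.X ^ (n + 1) ∣ constFamily k B ^ (2 * n) * F -
      constFamily k B * approxRoot F B G (n + 1) ^ 2 := by
    refine parameter_pow_dvd fun q hq => ?_
    rw [hcoef, hlow q hq]
    rcases q with _ | q
    · rw [← atZero_eq_tCoeff, hF0, Finset.Nat.antidiagonal_zero, Finset.sum_singleton]
      have h0 : rootCoeff F B G 0 = G := if_pos rfl
      rw [h0, Nat.sub_zero]; ring
    · rw [sum_antidiagonal_rootCoeff, two_mul_rootCoeff (by omega) (h _ (by omega) hq),
        discriminant_add_sum]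
      have : 2 * n = 1 + ((2 * n - (q + 1)) + q) := by omega
      conv_lhs => enter [1, 1]; rw [this, pow_add, pow_add]
      ring
  obtain ⟨ψ, hψ⟩ := hdvd
  refine ⟨ψ, by linear_combination hψ, ?_⟩
  have h1 : atZero ψ = tCoeff (n + 1) (C PowerSeries.X ^ (n + 1) * ψ) := by
    rw [← coeff_expansion, map_mul, map_pow, expansion_parameter, PowerSeries.coeff_X_pow_mul',
      if_pos le_rfl, Nat.sub_self, coeff_expansion, atZero_eq_tCoeff]
  rw [h1, ← hψ, hcoef, Finset.Nat.sum_antidiagonal_eq_sum_range_succ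
    (fun i j => tCoeff i (approxRoot F B G (n + 1)) * tCoeff j (approxRoot F B G (n + 1))),
    Finset.sum_range_succ, Finset.sum_range_succ', tCoeff_approxRoot _ _ _ _ (n + 1 - 0),
    tCoeff_approxRoot _ _ _ _ (n + 1), if_neg (by omega), if_neg (by omega), mul_zero, zero_mul,
    add_zero, add_zero]
  have h2 : ∑ i ∈ Finset.range n, tCoeff (i + 1) (approxRoot F B G (n + 1)) *
      tCoeff (n + 1 - (i + 1)) (approxRoot F B G (n + 1)) = B ^ (n - 1) *
      ∑ i ∈ Finset.range n, rootCoeff F B G (i + 1) * rootCoeff F B G (n - i) := by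
    rw [Finset.mul_sum]
    refine Finset.sum_congr rfl fun i hi => ?_
    rw [Finset.mem_range] at hi
    rw [tCoeff_approxRoot, tCoeff_approxRoot, if_pos (by omega), if_pos (by omega)]
    have e1 : n + 1 - (i + 1) = n - i := by omega
    have e2 : n - 1 = (n + 1 - 1 - (i + 1)) + (n + 1 - 1 - (n + 1 - (i + 1))) := by omega
    rw [e2, pow_add, e1]; ring
  rw [h2]
  have h3 := discriminant_add_sum F B G n
  rcases n with _ | n
  · simp only [Finset.range_zero, Finset.sum_empty, add_zero, pow_zero, one_mul, mul_zero,
      sub_zero] at h3 ⊢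
    exact h3.symm
  · rw [Nat.add_sub_cancel]
    linear_combination -B ^ (n + 1) * h3

end Families

/-! ### Wronskians of a degenerating family -/

theorem map_wronskian_of_forall {R R' : Type*} [CommRing R] [CommRing R'] (f : R →+* R')
    {D : Derivation R (Poly3 R) (Poly3 R)} {D' : Derivation R' (Poly3 R') (Poly3 R')}
    (h : ∀ g, map f (D g) = D' (map f g)) {n : ℕ} (v : Fin n → Poly3 R) :
    map f (wronskian D v) = wronskian D' (fun j => map f (v j)) := by
  have h : ∀ i G, map f ((⇑D)^[i] G) = (⇑D')^[i] (map f G) := by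
    intro i G
    induction i with
    | zero => rfl
    | succ i ih => rw [Function.iterate_succ_apply', Function.iterate_succ_apply', h, ih]
  rw [wronskian, wronskian, RingHom.map_det]
  congr 1
  ext1 i j
  exact h _ _

/-- The derivation `φψ ∂_b + 2bψ ∂_φ - bφ ∂_ψ`.  When `b φ² + τ ψ` is a multiple of `F` for a
constant `τ`, its product with `φ` is proportional to `∂_F` on the curve `F = 0`. -/
def degenerationDerivation {R : Type*} [CommRing R] (b φ ψ L : Poly3 R) :
    Derivation R (Poly3 R) (Poly3 R) :=
  (φ * ψ) • jacobianDerivation b L + (2 * b * ψ) • jacobianDerivation φ L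
    - (b * φ) • jacobianDerivation ψ L

section Relation
variable {R : Type*} [CommRing R]

theorem degenerationDerivation_apply (b φ ψ L a : Poly3 R) :
    degenerationDerivation b φ ψ L a = φ * ψ * jacobianDerivation b L a
      + 2 * b * ψ * jacobianDerivation φ L a - b * φ * jacobianDerivation ψ L a := rfl

theorem jacobianDerivation_eq_zero {τ : Poly3 R} (hτ : ∀ i, pderiv i τ = 0) (L a : Poly3 R) :
    jacobianDerivation τ L a = 0 := by
  rw [jacobianDerivation_apply, hτ, hτ, hτ]; ring

/-- On `F = 0` the product of `φ` and the derivation `degenerationDerivation` is proportional to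
`∂_F`; the factor `φ` in `∂_F` is what makes the Wronskian vanish for `τ = 0`. -/
theorem smul_jacobianDerivation_sub {F b φ ψ c τ : Poly3 R} (h : c * F = b * φ ^ 2 + τ * ψ)
    (hτ : ∀ i, pderiv i τ = 0) (L a : Poly3 R) :
    ψ * c * jacobianDerivation F L a - φ * degenerationDerivation b φ ψ L a =
      (c * jacobianDerivation ψ L a - ψ * jacobianDerivation c L a) * F := by
  have h1 := congrArg (fun x => jacobianDerivation x L a) h
  simp only [jacobianDerivation_mul_left, jacobianDerivation_add_left, sq,
    jacobianDerivation_eq_zero hτ] at h1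
  rw [degenerationDerivation_apply]
  linear_combination ψ * h1 - jacobianDerivation ψ L a * h

theorem dvd_pow_mul_wronskian_sub {F b φ ψ c τ : Poly3 R} (h : c * F = b * φ ^ 2 + τ * ψ)
    (hτ : ∀ i, pderiv i τ = 0) (L : Poly3 R) {n : ℕ} (v : Fin n → Poly3 R) :
    F ∣ (ψ * c) ^ (n.choose 2) * wronskian (jacobianDerivation F L) v -
      φ ^ (n.choose 2) * wronskian (degenerationDerivation b φ ψ L) v := by
  rw [← wronskian_smul, ← Ideal.mem_span_singleton]
  refine wronskian_sub_mem_of_forall _ _ _ (fun x hx => ?_) _ (fun x => ?_) v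
  · exact Ideal.mul_mem_left _ _ (jacobianDerivation_mem_span _ _ x hx)
  · exact Ideal.mem_span_singleton'.mpr ⟨_, (smul_jacobianDerivation_sub h hτ L x).symm⟩

/-- On the curve `F = 0` the square of the Wronskian is divisible by a power of `τ`, up to factors
prime to `τ`. The square is needed in order to replace `b φ²` by `-τ ψ`. -/
theorem dvd_mul_wronskian_sq_sub {F b φ ψ c τ : Poly3 R} (h : c * F = b * φ ^ 2 + τ * ψ)
    (hτ : ∀ i, pderiv i τ = 0) (L : Poly3 R) {n : ℕ} (v : Fin n → Poly3 R) :
    F ∣ (b ^ (n.choose 2) * (ψ * c) ^ (2 * n.choose 2)) *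
        wronskian (jacobianDerivation F L) v ^ 2 -
      τ ^ (n.choose 2) * ((-ψ) ^ (n.choose 2) *
        wronskian (degenerationDerivation b φ ψ L) v ^ 2) := by
  obtain ⟨s, hs⟩ := dvd_pow_mul_wronskian_sub h hτ L v
  obtain ⟨r, hr⟩ := sub_dvd_pow_sub_pow (b * φ ^ 2) (-(τ * ψ)) (n.choose 2)
  set N := n.choose 2
  set w := wronskian (jacobianDerivation F L) v
  set W := wronskian (degenerationDerivation b φ ψ L) v
  rw [sub_neg_eq_add, ← h, mul_pow b, ← pow_mul, mul_comm 2 N, pow_mul φ, ← mul_neg,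
    mul_pow τ] at hr
  refine ⟨b ^ N * s * ((ψ * c) ^ N * w + φ ^ N * W) + c * r * W ^ 2, ?_⟩
  rw [mul_comm 2 N, pow_mul (ψ * c)]
  linear_combination b ^ N * ((ψ * c) ^ N * w + φ ^ N * W) * hs + W ^ 2 * hr

theorem map_degenerationDerivation {R' : Type*} [CommRing R'] (f : R →+* R') (b φ ψ L a : Poly3 R) :
    map f (degenerationDerivation b φ ψ L a) =
      degenerationDerivation (map f b) (map f φ) (map f ψ) (map f L) (map f a) := by
  simp only [degenerationDerivation_apply, map_add, map_sub, map_mul, map_jacobianDerivation,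
    map_ofNat]

/-- On `G = 0`, where `φ = G B^p` vanishes, only the term `2Bψ ∂_φ` of the derivation is left,
which is `2 B^{p+1} ψ ∂_G`. -/
theorem wronskian_degenerationDerivation_sub_mem (B G ψ L : Poly3 R) {p : ℕ} {n : ℕ}
    (v : Fin n → Poly3 R) :
    (2 * B ^ (p + 1) * ψ) ^ (n.choose 2) * wronskian (jacobianDerivation G L) v -
      wronskian (degenerationDerivation B (G * B ^ p) ψ L) v ∈ Ideal.span {G} := by
  rw [← wronskian_smul]
  have := wronskian_sub_mem_of_forall (Ideal.span {G})
      ((2 * B ^ (p + 1) * ψ) • jacobianDerivation G L)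
    (degenerationDerivation B (G * B ^ p) ψ L) (fun x hx => Ideal.mul_mem_left _ _
      (jacobianDerivation_mem_span _ _ x hx)) 1 (fun x => ?_) v
  · rwa [one_pow, one_mul] at this
  · rw [degenerationDerivation_apply, jacobianDerivation_mul_left, Derivation.smul_apply,
      smul_eq_mul, one_mul, Ideal.mem_span_singleton]
    refine ⟨-(B ^ p * ψ * jacobianDerivation B L x + 2 * B * ψ * jacobianDerivation (B ^ p) L x
      - B * B ^ p * jacobianDerivation ψ L x), ?_⟩
    ring

end Relation

/-! ### Reduced curves -/

/-- A nonzero form does not vanish on the affine chart `X_i = 1`. -/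
theorem not_X_sub_one_dvd {K : Type*} [CommRing K] [IsDomain K] {H : Poly3 K} {n : ℕ}
    (hH : H.IsHomogeneous n) (h0 : H ≠ 0) (i : Fin 3) : ¬ (X i - 1 : Poly3 K) ∣ H := by
  intro h
  obtain ⟨a, ha⟩ := exists_isHomogeneous_of_dvd hH h0 h
  have h1 : homogeneousComponent 1 (X i - 1 : Poly3 K) = X i := by
    rw [map_sub, homogeneousComponent_of_mem (m := 1) (isHomogeneous_X K i), if_pos rfl,
      homogeneousComponent_of_mem (m := 1) (isHomogeneous_one (Fin 3) K), if_neg (by omega),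
          sub_zero]
  have h2 : homogeneousComponent 0 (X i - 1 : Poly3 K) = -1 := by
    rw [map_sub, homogeneousComponent_of_mem (m := 0) (isHomogeneous_X K i), if_neg (by omega),
      homogeneousComponent_of_mem (m := 0) (isHomogeneous_one (Fin 3) K), if_pos rfl, zero_sub]
  rw [homogeneousComponent_of_mem (m := 1) ha] at h1
  rw [homogeneousComponent_of_mem (m := 0) ha] at h2
  by_cases ha1 : 1 = a
  · rw [if_neg (by omega)] at h2
    exact one_ne_zero (neg_eq_zero.mp h2.symm)
  · rw [if_neg ha1] at h1
    exact X_ne_zero i h1.symm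

/-- Setting `X i = 1`. -/
def dehomogenize (K : Type*) [CommRing K] (i : Fin 3) : Poly3 K →ₐ[K] Poly3 K :=
  aeval (Function.update X i 1)

theorem X_sub_one_dvd_sub_dehomogenize {K : Type*} [CommRing K] (i : Fin 3) (p : Poly3 K) :
    (X i - 1 : Poly3 K) ∣ p - dehomogenize K i p := by
  induction p using MvPolynomial.induction_on with
  | C r => simp [dehomogenize]
  | add p q hp hq =>
    rw [map_add, add_sub_add_comm]
    exact dvd_add hp hq
  | mul_X p j hp =>
    have h1 : (X i - 1 : Poly3 K) ∣ X j - dehomogenize K i (X j) := by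
      rw [dehomogenize, aeval_X]
      by_cases h : j = i
      · subst h; simp
      · simp [h]
    obtain ⟨a, ha⟩ := hp
    obtain ⟨b, hb⟩ := h1
    rw [map_mul]
    exact ⟨a * X j + dehomogenize K i p * b, by linear_combination X j * ha + dehomogenize K i p *
        hb⟩

theorem dehomogenize_ne_zero {K : Type*} [CommRing K] [IsDomain K] {H : Poly3 K} {n : ℕ}
    (hH : H.IsHomogeneous n) (h0 : H ≠ 0) (i : Fin 3) : dehomogenize K i H ≠ 0 := fun h => by
  have := X_sub_one_dvd_sub_dehomogenize i H
  rw [h, sub_zero] at this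
  exact not_X_sub_one_dvd hH h0 i this

theorem eq_C_mul_X_pow_of_isUnit_dehomogenize {K : Type*} [Field K] {H : Poly3 K} {n : ℕ}
    (hH : H.IsHomogeneous n) {i : Fin 3} (h : IsUnit (dehomogenize K i H)) :
    ∃ c : K, c ≠ 0 ∧ H = C c * X i ^ n := by
  obtain ⟨c, hc, hcH⟩ := (MvPolynomial.isUnit_iff_eq_C_of_isReduced).mp h
  refine ⟨c, hc.ne_zero, ?_⟩
  rw [← sub_eq_zero]
  by_contra h0
  have h1 : (H - C c * X i ^ n).IsHomogeneous n := by
    refine hH.sub ?_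
    simpa using (isHomogeneous_C (Fin 3) c).mul ((isHomogeneous_X K i).pow n)
  apply dehomogenize_ne_zero h1 h0 i
  rw [map_sub, hcH, map_mul, map_pow]
  simp [dehomogenize]

/-- The equation of a geometrically reduced curve is square-free. -/
theorem not_sq_dvd_of_isGeometricallyReduced {K : Type*} [Field K] {H P : Poly3 K} {n p : ℕ}
    (hH : IsGeometricallyReducedSubscheme (Ideal.span {H})) (hHh : H.IsHomogeneous n) (hH0 : H ≠ 0)
    (hP : P.IsHomogeneous p) (hp : 0 < p) : ¬ P ^ 2 ∣ H := by
  rintro ⟨Q, hQ⟩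
  have hPQ : P * Q ∣ H := ⟨P, by rw [hQ]; ring⟩
  obtain ⟨q, hq⟩ := exists_isHomogeneous_of_dvd hHh hH0 hPQ
  have hPQ0 : P * Q ≠ 0 := fun h => hH0 (by rw [hQ, sq, mul_assoc, h, mul_zero])
  have hunit : ∀ i, IsUnit (dehomogenize K i P) := by
    intro i
    have := hH i
    have hred : IsReduced (Poly3 K ⧸ chartIdeal (Ideal.span {H}) i) :=
      Algebra.isReduced_of_isGeometricallyReduced (k := K)
    have h1 : (P * Q) ^ 2 ∈ chartIdeal (Ideal.span {H}) i := by
      refine Ideal.mem_sup_left (Ideal.mem_span_singleton.mpr ⟨Q, ?_⟩)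
      rw [hQ]; ring
    have h2 : P * Q ∈ chartIdeal (Ideal.span {H}) i := by
      rw [← Ideal.Quotient.eq_zero_iff_mem] at h1 ⊢
      rw [map_pow] at h1
      exact eq_zero_of_pow_eq_zero h1
    obtain ⟨x, hx, y, hy, hxy⟩ := Submodule.mem_sup.mp h2
    obtain ⟨u, rfl⟩ := Ideal.mem_span_singleton'.mp hx
    obtain ⟨z, rfl⟩ := Ideal.mem_span_singleton'.mp hy
    have h3 := congrArg (dehomogenize K i) hxy
    have h4 : dehomogenize K i (X i - 1) = 0 := by simp [dehomogenize]
    rw [map_add, map_mul, map_mul _ z, h4, mul_zero, add_zero, hQ] at h3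
    have h5 : dehomogenize K i (P * Q) * (dehomogenize K i u * dehomogenize K i P) =
        dehomogenize K i (P * Q) * 1 := by
      simp only [map_mul, map_pow] at h3 ⊢
      linear_combination h3
    exact IsUnit.of_mul_eq_one_right _
      (mul_left_cancel₀ (dehomogenize_ne_zero hq hPQ0 i) h5)
  obtain ⟨c, hc, h0⟩ := eq_C_mul_X_pow_of_isUnit_dehomogenize hP (hunit 0)
  obtain ⟨c', -, h1⟩ := eq_C_mul_X_pow_of_isUnit_dehomogenize hP (hunit 1)
  have h2 := congrArg (eval (Pi.single 0 1)) (h0.symm.trans h1)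
  simp [hp.ne'] at h2
  exact hc h2

/-! ### Existence of the type -/

theorem exists_irreducible_dvd_mem {R : Type*} [CommRing R] [IsDomain R]
    [UniqueFactorizationMonoid R] {Q : Ideal R} [hQ : Q.IsPrime] {F : R} (hF0 : F ≠ 0) (hF : F ∈ Q)
        :
    ∃ P, Irreducible P ∧ P ∣ F ∧ P ∈ Q := by
  induction F using WfDvdMonoid.induction_on_irreducible with
  | zero => exact absurd rfl hF0
  | unit u hu => exact absurd (Ideal.eq_top_of_isUnit_mem _ hF hu) hQ.ne_top
  | mul x p hx hp ih =>
    rcases hQ.mem_or_mem hF with h | h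
    · exact ⟨p, hp, Dvd.intro _ rfl, h⟩
    · obtain ⟨P, h1, h2, h3⟩ := ih hx h
      exact ⟨P, h1, Dvd.dvd.mul_left h2 _, h3⟩

/-- Krull's intersection theorem in `R_Q / P`. -/
theorem dvd_of_forall_mul_mem {R : Type*} [CommRing R] [IsDomain R] [IsNoetherianRing R]
    {Q : Ideal R} [hQ : Q.IsPrime] {P t g : R} (hP : Prime P) (hPQ : P ∈ Q) (ht : t ∈ Q)
    (h : ∀ n : ℕ, ∃ s, s ∉ Q ∧ s * g ∈ Ideal.span {P, t ^ n}) : P ∣ g := by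
  let M := Localization.AtPrime Q
  let I : Ideal M := Ideal.span {algebraMap R M t}
  have hI : I ≠ ⊤ := by
    intro h
    have h1 : I ≤ IsLocalRing.maximalIdeal M := by
      rw [Ideal.span_le, Set.singleton_subset_iff]
      exact (IsLocalization.AtPrime.to_map_mem_maximal_iff M Q t).mpr ht
    exact (IsLocalRing.maximalIdeal.isMaximal M).ne_top (top_le_iff.mp (h ▸ h1))
  have hK := Ideal.iInf_pow_smul_eq_bot_of_isLocalRing (M := M ⧸ Ideal.span {algebraMap R M P}) I hI
  have hmem : (Ideal.Quotient.mk (Ideal.span {algebraMap R M P}) (algebraMap R M g)) ∈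
      ⨅ i : ℕ, I ^ i • (⊤ : Submodule M (M ⧸ Ideal.span {algebraMap R M P})) := by
    rw [Submodule.mem_iInf]
    intro n
    obtain ⟨s, hs, hsg⟩ := h n
    obtain ⟨x, y, hxy⟩ := Ideal.mem_span_pair.mp hsg
    have hu : IsUnit (algebraMap R M s) := IsLocalization.map_units M (⟨s, hs⟩ : Q.primeCompl)
    obtain ⟨u, hu⟩ := hu.exists_left_inv
    have h1 : algebraMap R M g = (u * algebraMap R M x) * algebraMap R M P +
        algebraMap R M t ^ n * (u * algebraMap R M y) := by
      have := congrArg (algebraMap R M) hxy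
      simp only [map_add, map_mul, map_pow] at this
      linear_combination -(algebraMap R M g) * hu - u * this
    have h2 : Ideal.Quotient.mk (Ideal.span {algebraMap R M P}) (algebraMap R M g) =
        algebraMap R M t ^ n •
        Ideal.Quotient.mk (Ideal.span {algebraMap R M P}) (u * algebraMap R M y) := by
      change _ = Ideal.Quotient.mk (Ideal.span {algebraMap R M P})
        (algebraMap R M t ^ n • (u * algebraMap R M y))
      rw [Ideal.Quotient.eq, h1, smul_eq_mul, add_sub_cancel_right]
      exact Ideal.mul_mem_left _ _ (Ideal.mem_span_singleton_self _)
    rw [h2]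
    exact Submodule.smul_mem_smul (Ideal.pow_mem_pow (Ideal.mem_span_singleton_self _) n)
      Submodule.mem_top
  rw [hK, Submodule.mem_bot, Ideal.Quotient.eq_zero_iff_mem, ← Set.image_singleton,
      ← Ideal.map_span,
    IsLocalization.algebraMap_mem_map_algebraMap_iff Q.primeCompl] at hmem
  obtain ⟨s, hs, h1⟩ := hmem
  by_contra hPg
  rcases hP.dvd_or_dvd (Ideal.mem_span_singleton.mp h1) with h2 | h2
  · exact hs (Q.mem_of_dvd h2 hPQ)
  · exact hPg h2

/-- On `F = τ = 0` the partial derivatives of `F` are nilpotent up to the factor `b c²`: the curve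
is nonreduced there. -/
theorem mul_sq_pderiv_mem {R : Type*} [CommRing R] {F b φ ψ c τ : Poly3 R}
    (h : c * F = b * φ ^ 2 + τ * ψ) (i : Fin 3) (hτ : pderiv i τ = 0) :
    (b * c ^ 2) * pderiv i F ^ 2 ∈ Ideal.span {F, τ} := by
  have h1 := congrArg (pderiv i) h
  simp only [map_add, Derivation.leibniz, sq, smul_eq_mul, hτ, mul_zero, add_zero] at h1
  set η := φ * pderiv i b + 2 * b * pderiv i φ
  have h2 : c * pderiv i F = φ * η + (τ * pderiv i ψ - F * pderiv i c) := by
    simp only [η]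
    linear_combination h1
  rw [Ideal.mem_span_pair]
  refine ⟨c * η ^ 2 - b * pderiv i c * (c * pderiv i F + φ * η), -ψ * η ^ 2 +
    b * pderiv i ψ * (c * pderiv i F + φ * η), ?_⟩
  linear_combination η ^ 2 * h - b * (c * pderiv i F + φ * η) * h2

section FamilyType
variable {k : Type*} [Field k]

theorem pderiv_parameter_pow (i : Fin 3) (n : ℕ) :
    pderiv i (C PowerSeries.X ^ n : Poly3 k⟦X⟧) = 0 := by
  rw [← C_pow, pderiv_C]

theorem atZero_ne_zero_of_dvd {P F : Poly3 k⟦X⟧} (hF : atZero F ≠ 0) (h : P ∣ F) : atZero P ≠ 0 :=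
    by
  rintro h0
  obtain ⟨u, rfl⟩ := h
  exact hF (by rw [atZero_mul, h0, zero_mul])

theorem pos_degree_of_atZero_mem {P : Poly3 k⟦X⟧} {p : ℕ} (hP : P.IsHomogeneous p)
    (h0 : atZero P ≠ 0) (hu : ¬ IsUnit P) : 0 < p := by
  rcases Nat.eq_zero_or_pos p with rfl | h
  · exfalso
    have h1 := totalDegree_eq_zero_iff_eq_C.mp (Nat.le_zero.mp hP.totalDegree_le)
    rw [h1] at h0 hu
    apply hu
    refine IsUnit.map C (PowerSeries.isUnit_iff_constantCoeff.mpr (isUnit_iff_ne_zero.mpr ?_))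
    intro h
    apply h0
    rw [atZero, map_C, h, map_zero]
  · exact h

/-- A family with square-free generic member is of some type for each double component: otherwise
completing the square to arbitrary order exhibits a double component of the generic member. -/
theorem exists_isOfType [CharZero k] {F : Poly3 k⟦X⟧} {e : ℕ} (hF : F.IsHomogeneous e)
    {B G : Poly3 k}
    (hG : Irreducible G) (hB : ¬ G ∣ B) (hF0 : atZero F = G ^ 2 * B)
    (hsq : ∀ (P : Poly3 k⟦X⟧) (p : ℕ), P.IsHomogeneous p → 0 < p → ¬ P ^ 2 ∣ F) :
    ∃ n, IsOfType F B G n := by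
  by_contra! hno
  have hall : ∀ i, 1 ≤ i → G ∣ discriminant F B G i := by
    intro i
    induction i using Nat.strong_induction_on with
    | _ i ih =>
      intro hi
      by_contra h
      exact hno i ⟨hi, fun j hj hji => ih j hji hj, h⟩
  have hB0 : B ≠ 0 := fun h => hB (h ▸ dvd_zero _)
  have hF00 : atZero F ≠ 0 := hF0 ▸ mul_ne_zero (pow_ne_zero _ hG.ne_zero) hB0
  have hFne : F ≠ 0 := by rintro rfl; exact hF00 (map_zero _)
  let Q : Ideal (Poly3 k⟦X⟧) := (Ideal.span {G}).comap (map PowerSeries.constantCoeff)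
  have hGp : (Ideal.span {G}).IsPrime := (Ideal.span_singleton_prime hG.ne_zero).mpr hG.prime
  have hQ : Q.IsPrime := hGp.comap _
  have hmemQ : ∀ x, x ∈ Q ↔ G ∣ atZero x := fun x => by
    rw [← Ideal.mem_span_singleton]; rfl
  obtain ⟨P, hP, hPF, hPQ⟩ := exists_irreducible_dvd_mem (Q := Q) hFne
    ((hmemQ _).mpr (hF0 ▸ Dvd.dvd.mul_right (dvd_pow_self _ two_ne_zero) _))
  have hder : ∀ i, P ∣ pderiv i F := by
    intro i
    refine hP.prime.dvd_of_dvd_pow (n := 2) ?_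
    refine dvd_of_forall_mul_mem (Q := Q) (t := C PowerSeries.X) hP.prime hPQ
      ((hmemQ _).mpr (by rw [atZero_parameter]; exact dvd_zero _)) fun n => ?_
    obtain ⟨ψ, hψ, -⟩ := exists_square_expansion hF0 (n := n + 1) (by omega)
      (fun i hi _ => hall i hi)
    refine ⟨constFamily k B * (constFamily k B ^ (2 * (n + 1) - 2)) ^ 2, ?_, ?_⟩
    · rw [← pow_mul, ← pow_succ', hmemQ, atZero_pow, atZero_constFamily]
      exact fun h => hB (hG.prime.dvd_of_dvd_pow h)
    · have h1 := mul_sq_pderiv_mem hψ i (pderiv_parameter_pow i (n + 1))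
      refine (Ideal.span_le.mpr ?_) h1
      rintro x (rfl | rfl)
      · exact Ideal.mem_of_dvd _ hPF (Ideal.subset_span (by simp))
      · rw [pow_succ]
        exact Ideal.mul_mem_right _ _ (Ideal.subset_span (by simp))
  obtain ⟨p, hp⟩ := exists_isHomogeneous_of_dvd hF hFne hPF
  have hp0 := pos_degree_of_atZero_mem hp (atZero_ne_zero_of_dvd hF00 hPF) hP.not_isUnit
  obtain ⟨U, hU⟩ := hPF
  have hPU : ¬ P ∣ U := by
    rintro ⟨u, rfl⟩
    exact hsq P p hp hp0 ⟨u, by rw [hU]; ring⟩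
  have hz : ∀ i, pderiv i P = 0 := by
    intro i
    have h1 := hder i
    rw [hU, Derivation.leibniz, smul_eq_mul, smul_eq_mul] at h1
    have h2 := (hP.prime.dvd_or_dvd ((dvd_add_right (Dvd.intro _ rfl)).mp h1)).resolve_left hPU
    by_contra hne
    exact not_dvd_of_isHomogeneous_lt hp hp.pderiv (by omega) hne h2
  have h3 := hp.sum_X_mul_pderiv
  simp only [hz, mul_zero, Finset.sum_const_zero] at h3
  rw [nsmul_eq_mul] at h3
  have h4 := (mul_eq_zero.mp h3.symm).resolve_right hP.ne_zero
  rw [← map_natCast C, C_eq_zero, ← map_natCast PowerSeries.C] at h4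
  have h5 := congrArg PowerSeries.constantCoeff h4
  rw [PowerSeries.constantCoeff_C, map_zero] at h5
  exact hp0.ne' (by exact_mod_cast h5)

theorem exactQuotient_isHomogeneous {P Q : Poly3 k} {a b : ℕ} (hP : P.IsHomogeneous (a + b))
    (hQ : Q.IsHomogeneous b) (hQ0 : Q ≠ 0) : (exactQuotient P Q).IsHomogeneous a := by
  by_cases h : Q ∣ P
  · by_cases hP0 : P = 0
    · have : exactQuotient P Q = 0 := by
        have := exactQuotient_mul h
        rw [hP0] at this
        rw [hP0]
        exact (mul_eq_zero.mp this).resolve_right hQ0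
      rw [this]; exact isHomogeneous_zero _ _ _
    · have h1 := exactQuotient_mul h
      obtain ⟨c, hc⟩ := exists_isHomogeneous_of_dvd hP hP0 (Dvd.intro _ h1)
      have h2 := hc.mul hQ
      rw [h1] at h2
      have := h2.inj_right hP hP0
      have : c = a := by omega
      exact this ▸ hc
  · rw [exactQuotient, dif_neg h]; exact isHomogeneous_zero _ _ _

theorem tCoeff_isHomogeneous {F : Poly3 k⟦X⟧} {e : ℕ} (hF : F.IsHomogeneous e) (i : ℕ) :
    (tCoeff i F).IsHomogeneous e := by
  intro m hm
  refine hF (d := m) fun h => hm ?_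
  rw [coeff_tCoeff, h, map_zero]

theorem discriminant_isHomogeneous {F : Poly3 k⟦X⟧} {B G : Poly3 k} {b g : ℕ}
    (hF : F.IsHomogeneous (2 * g + b)) (hB : B.IsHomogeneous b) (hG : G.IsHomogeneous g)
    (hG0 : G ≠ 0) (i : ℕ) : (discriminant F B G i).IsHomogeneous (i * b + 2 * g) := by
  induction i using Nat.strong_induction_on with
  | _ i ih =>
    have hq : ∀ j, j < i → (C 2⁻¹ * exactQuotient (discriminant F B G j) G).IsHomogeneous
        (j * b + g) := fun j hj => by
      refine IsHomogeneous.C_mul (exactQuotient_isHomogeneous (b := g) ?_ hG hG0) _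
      have := ih j hj
      rwa [two_mul, ← add_assoc] at this
    clear ih
    match i, hq with
    | 0, _ => rw [discriminant]; exact isHomogeneous_zero _ _ _
    | 1, _ =>
      rw [discriminant, one_mul, add_comm]
      exact tCoeff_isHomogeneous hF 1
    | n + 2, hq =>
      rw [discriminant]
      refine IsHomogeneous.sub ?_ (IsHomogeneous.sum _ _ _ fun j _ => ?_)
      · have h1 := (hB.pow (n + 1)).mul (tCoeff_isHomogeneous hF (n + 2))
        have h2 : b * (n + 1) + (2 * g + b) = (n + 2) * b + 2 * g := by ring
        rwa [h2] at h1
      · have hj := j.2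
        have h1 := (hq (j + 1) (by omega)).mul (hq (n + 1 - j) (by omega))
        have h2 : (j + 1 : ℕ) * b + g + ((n + 1 - j : ℕ) * b + g) = (n + 2) * b + 2 * g := by
          have : n + 2 = (j + 1 : ℕ) + (n + 1 - j : ℕ) := by omega
          rw [this]; ring
        rwa [h2] at h1

end FamilyType

/-! ### Limits of linear systems -/

section Submodules
variable {R M : Type*} [CommRing R] [AddCommGroup M] [Module R M] {V : Submodule R M} {r : ℕ}

theorem sum_basis_eq_zero (b : Module.Basis (Fin r) R V) {c : Fin r → R}
    (h : ∑ j, c j • (b j : M) = 0) (j : Fin r) : c j = 0 := by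
  refine Fintype.linearIndependent_iff.mp b.linearIndependent c (Subtype.ext ?_) j
  simpa using h

theorem eq_sum_basis (b : Module.Basis (Fin r) R V) {P : M} (hP : P ∈ V) :
    ∃ c : Fin r → R, P = ∑ j, c j • (b j : M) := by
  refine ⟨b.repr ⟨P, hP⟩, ?_⟩
  have := congrArg Subtype.val (b.sum_repr ⟨P, hP⟩)
  refine (show P = _ from this.symm).trans ?_
  simp only [Submodule.coe_sum, Submodule.coe_smul]

theorem exists_basis_of_le_fg [IsDomain R] [IsPrincipalIdealRing R] [Module.IsTorsionFree R M]
    {W : Submodule R M} (hW : W.FG) (hV : V ≤ W) (hr : Module.finrank R V = r) :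
    Nonempty (Module.Basis (Fin r) R V) := by
  have h1 : Module.Finite R W := Module.Finite.iff_fg.mpr hW
  have h3 : Module.Finite R V := Module.Finite.of_injective (Submodule.inclusion hV)
    (Submodule.inclusion_injective hV)
  exact ⟨Module.finBasisOfFinrankEq R V hr⟩

end Submodules

section Systems
variable {k : Type*} [Field k]

theorem atZero_smul (c : k⟦X⟧) (P : Poly3 k⟦X⟧) :
    atZero (c • P) = PowerSeries.constantCoeff c • atZero P := by
  rw [← C_mul', atZero_mul, ← C_mul']
  congr 1
  simp [atZero]

theorem genericFiber_smul (c : k⟦X⟧) (P : Poly3 k⟦X⟧) :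
    genericFiber (c • P) = algebraMap k⟦X⟧ k⸨X⸩ c • genericFiber P := by
  rw [← C_mul', genericFiber, map_mul, map_C, C_mul']; rfl

theorem genericFiber_injective : Function.Injective (genericFiber (k := k)) :=
  map_injective _ (IsFractionRing.injective k⟦X⟧ k⸨X⸩)

variable {V : Submodule k⟦X⟧ (Poly3 k⟦X⟧)} {r : ℕ} (b : Module.Basis (Fin r) k⟦X⟧ V)

/-- Since `V` is saturated, a basis of `V` specializes to a basis of `V(0)`. -/
theorem exists_basis_specialSystem (hsat : IsSaturated V) :
    ∃ b0 : Module.Basis (Fin r) k (specialSystem V), ∀ j, (b0 j : Poly3 k) = atZero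
        (b j : Poly3 k⟦X⟧) := by
  have hli : LinearIndependent k (fun j => atZero (b j : Poly3 k⟦X⟧)) := by
    rw [Fintype.linearIndependent_iff]
    intro a ha
    set P : Poly3 k⟦X⟧ := ∑ j, PowerSeries.C (a j) • (b j : Poly3 k⟦X⟧)
    have hPV : P ∈ V := V.sum_mem fun j _ => V.smul_mem _ (b j).2
    have hP0 : atZero P = 0 := by
      rw [← ha]
      have : atZero P = ∑ j, atZero (PowerSeries.C (a j) • (b j : Poly3 k⟦X⟧)) := map_sum _ _ _
      rw [this]
      exact Finset.sum_congr rfl fun j _ => by rw [atZero_smul, PowerSeries.constantCoeff_C]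
    obtain ⟨Q, hQ⟩ := parameter_dvd_iff.mpr hP0
    rw [C_mul'] at hQ
    have hQV : Q ∈ V := hsat Q (hQ ▸ hPV)
    obtain ⟨c, hc⟩ := eq_sum_basis b hQV
    have h1 : ∑ j, (PowerSeries.C (a j) - PowerSeries.X * c j) • (b j : Poly3 k⟦X⟧) = 0 := by
      simp only [sub_smul, Finset.sum_sub_distrib, mul_smul, ← Finset.smul_sum]
      rw [← hc, ← hQ, sub_self]
    intro j
    have h2 := congrArg PowerSeries.constantCoeff (sum_basis_eq_zero b h1 j)
    simpa using h2
  have hspan : Submodule.span k (Set.range fun j => atZero (b j : Poly3 k⟦X⟧)) = specialSystem V :=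
      by
    apply le_antisymm
    · rw [Submodule.span_le]
      rintro _ ⟨j, rfl⟩
      exact Submodule.subset_span ⟨_, (b j).2, rfl⟩
    · rw [specialSystem, Submodule.span_le]
      rintro _ ⟨P, hP, rfl⟩
      obtain ⟨c, rfl⟩ := eq_sum_basis b hP
      have : atZero (∑ j, c j • (b j : Poly3 k⟦X⟧)) = ∑ j, atZero (c j • (b j : Poly3 k⟦X⟧)) :=
        map_sum _ _ _
      rw [this]
      refine Submodule.sum_mem _ fun j _ => ?_
      rw [atZero_smul]
      exact Submodule.smul_mem _ _ (Submodule.subset_span ⟨j, rfl⟩)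
  refine ⟨(Module.Basis.span hli).map (LinearEquiv.ofEq _ _ hspan), fun j => ?_⟩
  rw [Module.Basis.map_apply, LinearEquiv.coe_ofEq_apply, Module.Basis.span_apply]

theorem exists_basis_genericSystem :
    ∃ b1 : Module.Basis (Fin r) k⸨X⸩ (genericSystem V),
      ∀ j, (b1 j : Poly3 k⸨X⸩) = genericFiber (b j : Poly3 k⟦X⟧) := by
  have hli : LinearIndependent k⸨X⸩ (fun j => genericFiber (b j : Poly3 k⟦X⟧)) := by
    rw [← LinearIndependent.iff_fractionRing k⟦X⟧ k⸨X⸩, Fintype.linearIndependent_iff]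
    intro c hc
    refine sum_basis_eq_zero b (genericFiber_injective ?_)
    have h1 : genericFiber (∑ j, c j • (b j : Poly3 k⟦X⟧)) =
        ∑ j, genericFiber (c j • (b j : Poly3 k⟦X⟧)) := map_sum _ _ _
    have h2 : genericFiber (0 : Poly3 k⟦X⟧) = 0 := map_zero _
    rw [h1, h2, ← hc]
    refine Finset.sum_congr rfl fun j _ => ?_
    rw [genericFiber_smul, algebraMap_smul]
  have hspan : Submodule.span k⸨X⸩ (Set.range fun j => genericFiber (b j : Poly3 k⟦X⟧)) =
      genericSystem V := by
    apply le_antisymm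
    · rw [Submodule.span_le]
      rintro _ ⟨j, rfl⟩
      exact Submodule.subset_span ⟨_, (b j).2, rfl⟩
    · rw [genericSystem, Submodule.span_le]
      rintro _ ⟨P, hP, rfl⟩
      obtain ⟨c, rfl⟩ := eq_sum_basis b hP
      have : genericFiber (∑ j, c j • (b j : Poly3 k⟦X⟧)) =
        ∑ j, genericFiber (c j • (b j : Poly3 k⟦X⟧)) := map_sum _ _ _
      rw [this]
      refine Submodule.sum_mem _ fun j _ => ?_
      rw [genericFiber_smul]
      exact Submodule.smul_mem _ _ (Submodule.subset_span ⟨j, rfl⟩)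
  refine ⟨(Module.Basis.span hli).map (LinearEquiv.ofEq _ _ hspan), fun j => ?_⟩
  rw [Module.Basis.map_apply, LinearEquiv.coe_ofEq_apply, Module.Basis.span_apply]

theorem specialSystem_le {d : ℕ} (hV : V ≤ homogeneousSubmodule (Fin 3) k⟦X⟧ d) :
    specialSystem V ≤ homogeneousSubmodule (Fin 3) k d := by
  rw [specialSystem, Submodule.span_le]
  rintro _ ⟨P, hP, rfl⟩
  exact IsHomogeneous.map (hV hP) _

theorem genericSystem_le {d : ℕ} (hV : V ≤ homogeneousSubmodule (Fin 3) k⟦X⟧ d) :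
    genericSystem V ≤ homogeneousSubmodule (Fin 3) k⸨X⸩ d := by
  rw [genericSystem, Submodule.span_le]
  rintro _ ⟨P, hP, rfl⟩
  exact IsHomogeneous.map (hV hP) _

end Systems

theorem IsNondegenerateOn.not_dvd_sum {k : Type*} [Field k] {V : Submodule k (Poly3 k)}
    {P G : Poly3 k}
    (h : IsNondegenerateOn V P) (hG : Irreducible G) (hGP : G ∣ P) {n : ℕ}
    (b : Module.Basis (Fin n) k V) {c : Fin n → k} (hc : c ≠ 0) :
    ¬ G ∣ ∑ j, C (c j) * (b j : Poly3 k) := by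
  have h1 : ((∑ j, c j • b j : V) : Poly3 k) = ∑ j, C (c j) * (b j : Poly3 k) := by
    simp [C_mul']
  rw [← h1]
  refine h G hG hGP _ (Subtype.mem _) fun h0 => hc ?_
  refine funext (sum_basis_eq_zero b ?_)
  simpa using h0

/-! ### Finiteness of ramification schemes -/

theorem not_dvd_of_squarefree_mul {R : Type*} [CommRing R] {G Q : R} (h : Squarefree (Q * G))
    (hG : ¬ IsUnit G) : ¬ G ∣ Q := by
  rintro ⟨u, rfl⟩
  exact hG (h G ⟨u, by ring⟩)

theorem isRelPrime_wronskian {k : Type*} [Field k] [IsAlgClosed k] [CharZero k] {P : Poly3 k}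
    {e d n : ℕ} (hP : Squarefree P) (hPh : P.IsHomogeneous e)
    {V : Submodule k (Poly3 k)} (hV : V ≤ homogeneousSubmodule (Fin 3) k d)
    (b : Module.Basis (Fin n) k V) (hnd : IsNondegenerateOn V P) {a : Fin 3 → k}
    (ha : ∀ G, Irreducible G → G ∣ P → ¬ G ∣ linearForm a) :
    IsRelPrime P (wronskian (jacobianDerivation P (linearForm a)) (fun j => (b j : Poly3 k))) := by
  refine WfDvdMonoid.isRelPrime_of_no_irreducible_factors (fun h => hP.ne_zero h.1) ?_
  intro G hG hGP
  obtain ⟨g, hg⟩ := exists_isHomogeneous_of_dvd hPh hP.ne_zero hGP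
  have hGP' := hGP
  obtain ⟨Q, rfl⟩ := hGP
  rw [mul_comm] at hP ⊢
  exact not_dvd_wronskian_mul hG hg (not_dvd_of_squarefree_mul hP hG.not_isUnit)
    (fun j => hV (b j).2) (fun c hc => hnd.not_dvd_sum hG hGP' b hc) (ha G hG hGP')

/-- The ramification scheme of a system that is nondegenerate on a square-free curve is finite. -/
theorem hasBinaryForms_ramificationIdeal {k : Type*} [Field k] [IsAlgClosed k] [CharZero k]
    {P : Poly3 k} {e d n : ℕ} (hP : Squarefree P) (hPh : P.IsHomogeneous e)
    {V : Submodule k (Poly3 k)} (hV : V ≤ homogeneousSubmodule (Fin 3) k d)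
    (b : Module.Basis (Fin n) k V) (hnd : IsNondegenerateOn V P) {a : Fin 3 → k}
    (ha : ∀ G, Irreducible G → G ∣ P → ¬ G ∣ linearForm a) :
    HasBinaryForms (ramificationIdeal P V) := by
  obtain ⟨w, hw⟩ := exists_wronskian_isHomogeneous hPh (v := fun j => (b j : Poly3 k))
    (fun j => hV (b j).2) a
  exact (hasBinaryForms_of_isRelPrime hPh hw hP.ne_zero
      (isRelPrime_wronskian hP hPh hV b hnd ha)).mono
    (span_le_ramificationIdeal hPh b hV a)

/-! ### The Wronskian of a degenerating family -/

/-- The relation governing the limit of the ramification scheme near a double component `G`: on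
`F = 0` the square of the Wronskian is `t^{nN} x / y`, with `N = r choose 2`, and `x` and `y` have
the given restrictions to `G = 0`. -/
theorem exists_wronskian_relation {k : Type*} [Field k] [CharZero k] {F : Poly3 k⟦X⟧}
    {B G : Poly3 k}
    (hF0 : atZero F = G ^ 2 * B) {n : ℕ} (h : IsOfType F B G n) (a : Fin 3 → k) {r : ℕ}
    (v : Fin r → Poly3 k⟦X⟧) :
    ∃ x y, F ∣ y * wronskian (jacobianDerivation F (linearForm fun i => PowerSeries.C (a i))) v ^ 2
        -
        C PowerSeries.X ^ (n * r.choose 2) * x ∧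
      atZero y = B ^ (r.choose 2) *
        (B ^ (n - 1) * discriminant F B G n * B ^ (2 * n - 2)) ^ (2 * r.choose 2) ∧
      G ∣ atZero x - (-(B ^ (n - 1) * discriminant F B G n)) ^ (r.choose 2) *
        ((2 * B ^ n * (B ^ (n - 1) * discriminant F B G n)) ^ (r.choose 2) *
          wronskian (jacobianDerivation G (linearForm a)) (fun j => atZero (v j))) ^ 2 := by
  obtain ⟨ψ, hψ, hψ0⟩ := exists_square_expansion hF0 h.1 h.2.1
  set L : Poly3 k⟦X⟧ := linearForm fun i => PowerSeries.C (a i)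
  have hL : atZero L = linearForm a := by
    rw [atZero, map_linearForm]
    simp only [PowerSeries.constantCoeff_C]
  have h1 := dvd_mul_wronskian_sq_sub hψ (fun i => pderiv_parameter_pow i n) L v
  rw [← pow_mul] at h1
  refine ⟨_, _, h1, ?_, ?_⟩
  · rw [atZero_mul, atZero_pow, atZero_pow, atZero_mul, atZero_pow, atZero_constFamily, hψ0]
  · have hφ0 : atZero (approxRoot F B G n) = G * B ^ (n - 1) := by
      have := h.1
      rw [atZero_eq_tCoeff, tCoeff_approxRoot, if_pos (by omega), rootCoeff, if_pos rfl,
          Nat.sub_zero]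
    have h1 : atZero (wronskian (degenerationDerivation (constFamily k B) (approxRoot F B G n) ψ L)
        v) =
        wronskian (degenerationDerivation (atZero (constFamily k B)) (atZero (approxRoot F B G n))
          (atZero ψ) (atZero L)) (fun j => atZero (v j)) :=
      map_wronskian_of_forall _ (fun g => map_degenerationDerivation _ _ _ _ _ _) v
    rw [atZero_constFamily, hφ0, hψ0, hL] at h1
    have h2 := wronskian_degenerationDerivation_sub_mem B G (B ^ (n - 1) * discriminant F B G n)
      (linearForm a) (p := n - 1) (fun j => atZero (v j))
    rw [Nat.sub_add_cancel h.1, Ideal.mem_span_singleton] at h2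
    have h3 : atZero (-ψ) = -(B ^ (n - 1) * discriminant F B G n) := by
      rw [← hψ0]; exact map_neg _ _
    rw [atZero_mul, atZero_pow, atZero_pow, h1, h3, ← mul_sub]
    refine Dvd.dvd.mul_left ?_ _
    rw [sq_sub_sq]
    exact Dvd.dvd.mul_left ((dvd_sub_comm).mp h2) _

/-! ### Degenerations -/

/-- The degenerations under consideration: the special member of the family `F` of forms of
degree `e` is `E²A`, with `E ~ ∏ G_j` and `A` square-free and coprime, and the family is of type
`n_j` along the double component `G_j`, where `E²A = G_j² B_j`. -/
structure IsDegeneration {k : Type*} [Field k] (F : Poly3 k⟦X⟧) (e : ℕ) (E A : Poly3 k) {m : ℕ}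
    (G B : Fin m → Poly3 k) (n : Fin m → ℕ) : Prop where
  isHomogeneous : F.IsHomogeneous e
  squarefree_left : Squarefree E
  squarefree_right : Squarefree A
  isRelPrime : IsRelPrime E A
  atZero_eq : atZero F = E ^ 2 * A
  irreducible : ∀ j, Irreducible (G j)
  associated : Associated (∏ j, G j) E
  sq_mul_eq : ∀ j, G j ^ 2 * B j = E ^ 2 * A
  isOfType : ∀ j, IsOfType F (B j) (G j) (n j)

theorem not_dvd_cofactor {k : Type*} [Field k] {E A G B : Poly3 k} (hE : Squarefree E)
    (hEA : IsRelPrime E A) (hG : Irreducible G) (hGE : G ∣ E) (h : G ^ 2 * B = E ^ 2 * A) :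
    ¬ G ∣ B := by
  obtain ⟨Q, rfl⟩ := hGE
  have h1 : ¬ G ∣ Q := not_dvd_of_squarefree_mul (by rwa [mul_comm]) hG.not_isUnit
  have h2 : ¬ G ∣ A := fun h => hG.not_isUnit (hEA (Dvd.intro _ rfl) h)
  have h3 : B = Q ^ 2 * A := mul_left_cancel₀ (pow_ne_zero 2 hG.ne_zero) (by rw [h]; ring)
  rw [h3]
  intro h4
  rcases hG.prime.dvd_or_dvd h4 with h5 | h5
  · exact h1 (hG.prime.dvd_of_dvd_pow h5)
  · exact h2 h5

namespace IsDegeneration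
variable {k : Type*} [Field k] {F : Poly3 k⟦X⟧} {e : ℕ} {E A : Poly3 k} {m : ℕ}
    {G B : Fin m → Poly3 k} {n : Fin m → ℕ} (h : IsDegeneration F e E A G B n)

include h

theorem atZero_ne_zero : atZero F ≠ 0 := by
  rw [h.atZero_eq]
  exact mul_ne_zero (pow_ne_zero _ h.squarefree_left.ne_zero) h.squarefree_right.ne_zero

theorem ne_zero : F ≠ 0 := by
  rintro rfl; exact h.atZero_ne_zero (map_zero _)

theorem atZero_eq_mul (j : Fin m) : atZero F = G j ^ 2 * B j := by
  rw [h.sq_mul_eq, h.atZero_eq]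

theorem dvd_left (j : Fin m) : G j ∣ E :=
  (Finset.dvd_prod_of_mem G (Finset.mem_univ j)).trans h.associated.dvd

theorem not_dvd_cofactor (j : Fin m) : ¬ G j ∣ B j :=
  Zeuthen.not_dvd_cofactor h.squarefree_left h.isRelPrime (h.irreducible j) (h.dvd_left j)
    (h.sq_mul_eq j)

theorem atZero_isHomogeneous : (atZero F).IsHomogeneous e := h.isHomogeneous.map _

theorem exists_isHomogeneous_right : ∃ a, A.IsHomogeneous a :=
  exists_isHomogeneous_of_dvd h.atZero_isHomogeneous h.atZero_ne_zero
    (h.atZero_eq ▸ Dvd.intro_left _ rfl)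

theorem exists_isHomogeneous_left : ∃ a, E.IsHomogeneous a :=
  exists_isHomogeneous_of_dvd h.atZero_isHomogeneous h.atZero_ne_zero
    (h.atZero_eq ▸ Dvd.dvd.mul_right (dvd_pow_self _ two_ne_zero) _)

theorem dvd_atZero (j : Fin m) : G j ∣ atZero F :=
  h.atZero_eq_mul j ▸ Dvd.dvd.mul_right (dvd_pow_self _ two_ne_zero) _

theorem exists_isHomogeneous_component (j : Fin m) : ∃ a, (G j).IsHomogeneous a :=
  exists_isHomogeneous_of_dvd h.atZero_isHomogeneous h.atZero_ne_zero (h.dvd_atZero j)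

theorem exists_isHomogeneous_cofactor (j : Fin m) : ∃ a, (B j).IsHomogeneous a :=
  exists_isHomogeneous_of_dvd h.atZero_isHomogeneous h.atZero_ne_zero
    (h.atZero_eq_mul j ▸ Dvd.intro_left _ rfl)

theorem exists_isHomogeneous_discriminant (j : Fin m) (i : ℕ) :
    ∃ a, (discriminant F (B j) (G j) i).IsHomogeneous a := by
  obtain ⟨g, hg⟩ := h.exists_isHomogeneous_component j
  obtain ⟨b, hb⟩ := h.exists_isHomogeneous_cofactor j
  have h1 : e = 2 * g + b := by
    have h2 := (hg.pow 2).mul hb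
    rw [← h.atZero_eq_mul j] at h2
    rw [← h2.inj_right h.atZero_isHomogeneous h.atZero_ne_zero]
    ring
  exact ⟨_, discriminant_isHomogeneous (h1 ▸ h.isHomogeneous) hb hg (h.irreducible j).ne_zero i⟩

theorem dvd_right_or_associated {P : Poly3 k} (hP : Irreducible P) (hPF : P ∣ atZero F) :
    P ∣ A ∨ ∃ j, Associated P (G j) := by
  rw [h.atZero_eq] at hPF
  rcases hP.prime.dvd_or_dvd hPF with h1 | h1
  · right
    have h2 := (hP.prime.dvd_of_dvd_pow h1).trans h.associated.symm.dvd
    obtain ⟨j, -, hj⟩ := hP.prime.exists_mem_finset_dvd h2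
    exact ⟨j, hP.associated_of_dvd (h.irreducible j) hj⟩
  · exact Or.inl h1

section Wronskian
variable [IsAlgClosed k] [CharZero k] {d r : ℕ} {V : Submodule k⟦X⟧ (Poly3 k⟦X⟧)}
    (hV : V ≤ homogeneousSubmodule (Fin 3) k⟦X⟧ d)
        (hnd : IsNondegenerateOn (specialSystem V) (E ^ 2 * A))
    (b : Module.Basis (Fin r) k⟦X⟧ V) (b0 : Module.Basis (Fin r) k (specialSystem V))
    (hb0 : ∀ j, (b0 j : Poly3 k) = atZero (b j : Poly3 k⟦X⟧))
    {a : Fin 3 → k} (ha : ∀ P, Irreducible P → P ∣ atZero F → ¬ P ∣ linearForm a)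

include hV hnd ha in
theorem not_dvd_wronskian_component (j : Fin m) :
    ¬ G j ∣ wronskian (jacobianDerivation (G j) (linearForm a)) (fun i => (b0 i : Poly3 k)) := by
  obtain ⟨g, hg⟩ := h.exists_isHomogeneous_component j
  exact not_dvd_wronskian (h.irreducible j) hg (fun i => specialSystem_le hV (b0 i).2)
    (fun c hc => hnd.not_dvd_sum (h.irreducible j) (h.atZero_eq ▸ h.dvd_atZero j) b0 hc)
    (ha _ (h.irreducible j) (h.dvd_atZero j))

omit h [IsAlgClosed k] [CharZero k] in
theorem nondegenerate_right (hnd : IsNondegenerateOn (specialSystem V) (E ^ 2 * A)) :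
    IsNondegenerateOn (specialSystem V) A :=
  fun P hP hPA => hnd P hP (Dvd.dvd.mul_left hPA _)

include hV hnd ha in
theorem isRelPrime_wronskian_right :
    IsRelPrime A (wronskian (jacobianDerivation A (linearForm a)) (fun i => (b0 i : Poly3 k))) := by
  obtain ⟨g, hg⟩ := h.exists_isHomogeneous_right
  exact isRelPrime_wronskian h.squarefree_right hg (specialSystem_le hV) b0
    (nondegenerate_right hnd) fun P hP hPA =>
      ha P hP (h.atZero_eq ▸ Dvd.dvd.mul_left hPA _)

omit [IsAlgClosed k] [CharZero k] in
theorem not_dvd_discriminant_factor (j : Fin m) :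
    ¬ G j ∣ (B j) ^ (n j - 1) * discriminant F (B j) (G j) (n j) := fun hd => by
  rcases (h.irreducible j).prime.dvd_or_dvd hd with h1 | h1
  · exact h.not_dvd_cofactor j ((h.irreducible j).prime.dvd_of_dvd_pow h1)
  · exact (h.isOfType j).2.2 h1

include hV hnd ha in
/-- The leading term in `exists_wronskian_relation` does not vanish identically on `G j = 0`. -/
theorem not_dvd_leadingTerm (j : Fin m) :
    ¬ G j ∣ (-((B j) ^ (n j - 1) * discriminant F (B j) (G j) (n j))) ^ (r.choose 2) *
        ((2 * (B j) ^ (n j) * ((B j) ^ (n j - 1) * discriminant F (B j) (G j) (n j))) ^ (r.choose 2)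
            *
          wronskian (jacobianDerivation (G j) (linearForm a)) (fun i => (b0 i : Poly3 k))) ^ 2 := by
  have hp := (h.irreducible j).prime
  intro hd
  rcases hp.dvd_or_dvd hd with h1 | h1
  · exact h.not_dvd_discriminant_factor j ((dvd_neg).mp (hp.dvd_of_dvd_pow h1))
  · rcases hp.dvd_or_dvd (hp.dvd_of_dvd_pow h1) with h2 | h2
    · rcases hp.dvd_or_dvd (hp.dvd_of_dvd_pow h2) with h3 | h3
      · rcases hp.dvd_or_dvd h3 with h4 | h4
        · refine hp.not_isUnit (isUnit_of_dvd_unit h4 ?_)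
          rw [← map_ofNat C 2]
          exact (isUnit_iff_ne_zero.mpr two_ne_zero).map C
        · exact h.not_dvd_cofactor j (hp.dvd_of_dvd_pow h4)
      · exact h.not_dvd_discriminant_factor j h3
    · exact h.not_dvd_wronskian_component hV hnd b0 ha j h2

omit [IsAlgClosed k] [CharZero k] in
include hb0 in
theorem atZero_wronskian (L : Fin 3 → k) :
    atZero (wronskian (jacobianDerivation F (linearForm fun i => PowerSeries.C (L i)))
      (fun i => (b i : Poly3 k⟦X⟧))) =
    wronskian (jacobianDerivation (E ^ 2 * A) (linearForm L)) (fun i => (b0 i : Poly3 k)) := by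
  rw [atZero, map_wronskian, map_linearForm, ← h.atZero_eq]
  simp only [PowerSeries.constantCoeff_C, hb0]
  rfl

omit [IsAlgClosed k] in
include hb0 in
theorem exists_relation (L : Fin 3 → k) (j : Fin m) :
    ∃ x y, F ∣ y * wronskian (jacobianDerivation F (linearForm fun i => PowerSeries.C (L i)))
        (fun i => (b i : Poly3 k⟦X⟧)) ^ 2 - C PowerSeries.X ^ (n j * r.choose 2) * x ∧
      atZero y = B j ^ (r.choose 2) *
        (B j ^ (n j - 1) * discriminant F (B j) (G j) (n j) * B j ^ (2 * n j - 2)) ^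
            (2 * r.choose 2) ∧
      G j ∣ atZero x - (-((B j) ^ (n j - 1) * discriminant F (B j) (G j) (n j))) ^ (r.choose 2) *
        ((2 * (B j) ^ (n j) * ((B j) ^ (n j - 1) * discriminant F (B j) (G j) (n j))) ^ (r.choose 2)
            *
          wronskian (jacobianDerivation (G j) (linearForm L)) (fun i => (b0 i : Poly3 k))) ^ 2 := by
  have := exists_wronskian_relation (h.atZero_eq_mul j) (h.isOfType j) L
    (fun i => (b i : Poly3 k⟦X⟧))
  simpa only [hb0] using this

include hV hnd hb0 ha in
/-- The generic ramification scheme is finite: a common component of `F` and of its Wronskian would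
specialize to a component of the special curve, which is excluded by the relations above. -/
theorem isRelPrime_family :
    IsRelPrime F (wronskian (jacobianDerivation F (linearForm fun i => PowerSeries.C (a i)))
      (fun i => (b i : Poly3 k⟦X⟧))) := by
  refine WfDvdMonoid.isRelPrime_of_no_irreducible_factors (fun h1 => h.ne_zero h1.1) ?_
  intro P hP hPF hPw
  have hP0 := atZero_ne_zero_of_dvd h.atZero_ne_zero hPF
  obtain ⟨p, hp⟩ := exists_isHomogeneous_of_dvd h.isHomogeneous h.ne_zero hPF
  have hp0 := pos_degree_of_atZero_mem hp hP0 hP.not_isUnit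
  have hdvd : ∀ {x y : Poly3 k⟦X⟧}, x ∣ y → atZero x ∣ atZero y := fun hxy => map_dvd _ hxy
  have hPu : ¬ IsUnit (atZero P) := by
    intro hu
    have h1 : (atZero P).IsHomogeneous p := hp.map _
    exact not_dvd_of_isHomogeneous_lt h1 (isHomogeneous_one _ _) hp0 one_ne_zero hu.dvd
  obtain ⟨Q, hQ, hQP⟩ := WfDvdMonoid.exists_irreducible_factor hPu hP0
  have hQF := hQP.trans (hdvd hPF)
  rcases h.dvd_right_or_associated hQ hQF with hQA | ⟨j, hj⟩
  · have h1 := hQP.trans (hdvd hPw)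
    rw [h.atZero_wronskian b b0 hb0 a] at h1
    obtain ⟨g, hg⟩ := exists_isHomogeneous_of_dvd h.atZero_isHomogeneous h.atZero_ne_zero hQF
    have hndQ := fun (c : Fin r → k) hc => hnd.not_dvd_sum hQ (h.atZero_eq ▸ hQF) b0 (c := c) hc
    obtain ⟨A', hA'⟩ := hQA
    have h2 : E ^ 2 * A = (E ^ 2 * A') * Q := by rw [hA']; ring
    rw [h2] at h1
    refine not_dvd_wronskian_mul hQ hg ?_ (fun i => specialSystem_le hV (b0 i).2) hndQ
      (ha Q hQ hQF) h1
    intro h3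
    rcases hQ.prime.dvd_or_dvd h3 with h4 | h4
    · exact hQ.not_isUnit (h.isRelPrime (hQ.prime.dvd_of_dvd_pow h4) (hA' ▸ Dvd.intro _ rfl))
    · refine not_dvd_of_squarefree_mul ?_ hQ.not_isUnit h4
      rw [mul_comm, ← hA']; exact h.squarefree_right
  · obtain ⟨x, y, h1, -, h2⟩ := h.exists_relation b b0 hb0 a j
    have h3 : P ∣ C PowerSeries.X ^ (n j * r.choose 2) * x :=
      (dvd_sub_right (Dvd.dvd.mul_left (dvd_pow hPw two_ne_zero) _)).mp (hPF.trans h1)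
    rcases hP.prime.dvd_or_dvd h3 with h4 | h4
    · rw [← C_pow] at h4
      exact not_dvd_of_isHomogeneous_lt hp (isHomogeneous_C _ _) hp0
        (C_ne_zero.mpr (pow_ne_zero _ PowerSeries.X_ne_zero)) h4
    · have h5 := hj.symm.dvd.trans (hQP.trans (hdvd h4))
      exact h.not_dvd_leadingTerm hV hnd b0 ha j ((dvd_sub_right h5).mp h2)

end Wronskian

end IsDegeneration

/-! ### Limits of subschemes -/

section Limit
variable {k : Type*} [Field k]

theorem atZero_mem_limitIdeal {I : Ideal (Poly3 k⸨X⸩)} {f : Poly3 k⟦X⟧} (hf : genericFiber f ∈ I) :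
    atZero f ∈ limitIdeal I :=
  Ideal.mem_map_of_mem _ (Ideal.mem_comap.mpr hf)

theorem mem_limitIdeal_iff {I : Ideal (Poly3 k⸨X⸩)} {g : Poly3 k} :
    g ∈ limitIdeal I ↔ ∃ f, genericFiber f ∈ I ∧ atZero f = g := by
  rw [limitIdeal, Ideal.mem_map_iff_of_surjective _
    (map_surjective _ PowerSeries.constantCoeff_surj)]
  rfl

theorem genericFiber_mul (P Q : Poly3 k⟦X⟧) :
    genericFiber (P * Q) = genericFiber P * genericFiber Q := map_mul _ _ _

theorem genericFiber_add (P Q : Poly3 k⟦X⟧) :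
    genericFiber (P + Q) = genericFiber P + genericFiber Q := map_add _ _ _

theorem isUnit_genericFiber_parameter_pow (c : ℕ) :
    IsUnit (genericFiber (C PowerSeries.X ^ c : Poly3 k⟦X⟧)) := by
  rw [← C_pow, genericFiber, map_C]
  exact (isUnit_iff_ne_zero.mpr ((map_ne_zero_iff _ (IsFractionRing.injective k⟦X⟧ k⸨X⸩)).mpr
    (pow_ne_zero _ PowerSeries.X_ne_zero))).map C

theorem exists_parameter_pow_mul_eq (x : Poly3 k⸨X⸩) :
    ∃ (c : ℕ) (x' : Poly3 k⟦X⟧), genericFiber x' = genericFiber (C PowerSeries.X ^ c) * x := by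
  induction x using MvPolynomial.induction_on with
  | C r =>
    obtain ⟨⟨y, ⟨_, c, rfl⟩⟩, hy⟩ := IsLocalization.surj
      (Submonoid.powers (PowerSeries.X : k⟦X⟧)) r
    refine ⟨c, C y, ?_⟩
    rw [← C_pow, genericFiber, genericFiber, map_C, map_C, ← hy, ← C_mul, mul_comm]
  | add p q hp hq =>
    obtain ⟨c, p', hp⟩ := hp
    obtain ⟨c', q', hq⟩ := hq
    refine ⟨c + c', C PowerSeries.X ^ c' * p' + C PowerSeries.X ^ c * q', ?_⟩
    rw [genericFiber_add, genericFiber_mul, genericFiber_mul, hp, hq, pow_add, genericFiber_mul]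
    ring
  | mul_X p i hp =>
    obtain ⟨c, p', hp⟩ := hp
    refine ⟨c, p' * X i, ?_⟩
    rw [genericFiber_mul, hp, mul_assoc]
    congr 2
    exact map_X _ i

/-- The closure of the generic fiber of a scheme is given by saturation with respect to `t`. -/
theorem genericFiber_mem_span_pair_iff {F w f : Poly3 k⟦X⟧} :
    genericFiber f ∈ Ideal.span {genericFiber F, genericFiber w} ↔
      ∃ c : ℕ, C PowerSeries.X ^ c * f ∈ Ideal.span {F, w} := by
  constructor
  · intro h
    obtain ⟨x, y, hxy⟩ := Ideal.mem_span_pair.mp h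
    obtain ⟨c, x', hx⟩ := exists_parameter_pow_mul_eq x
    obtain ⟨c', y', hy⟩ := exists_parameter_pow_mul_eq y
    refine ⟨c + c', Ideal.mem_span_pair.mpr
      ⟨C PowerSeries.X ^ c' * x', C PowerSeries.X ^ c * y', genericFiber_injective ?_⟩⟩
    rw [genericFiber_add, genericFiber_mul, genericFiber_mul, genericFiber_mul, genericFiber_mul,
      genericFiber_mul, hx, hy, pow_add, genericFiber_mul, ← hxy]
    ring
  · rintro ⟨c, hc⟩
    obtain ⟨x, y, hxy⟩ := Ideal.mem_span_pair.mp hc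
    obtain ⟨u, hu⟩ := (isUnit_genericFiber_parameter_pow (k := k) c).exists_left_inv
    have h1 := congrArg genericFiber hxy
    rw [genericFiber_add, genericFiber_mul, genericFiber_mul, genericFiber_mul] at h1
    refine Ideal.mem_span_pair.mpr ⟨u * genericFiber x, u * genericFiber y, ?_⟩
    linear_combination u * h1 + genericFiber f * hu

end Limit

/-! ### Points and cycles -/

section Points
variable {k : Type*} [Field k]

theorem aeval_C_eq_C_eval (x : Fin 3 → k) (P : Poly3 k) :
    aeval (fun i => Polynomial.C (x i)) P = Polynomial.C (eval x P) := by
  induction P using MvPolynomial.induction_on with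
  | C r => simp
  | add q r hq hr => simp only [map_add, hq, hr]
  | mul_X q i hq => simp only [map_mul, hq, aeval_X, eval_X]

theorem mem_pointIdeal_iff_of_isHomogeneous {p : ℙ k (Fin 3 → k)} {P : Poly3 k} {n : ℕ}
    (hP : P.IsHomogeneous n) : P ∈ pointIdeal p ↔ eval p.rep P = 0 := by
  rw [pointIdeal, RingHom.mem_ker]
  have h1 : (fun i : Fin 3 => Polynomial.C (p.rep i) * (Polynomial.X : Polynomial k)) =
      fun i => Polynomial.X * Polynomial.C (p.rep i) := funext fun i => mul_comm _ _
  change aeval _ P = 0 ↔ _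
  rw [h1, IsHomogeneous_aeval_mul hP, aeval_C_eq_C_eval, mul_eq_zero,
    or_iff_right (pow_ne_zero _ Polynomial.X_ne_zero), Polynomial.C_eq_zero]

theorem rep_injective {p q : ℙ k (Fin 3 → k)} {i : Fin 3} (hp : p.rep i ≠ 0) (hq : q.rep i ≠ 0)
    (h : ∀ l, p.rep l / p.rep i = q.rep l / q.rep i) : p = q := by
  rw [← p.mk_rep, ← q.mk_rep, Projectivization.mk_eq_mk_iff']
  refine ⟨p.rep i / q.rep i, ?_⟩
  funext l
  have := h l
  rw [Pi.smul_apply, smul_eq_mul]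
  field_simp at this ⊢
  linear_combination -this

/-- Two binary forms leave finitely many values for the ratios of the coordinates of a point. -/
theorem HasBinaryForms.finite_points [Infinite k] {J : Ideal (Poly3 k)} (h : HasBinaryForms J) :
    {p : ℙ k (Fin 3 → k) | J ≤ pointIdeal p}.Finite := by
  have hcover : {p : ℙ k (Fin 3 → k) | J ≤ pointIdeal p} ⊆
      ⋃ i : Fin 3, {p | J ≤ pointIdeal p ∧ p.rep i ≠ 0} := by
    intro p hp
    obtain ⟨i, hi⟩ : ∃ i, p.rep i ≠ 0 := by
      by_contra! h
      exact p.rep_nonzero (funext h)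
    exact Set.mem_iUnion.mpr ⟨i, hp, hi⟩
  refine (Set.finite_iUnion fun i => ?_).subset hcover
  have hroots : ∀ l, ∃ q : Polynomial k, q ≠ 0 ∧ ∀ p : ℙ k (Fin 3 → k), J ≤ pointIdeal p →
      p.rep i ≠ 0 → q.IsRoot (p.rep l / p.rep i) := by
    intro l
    by_cases hl : l = i
    · refine ⟨Polynomial.X - Polynomial.C 1, Polynomial.X_sub_C_ne_zero 1, fun p _ hpi => ?_⟩
      simp [hl, hpi]
    · obtain ⟨g, N, h0, h1, h2⟩ := h i l (Ne.symm hl)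
      refine ⟨_, aeval_binaryForm_ne_zero h0 h1 one_ne_zero, fun p hp hpi => ?_⟩
      have h3 := (mem_pointIdeal_iff_of_isHomogeneous
        (h1.rename_isHomogeneous (f := ![i, l]))).mp (hp h2)
      rw [Polynomial.IsRoot, ← Polynomial.coe_aeval_eq_eval, ← AlgHom.comp_apply, comp_aeval]
      have h4 : (fun j => (Polynomial.aeval (p.rep l / p.rep i))
          ((![Polynomial.C (1 : k), Polynomial.X] : Fin 2 → Polynomial k) j)) =
          fun j => (1 / p.rep i) * (p.rep ∘ ![i, l]) j := by
        funext j
        fin_cases j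
        · simp [hpi]
        · simp; ring
      rw [h4, IsHomogeneous_aeval_mul h1]
      rw [eval_rename] at h3
      rw [← coe_aeval_eq_eval] at h3
      exact mul_eq_zero_of_right _ h3
  choose q hq0 hq using hroots
  refine Set.Finite.of_finite_image (f := fun p : ℙ k (Fin 3 → k) => fun l => p.rep l / p.rep i) ?_
      ?_
  · refine (Set.Finite.pi fun l => Polynomial.finite_setOfPred_isRoot (hq0 l)).subset ?_
    rintro _ ⟨p, ⟨hp, hpi⟩, rfl⟩
    exact fun l _ => hq l p hp hpi
  · rintro p ⟨-, hp⟩ p' ⟨-, hp'⟩ hpp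
    exact rep_injective hp hp' (congrFun hpp)

theorem pointMultiplicity_eq_zero {J : Ideal (Poly3 k)} {p : ℙ k (Fin 3 → k)}
    (h : ¬ J ≤ pointIdeal p) : pointMultiplicity J p = 0 := by
  obtain ⟨x, hx, hxp⟩ := Set.not_subset.mp h
  have h1 : J.map (algebraMap (Poly3 k) (Localization.AtPrime (pointIdeal p))) = ⊤ :=
    Ideal.eq_top_of_isUnit_mem _ (Ideal.mem_map_of_mem _ hx)
      (IsLocalization.map_units _ (⟨x, hxp⟩ : (pointIdeal p).primeCompl))
  rw [pointMultiplicity, h1, Module.length_eq_zero_iff]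
  exact Ideal.Quotient.subsingleton_iff.mpr rfl

theorem cycle_apply [Infinite k] {J : Ideal (Poly3 k)} (h : HasBinaryForms J) (p : ℙ k (Fin 3 → k))
    :
    cycle J p = ((pointMultiplicity J p).toNat : ℤ) := by
  have hfin : (Function.support fun p => ((pointMultiplicity J p).toNat : ℤ)).Finite := by
    refine h.finite_points.subset fun p hp => ?_
    by_contra hJ
    exact hp (by simp [pointMultiplicity_eq_zero hJ])
  rw [cycle, dif_pos hfin]
  rfl

/-- A line through a point off the curve `P = 0` is not a component of that curve. -/
theorem not_dvd_linearForm {P F : Poly3 k} {e : ℕ} (hP : Irreducible P) (hPF : P ∣ F)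
    (hF : F.IsHomogeneous e) (hF0 : F ≠ 0) {x a : Fin 3 → k} (hx : eval x F ≠ 0) (ha : a ≠ 0)
    (hax : eval x (linearForm a) = 0) : ¬ P ∣ linearForm a := by
  rintro ⟨u, hu⟩
  have hL0 : linearForm a ≠ 0 := by
    intro h
    apply ha
    funext i
    have := congrArg (pderiv i) h
    rw [pderiv_linearForm, map_zero, C_eq_zero] at this
    exact this
  obtain ⟨g, hg⟩ := exists_isHomogeneous_of_dvd hF hF0 hPF
  have hg0 := pos_degree_of_irreducible hP hg
  obtain ⟨b, hb⟩ := exists_isHomogeneous_of_dvd (linearForm_isHomogeneous a) hL0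
    (Dvd.intro_left _ hu.symm)
  have h1 := hg.mul hb
  rw [← hu] at h1
  have h2 := h1.inj_right (linearForm_isHomogeneous a) hL0
  have hb0 : b = 0 := by omega
  subst hb0
  have h3 := totalDegree_eq_zero_iff_eq_C.mp (Nat.le_zero.mp hb.totalDegree_le)
  have hPx : eval x P ≠ 0 := by
    obtain ⟨y, rfl⟩ := hPF
    intro h
    exact hx (by rw [map_mul, h, zero_mul])
  rw [hu, map_mul] at hax
  have h4 := (mul_eq_zero.mp hax).resolve_left hPx
  rw [h3, eval_C] at h4
  exact hL0 (by rw [hu, h3, h4, map_zero, mul_zero])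

end Points

namespace IsDegeneration
variable {k : Type*} [Field k] {F : Poly3 k⟦X⟧} {e : ℕ} {E A : Poly3 k} {m : ℕ}
    {G B : Fin m → Poly3 k} {n : Fin m → ℕ} (h : IsDegeneration F e E A G B n)
    [IsAlgClosed k] [CharZero k] {d r : ℕ} {V : Submodule k⟦X⟧ (Poly3 k⟦X⟧)}
    (hV : V ≤ homogeneousSubmodule (Fin 3) k⟦X⟧ d)
        (hnd : IsNondegenerateOn (specialSystem V) (E ^ 2 * A))
    (b : Module.Basis (Fin r) k⟦X⟧ V) (b0 : Module.Basis (Fin r) k (specialSystem V))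
    (hb0 : ∀ j, (b0 j : Poly3 k) = atZero (b j : Poly3 k⟦X⟧))
    {a : Fin 3 → k} (ha : ∀ P, Irreducible P → P ∣ atZero F → ¬ P ∣ linearForm a)

omit [IsAlgClosed k] [CharZero k] in
theorem genericFiber_wronskian (F : Poly3 k⟦X⟧) (L : Fin 3 → k) (v : Fin r → Poly3 k⟦X⟧) :
    genericFiber (wronskian (jacobianDerivation F (linearForm fun i => PowerSeries.C (L i))) v) =
      wronskian (jacobianDerivation (genericFiber F)
        (linearForm fun i => algebraMap k⟦X⟧ k⸨X⸩ (PowerSeries.C (L i))))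
        (fun j => genericFiber (v j)) := by
  rw [genericFiber, map_wronskian, map_linearForm]
  rfl

include h hV in
omit [IsAlgClosed k] [CharZero k] in
/-- Away from the line `L = 0` the closure of the generic ramification scheme is the saturation,
with respect to `t`, of the ideal of `F` and of the Wronskian of `L`. -/
theorem genericFiber_mem_ramificationIdeal_iff (L : Fin 3 → k) (f : Poly3 k⟦X⟧) :
    (genericFiber f ∈ ramificationIdeal (genericFiber F) (genericSystem V) →
      ∃ c c' : ℕ, C PowerSeries.X ^ c * (linearForm (fun i => PowerSeries.C (L i)) ^ c' * f) ∈
        Ideal.span {F, wronskian (jacobianDerivation F (linearForm fun i => PowerSeries.C (L i)))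
          (fun i => (b i : Poly3 k⟦X⟧))}) ∧
    ((∃ c : ℕ, C PowerSeries.X ^ c * f ∈
        Ideal.span {F, wronskian (jacobianDerivation F (linearForm fun i => PowerSeries.C (L i)))
          (fun i => (b i : Poly3 k⟦X⟧))}) →
      genericFiber f ∈ ramificationIdeal (genericFiber F) (genericSystem V)) := by
  obtain ⟨b1, hb1⟩ := exists_basis_genericSystem b
  have hw := genericFiber_wronskian F L (fun i => (b i : Poly3 k⟦X⟧))
  have hFh : (genericFiber F).IsHomogeneous e := h.isHomogeneous.map _
  constructor
  · intro hf
    obtain ⟨c', hc'⟩ := exists_pow_mul_mem_span hFh b1 (genericSystem_le hV)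
      (fun i => algebraMap k⟦X⟧ k⸨X⸩ (PowerSeries.C (L i))) hf
    simp only [hb1] at hc'
    rw [← hw] at hc'
    have hL : genericFiber (linearForm (fun i => PowerSeries.C (L i)) ^ c' * f) =
        linearForm (fun i => algebraMap k⟦X⟧ k⸨X⸩ (PowerSeries.C (L i))) ^ c' * genericFiber f := by
      rw [genericFiber_mul]
      congr 1
      rw [genericFiber, map_pow, map_linearForm]
    rw [← hL, genericFiber_mem_span_pair_iff] at hc'
    obtain ⟨c, hc⟩ := hc'
    exact ⟨c, c', hc⟩
  · intro hf
    rw [← genericFiber_mem_span_pair_iff, hw] at hf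
    simp only [← hb1] at hf
    exact span_le_ramificationIdeal hFh b1 (genericSystem_le hV) _ hf

include h hV hnd b b0 hb0 ha in
theorem hasBinaryForms_generic :
    HasBinaryForms (ramificationIdeal (genericFiber F) (genericSystem V)) := by
  obtain ⟨b1, hb1⟩ := exists_basis_genericSystem b
  have hFh : (genericFiber F).IsHomogeneous e := h.isHomogeneous.map _
  obtain ⟨w, hw⟩ := exists_wronskian_isHomogeneous h.isHomogeneous
    (v := fun j => (b j : Poly3 k⟦X⟧)) (fun j => hV (b j).2) (fun i => PowerSeries.C (a i))
  have h1 := hasBinaryForms_of_isRelPrime h.isHomogeneous hw h.ne_zero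
    (h.isRelPrime_family hV hnd b b0 hb0 ha)
  refine (h1.map (IsFractionRing.injective k⟦X⟧ k⸨X⸩)).mono ?_
  rw [Ideal.map_span, Ideal.span_le]
  rintro _ ⟨x, hx, rfl⟩
  refine (h.genericFiber_mem_ramificationIdeal_iff hV b a x).2 ⟨0, ?_⟩
  rw [pow_zero, one_mul]
  exact Ideal.subset_span hx

include h hV hnd b0 ha in
theorem hasBinaryForms_component (j : Fin m) :
    HasBinaryForms (ramificationIdeal (G j) (specialSystem V)) := by
  obtain ⟨g, hg⟩ := h.exists_isHomogeneous_component j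
  have hdvd : ∀ P, P ∣ G j → P ∣ atZero F := fun P hP => hP.trans (h.dvd_atZero j)
  exact hasBinaryForms_ramificationIdeal (h.irreducible j).squarefree hg (specialSystem_le hV) b0
    (fun P hP hPG => hnd P hP (h.atZero_eq ▸ hdvd P hPG)) (fun P hP hPG => ha P hP (hdvd P hPG))

include h hV hnd b0 ha in
theorem hasBinaryForms_right : HasBinaryForms (ramificationIdeal A (specialSystem V)) := by
  obtain ⟨g, hg⟩ := h.exists_isHomogeneous_right
  have hdvd : ∀ P, P ∣ A → P ∣ atZero F := fun P hP => h.atZero_eq ▸ Dvd.dvd.mul_left hP _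
  exact hasBinaryForms_ramificationIdeal h.squarefree_right hg (specialSystem_le hV) b0
    (nondegenerate_right hnd) (fun P hP hPG => ha P hP (hdvd P hPG))

include h in
omit [IsAlgClosed k] [CharZero k] in
theorem hasBinaryForms_left_right : HasBinaryForms (intersectionIdeal (E ^ 2) A) := by
  obtain ⟨g, hg⟩ := h.exists_isHomogeneous_right
  obtain ⟨g', hg'⟩ := h.exists_isHomogeneous_left
  exact hasBinaryForms_of_isRelPrime (hg'.pow 2) hg (pow_ne_zero _ h.squarefree_left.ne_zero)
    h.isRelPrime.pow_left

include h in
omit [IsAlgClosed k] [CharZero k] in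
theorem hasBinaryForms_discriminant (j : Fin m) :
    HasBinaryForms (intersectionIdeal (discriminant F (B j) (G j) (n j)) (G j)) := by
  obtain ⟨g, hg⟩ := h.exists_isHomogeneous_component j
  obtain ⟨g', hg'⟩ := h.exists_isHomogeneous_discriminant j (n j)
  rw [intersectionIdeal, Set.pair_comm]
  exact hasBinaryForms_of_prime hg hg' (h.irreducible j).prime (h.isOfType j).2.2

include h in
omit [IsAlgClosed k] [CharZero k] in
theorem hasBinaryForms_cofactor (j : Fin m) : HasBinaryForms (intersectionIdeal (B j) (G j)) := by
  obtain ⟨g, hg⟩ := h.exists_isHomogeneous_component j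
  obtain ⟨g', hg'⟩ := h.exists_isHomogeneous_cofactor j
  rw [intersectionIdeal, Set.pair_comm]
  exact hasBinaryForms_of_prime hg hg' (h.irreducible j).prime (h.not_dvd_cofactor j)

include h hV hnd b b0 hb0 ha in
theorem hasBinaryForms_limit :
    HasBinaryForms (limitIdeal (ramificationIdeal (genericFiber F) (genericSystem V))) := by
  set I := limitIdeal (ramificationIdeal (genericFiber F) (genericSystem V))
  have hlim : ∀ f, (∃ c : ℕ, C PowerSeries.X ^ c * f ∈
        Ideal.span {F, wronskian (jacobianDerivation F (linearForm fun i => PowerSeries.C (a i)))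
          (fun i => (b i : Poly3 k⟦X⟧))}) → atZero f ∈ I := fun f hf =>
    atZero_mem_limitIdeal ((h.genericFiber_mem_ramificationIdeal_iff hV b a f).2 hf)
  have hF : atZero F ∈ I := hlim F ⟨0, Ideal.mul_mem_left _ _ (Ideal.subset_span (by simp))⟩
  have hw := hlim _ ⟨0, Ideal.mul_mem_left _ _ (Ideal.subset_span (Or.inr rfl))⟩
  rw [h.atZero_wronskian b b0 hb0] at hw
  have hGj : ∀ j, HasBinaryForms (I ⊔ Ideal.span {G j}) := by
    intro j
    obtain ⟨x, y, h1, -, h2⟩ := h.exists_relation b b0 hb0 a j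
    have hx : atZero x ∈ I := by
      refine hlim x ⟨n j * r.choose 2, ?_⟩
      obtain ⟨s, hs⟩ := h1
      refine Ideal.mem_span_pair.mpr ⟨-s, y * wronskian (jacobianDerivation F
        (linearForm fun i => PowerSeries.C (a i))) (fun i => (b i : Poly3 k⟦X⟧)), ?_⟩
      linear_combination hs
    set z := (-((B j) ^ (n j - 1) * discriminant F (B j) (G j) (n j))) ^ (r.choose 2) *
        ((2 * (B j) ^ (n j) * ((B j) ^ (n j - 1) * discriminant F (B j) (G j) (n j))) ^ (r.choose 2)
            *
          wronskian (jacobianDerivation (G j) (linearForm a)) (fun i => (b0 i : Poly3 k))) ^ 2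
      with hz
    have hzI : z ∈ I ⊔ Ideal.span {G j} := by
      have h3 : atZero x - z ∈ I ⊔ Ideal.span {G j} :=
        Ideal.mem_sup_right (Ideal.mem_span_singleton.mpr h2)
      have h4 := Ideal.sub_mem _ (Ideal.mem_sup_left hx) h3
      rwa [sub_sub_cancel] at h4
    obtain ⟨g, hg⟩ := h.exists_isHomogeneous_component j
    obtain ⟨g', hg'⟩ := h.exists_isHomogeneous_discriminant j (n j)
    obtain ⟨g'', hg''⟩ := h.exists_isHomogeneous_cofactor j
    obtain ⟨w', hw'⟩ := exists_wronskian_isHomogeneous hg (v := fun j => (b0 j : Poly3 k))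
      (fun j => specialSystem_le hV (b0 j).2) a
    have h2h : (2 : Poly3 k).IsHomogeneous 0 := by
      rw [← map_ofNat C 2]; exact isHomogeneous_C _ _
    have hzh := (((((hg''.pow (n j - 1)).mul hg').neg).pow (r.choose 2)).mul
      (((((h2h.mul (hg''.pow (n j))).mul ((hg''.pow (n j - 1)).mul hg')).pow (r.choose 2)).mul
        hw').pow 2))
    rw [← hz] at hzh
    refine (hasBinaryForms_of_prime hg hzh (h.irreducible j).prime
      (h.not_dvd_leadingTerm hV hnd b0 ha j)).mono ?_
    rw [Ideal.span_le]
    rintro _ (rfl | rfl)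
    · exact Ideal.mem_sup_right (Ideal.mem_span_singleton_self _)
    · exact hzI
  have hE : HasBinaryForms (I ⊔ Ideal.span {E}) := by
    refine (HasBinaryForms.sup_span_prod Finset.univ fun j _ => hGj j).mono ?_
    rw [Ideal.span_singleton_eq_span_singleton.mpr h.associated]
  have hA : HasBinaryForms (I ⊔ Ideal.span {A}) := by
    obtain ⟨g, hg⟩ := h.exists_isHomogeneous_right
    obtain ⟨g', hg'⟩ := h.exists_isHomogeneous_left
    obtain ⟨w', hw'⟩ := exists_wronskian_isHomogeneous hg (v := fun j => (b0 j : Poly3 k))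
      (fun j => specialSystem_le hV (b0 j).2) a
    refine (hasBinaryForms_of_isRelPrime hg (((hg'.pow 2).pow (r.choose 2)).mul hw')
      h.squarefree_right.ne_zero (IsRelPrime.mul_right ?_
        (h.isRelPrime_wronskian_right hV hnd b0 ha))).mono ?_
    · exact h.isRelPrime.symm.pow_right.pow_right
    · rw [Ideal.span_le]
      rintro _ (rfl | rfl)
      · exact Ideal.mem_sup_right (Ideal.mem_span_singleton_self _)
      · exact span_pair_mem_of_sub_mem (Ideal.mem_sup_right (Ideal.mem_span_singleton_self _))
          (Ideal.mem_sup_left hw) (wronskian_mul_sub_mem A (E ^ 2) (linearForm a) _)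
  have hEE : HasBinaryForms (I ⊔ Ideal.span {E ^ 2 * A}) := by
    rw [sq]; exact (hE.sup_span_mul hE).sup_span_mul hA
  refine hEE.mono (sup_le le_rfl ?_)
  rw [Ideal.span_singleton_le_iff_mem, ← h.atZero_eq]
  exact hF

end IsDegeneration

/-! ### Linear changes of coordinates -/

section Coordinates
variable {R : Type*} [CommRing R]

/-- The substitution `X_i = ∑_l M_{il} Y_l`. -/
def linearSubst (M : Matrix (Fin 3) (Fin 3) R) : Poly3 R →ₐ[R] Poly3 R :=
  aeval fun i => linearForm (M i)

theorem linearSubst_X (M : Matrix (Fin 3) (Fin 3) R) (i : Fin 3) :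
    linearSubst M (X i) = linearForm (M i) :=
  aeval_X _ _

theorem linearSubst_linearForm (M : Matrix (Fin 3) (Fin 3) R) (a : Fin 3 → R) :
    linearSubst M (linearForm a) = linearForm (Matrix.vecMul a M) := by
  simp only [linearSubst, linearForm, map_sum, map_mul, aeval_X, Matrix.vecMul, dotProduct,
    Finset.mul_sum, Finset.sum_mul, algHom_C, algebraMap_eq]
  rw [Finset.sum_comm]
  refine Finset.sum_congr rfl fun i _ => Finset.sum_congr rfl fun l _ => ?_
  ring

theorem linearSubst_linearSubst (M M' : Matrix (Fin 3) (Fin 3) R) (h : M * M' = 1) (P : Poly3 R) :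
    linearSubst M' (linearSubst M P) = P := by
  rw [← AlgHom.comp_apply]
  have : (linearSubst M').comp (linearSubst M) = AlgHom.id R _ := by
    apply algHom_ext
    intro i
    rw [AlgHom.comp_apply, linearSubst_X, linearSubst_linearForm, AlgHom.id_apply,
      X_eq_linearForm]
    congr 1
    funext l
    rw [Matrix.vecMul, ← Matrix.mul_apply', h, Matrix.one_apply, Pi.single_apply]
    simp only [eq_comm]
  rw [this, AlgHom.id_apply]

theorem eval_linearSubst (M : Matrix (Fin 3) (Fin 3) R) (x : Fin 3 → R) (P : Poly3 R) :
    eval x (linearSubst M P) = eval (Matrix.mulVec M x) P := by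
  rw [← coe_aeval_eq_eval, ← coe_aeval_eq_eval]
  change ((aeval x).comp (linearSubst M)) P = aeval (Matrix.mulVec M x) P
  congr 1
  apply algHom_ext
  intro i
  rw [AlgHom.comp_apply, linearSubst, aeval_X, aeval_X, linearForm, map_sum, Matrix.mulVec,
    dotProduct]
  simp

theorem linearSubst_isHomogeneous (M : Matrix (Fin 3) (Fin 3) R) {P : Poly3 R} {n : ℕ}
    (hP : P.IsHomogeneous n) : (linearSubst M P).IsHomogeneous n := by
  have := hP.aeval (fun i => linearForm (M i)) (n := 1) fun i => linearForm_isHomogeneous _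
  rwa [one_mul] at this

theorem map_linearSubst {R' : Type*} [CommRing R'] (f : R →+* R') (M : Matrix (Fin 3) (Fin 3) R)
    (P : Poly3 R) : map f (linearSubst M P) = linearSubst (M.map f) (map f P) := by
  induction P using MvPolynomial.induction_on with
  | C r => simp [linearSubst]
  | add p q hp hq => simp only [map_add, hp, hq]
  | mul_X p i hp =>
    rw [map_mul, map_mul, hp, map_mul, map_mul, map_X]
    congr 1
    rw [linearSubst, linearSubst, aeval_X, aeval_X, map_linearForm]
    rfl

/-- `R[X_0, X_1, X_2]` as the polynomials in `Y_0` over `R[Y_1, Y_2]`, after the substitution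
`X = M Y`. -/
def coordHom (M : Matrix (Fin 3) (Fin 3) R) : Poly3 R →ₐ[R] Polynomial (MvPolynomial (Fin 2) R) :=
  (MvPolynomial.finSuccEquiv R 2).toAlgHom.comp (linearSubst M)

theorem coordHom_apply (M : Matrix (Fin 3) (Fin 3) R) (P : Poly3 R) :
    coordHom M P = MvPolynomial.finSuccEquiv R 2 (linearSubst M P) := rfl

theorem coordHom_linearForm (M M' : Matrix (Fin 3) (Fin 3) R) (h : M' * M = 1) (i : Fin 3) :
    coordHom M (linearForm (M' i)) = MvPolynomial.finSuccEquiv R 2 (X i) := by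
  rw [coordHom_apply, linearSubst_linearForm, X_eq_linearForm]
  congr 2
  funext l
  rw [Matrix.vecMul, ← Matrix.mul_apply', h, Matrix.one_apply, Pi.single_apply]
  simp only [eq_comm]

theorem coordHom_injective {M M' : Matrix (Fin 3) (Fin 3) R} (h : M * M' = 1) :
    Function.Injective (coordHom M) := by
  intro P Q hPQ
  have h1 := (MvPolynomial.finSuccEquiv R 2).injective hPQ
  rw [← linearSubst_linearSubst M M' h P, ← linearSubst_linearSubst M M' h Q]
  exact congrArg _ h1

theorem coordHom_surjective {M M' : Matrix (Fin 3) (Fin 3) R} (h : M' * M = 1) :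
    Function.Surjective (coordHom M) := by
  intro f
  refine ⟨linearSubst M' ((MvPolynomial.finSuccEquiv R 2).symm f), ?_⟩
  rw [coordHom_apply, linearSubst_linearSubst M' M h, AlgEquiv.apply_symm_apply]

theorem map_finSuccEquiv {R' : Type*} [CommRing R'] (f : R →+* R') {n : ℕ}
    (P : MvPolynomial (Fin (n + 1)) R) :
    Polynomial.map (MvPolynomial.map f) (MvPolynomial.finSuccEquiv R n P) =
      MvPolynomial.finSuccEquiv R' n (MvPolynomial.map f P) := by
  induction P using MvPolynomial.induction_on with
  | C r =>
    rw [map_C, finSuccEquiv_apply, finSuccEquiv_apply, eval₂Hom_C, eval₂Hom_C]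
    simp
  | add p q hp hq => simp only [map_add, Polynomial.map_add, hp, hq]
  | mul_X p i hp =>
    rw [map_mul, Polynomial.map_mul, hp, map_mul, map_mul, map_X]
    congr 1
    refine Fin.cases ?_ (fun i => ?_) i
    · rw [finSuccEquiv_X_zero, finSuccEquiv_X_zero, Polynomial.map_X]
    · rw [finSuccEquiv_X_succ, finSuccEquiv_X_succ, Polynomial.map_C, map_X]

theorem map_coordHom {R' : Type*} [CommRing R'] (f : R →+* R') (M : Matrix (Fin 3) (Fin 3) R)
    (P : Poly3 R) : Polynomial.map (MvPolynomial.map f) (coordHom M P) =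
      coordHom (M.map f) (map f P) := by
  rw [coordHom_apply, coordHom_apply, map_finSuccEquiv, map_linearSubst]

/-- A form of degree `n` is a polynomial of degree at most `n` in `Y_0`, whose leading coefficient
is the value of the form at the point `Y_0 = 1`, `Y_1 = Y_2 = 0`. -/
theorem coordHom_isHomogeneous (M : Matrix (Fin 3) (Fin 3) R) {P : Poly3 R} {n : ℕ}
    (hP : P.IsHomogeneous n) : (coordHom M P).natDegree ≤ n ∧
      (coordHom M P).coeff n = C (eval (fun i => M i 0) P) := by
  have h1 := linearSubst_isHomogeneous M hP
  constructor
  · rw [coordHom_apply, natDegree_finSuccEquiv]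
    exact (degreeOf_le_totalDegree _ _).trans h1.totalDegree_le
  · have h2 : ∀ i, i ≤ n → ((coordHom M P).coeff i).IsHomogeneous (n - i) := fun i hi =>
      h1.finSuccEquiv_coeff_isHomogeneous i (n - i) (by omega)
    have h3 := h2 n le_rfl
    rw [Nat.sub_self] at h3
    have h4 := totalDegree_eq_zero_iff_eq_C.mp (Nat.le_zero.mp h3.totalDegree_le)
    rw [h4]
    congr 1
    have h5 := eval_eq_eval_mv_eval' 0 1 (linearSubst M P)
    rw [← coordHom_apply, eval_linearSubst] at h5
    have h6 : Polynomial.map (eval 0) (coordHom M P) =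
        Polynomial.C ((coordHom M P).coeff n |>.coeff 0) * Polynomial.X ^ n := by
      ext i
      rw [Polynomial.coeff_map, Polynomial.coeff_C_mul, Polynomial.coeff_X_pow]
      rcases lt_trichotomy i n with hi | rfl | hi
      · rw [if_neg hi.ne, mul_zero]
        have := h2 i hi.le
        have h7 : (aeval (fun j : Fin 2 => (0 : R) * (0 : Fin 2 → R) j)) ((coordHom M P).coeff i) =
            0 := by
          rw [IsHomogeneous_aeval_mul this, zero_pow (by omega), zero_mul]
        rw [← coe_aeval_eq_eval]
        simpa using h7
      · rw [if_pos rfl, mul_one, h4, eval_C, coeff_C, if_pos rfl]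
      · have h8 : (coordHom M P).natDegree ≤ n := by
          rw [coordHom_apply, natDegree_finSuccEquiv]
          exact (degreeOf_le_totalDegree _ _).trans h1.totalDegree_le
        rw [if_neg hi.ne', mul_zero, Polynomial.coeff_eq_zero_of_natDegree_lt (by omega), map_zero]
    rw [h6] at h5
    rw [Polynomial.eval_mul, Polynomial.eval_C, Polynomial.eval_pow, Polynomial.eval_X, one_pow,
      mul_one] at h5
    rw [← h5]
    congr 2
    funext i
    have h9 : (Fin.cons 1 0 : Fin 3 → R) 2 = 0 := rfl
    simp [Matrix.mulVec, dotProduct, Fin.sum_univ_three, h9]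

end Coordinates

theorem exists_monic_associated {R : Type*} [CommRing R] {P : Polynomial R} {n : ℕ}
    (h : P.natDegree ≤ n) (hu : IsUnit (P.coeff n)) : ∃ Q : Polynomial R, Q.Monic ∧
        Associated P Q := by
  obtain ⟨u, hu⟩ := hu
  refine ⟨P * Polynomial.C (↑u⁻¹ : R), ?_, ?_⟩
  · refine Polynomial.monic_of_natDegree_le_of_coeff_eq_one n ?_ ?_
    · exact (Polynomial.natDegree_mul_C_le _ _).trans h
    · rw [Polynomial.coeff_mul_C, ← hu, Units.mul_inv]
  · exact ⟨(Units.map (Polynomial.C : R →+* Polynomial R).toMonoidHom) u⁻¹, rfl⟩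

/-! ### The local rings of the projection from a point -/

section LocalRings

theorem algebraMap_localization_injective {R : Type*} [CommRing R] [IsDomain R] (p : Ideal R)
    [p.IsPrime] : Function.Injective (algebraMap R (Localization.AtPrime p)) :=
  IsLocalization.injective _ p.primeCompl_le_nonZeroDivisors

theorem isDomain_localization {R : Type*} [CommRing R] [IsDomain R] (p : Ideal R)
    [p.IsPrime] : IsDomain (Localization.AtPrime p) :=
  IsLocalization.isDomain_localization p.primeCompl_le_nonZeroDivisors

theorem localRingHom_surjective {R S : Type*} [CommRing R] [CommRing S] {f : R →+* S}
    (hf : Function.Surjective f) (p : Ideal R) [p.IsPrime] (q : Ideal S) [q.IsPrime]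
    (h : p = q.comap f) : Function.Surjective (Localization.localRingHom p q f h) := by
  intro z
  obtain ⟨⟨x, s⟩, hx⟩ := IsLocalization.surj q.primeCompl z
  obtain ⟨x', hx'⟩ := hf x
  obtain ⟨s', hs'⟩ := hf (s : S)
  have hs : s' ∈ p.primeCompl := by
    intro h'
    have h2 : f s' ∈ q := Ideal.mem_comap.mp (h ▸ h' : s' ∈ q.comap f)
    exact s.2 (hs' ▸ h2)
  obtain ⟨u, hu⟩ := (IsLocalization.map_units (Localization.AtPrime p)
    (⟨s', hs⟩ : p.primeCompl)).exists_left_inv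
  refine ⟨u * algebraMap _ _ x', ?_⟩
  have h1 := congrArg (Localization.localRingHom p q f h) hu
  rw [map_mul, Localization.localRingHom_to_map, map_one] at h1
  simp only [hs'] at h1
  simp only at hx
  rw [map_mul, Localization.localRingHom_to_map, hx', ← hx]
  linear_combination z * h1

theorem ker_localRingHom {R S : Type*} [CommRing R] [CommRing S] [IsDomain S] {f : R →+* S} {t : R}
    (hf : RingHom.ker f = Ideal.span {t}) (p : Ideal R) [p.IsPrime] (q : Ideal S) [q.IsPrime]
    (h : p = q.comap f) :
    RingHom.ker (Localization.localRingHom p q f h) = Ideal.span {algebraMap _ _ t} := by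
  apply le_antisymm
  · intro z hz
    obtain ⟨⟨x, s⟩, hx⟩ := IsLocalization.surj p.primeCompl z
    have h1 := congrArg (Localization.localRingHom p q f h) hx
    rw [map_mul, RingHom.mem_ker.mp hz, zero_mul, Localization.localRingHom_to_map] at h1
    have h2 := algebraMap_localization_injective q (h1.symm.trans (map_zero _).symm)
    have h3 : t ∣ x := by
      rw [← Ideal.mem_span_singleton, ← hf]
      exact h2
    obtain ⟨y, rfl⟩ := h3
    obtain ⟨u, hu⟩ := (IsLocalization.map_units (Localization.AtPrime p) s).exists_left_inv
    rw [Ideal.mem_span_singleton]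
    refine ⟨u * algebraMap _ _ y, ?_⟩
    simp only [map_mul] at hx
    linear_combination u * hx - z * hu
  · rw [Ideal.span_le, Set.singleton_subset_iff]
    change Localization.localRingHom p q f h _ = 0
    have ht : t ∈ RingHom.ker f := hf ▸ Ideal.mem_span_singleton_self t
    rw [Localization.localRingHom_to_map, RingHom.mem_ker.mp ht, map_zero]

variable (k : Type*) [Field k]

/-- The ideal of the point `Y_1 = 0` in the homogeneous coordinate ring `k[Y_1, Y_2]` of
the line. -/
def lineIdeal : Ideal (MvPolynomial (Fin 2) k) :=
  RingHom.ker (aeval ![0, Polynomial.X] : MvPolynomial (Fin 2) k →ₐ[k] Polynomial k)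

instance : (lineIdeal k).IsPrime := RingHom.ker_isPrime _

/-- The local ring of `k[Y_1, Y_2]` at `Y_1 = 0`, a discrete valuation ring. -/
def LineRing : Type _ := Localization.AtPrime (lineIdeal k)

instance : CommRing (LineRing k) := inferInstanceAs (CommRing (Localization.AtPrime _))

instance : IsLocalRing (LineRing k) := inferInstanceAs (IsLocalRing (Localization.AtPrime _))

instance : Algebra (MvPolynomial (Fin 2) k) (LineRing k) :=
  inferInstanceAs (Algebra _ (Localization.AtPrime (lineIdeal k)))

instance : IsLocalization.AtPrime (LineRing k) (lineIdeal k) :=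
  inferInstanceAs (IsLocalization.AtPrime (Localization.AtPrime (lineIdeal k)) (lineIdeal k))

variable {k} in
theorem X_zero_mem_lineIdeal : (X 0 : MvPolynomial (Fin 2) k) ∈ lineIdeal k := by
  rw [lineIdeal, RingHom.mem_ker]; simp

variable {k} in
theorem X_one_notMem_lineIdeal : (X 1 : MvPolynomial (Fin 2) k) ∉ lineIdeal k := by
  rw [lineIdeal, RingHom.mem_ker]; simp

theorem lineIdeal_eq_span : lineIdeal k = Ideal.span {X 0} := by
  apply le_antisymm
  · intro g hg
    have h1 : ∀ g : MvPolynomial (Fin 2) k, g - Polynomial.aeval (X 1)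
        (aeval ![(0 : Polynomial k), Polynomial.X] g) ∈
            Ideal.span {(X 0 : MvPolynomial (Fin 2) k)} := by
      intro g
      rw [← Ideal.Quotient.eq]
      change Ideal.Quotient.mkₐ k _ g = Ideal.Quotient.mkₐ k _ _
      rw [← AlgHom.comp_apply, ← AlgHom.comp_apply]
      congr 1
      apply algHom_ext
      intro i
      fin_cases i
      · simp only [AlgHom.comp_apply, aeval_X]
        simp
      · simp
    have h2 := h1 g
    rw [lineIdeal, RingHom.mem_ker] at hg
    change aeval _ g = 0 at hg
    rwa [hg, map_zero, sub_zero] at h2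
  · rw [Ideal.span_le, Set.singleton_subset_iff]
    exact X_zero_mem_lineIdeal

theorem maximalIdeal_lineRing : IsLocalRing.maximalIdeal (LineRing k) =
    Ideal.span {algebraMap (MvPolynomial (Fin 2) k) (LineRing k) (X 0)} := by
  rw [← Set.image_singleton, ← Ideal.map_span, ← lineIdeal_eq_span]
  exact (Localization.AtPrime.map_eq_maximalIdeal (I := lineIdeal k)).symm

instance : IsDomain (LineRing k) := isDomain_localization (lineIdeal k)

variable {k} in
theorem algebraMap_lineRing_injective :
    Function.Injective (algebraMap (MvPolynomial (Fin 2) k) (LineRing k)) :=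
  algebraMap_localization_injective (lineIdeal k)

instance : IsNoetherianRing (LineRing k) :=
  IsLocalization.isNoetherianRing (lineIdeal k).primeCompl (LineRing k) inferInstance

instance : IsDiscreteValuationRing (LineRing k) := by
  have hf : ¬ IsField (LineRing k) := by
    intro hf
    have := IsLocalRing.isField_iff_maximalIdeal_eq.mp hf
    rw [maximalIdeal_lineRing, Ideal.span_singleton_eq_bot] at this
    exact X_ne_zero 0 (algebraMap_lineRing_injective (this.trans (map_zero _).symm))
  refine ((IsDiscreteValuationRing.TFAE (LineRing k) hf).out 0 4).mpr ?_
  rw [maximalIdeal_lineRing]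
  exact ⟨_, rfl⟩

variable {R : Type*} [CommRing R] {k} (φ : R →+* k)

/-- The inverse image in `R[Y_1, Y_2]` of the ideal of `Y_1 = 0`; for `R = k[[t]]` it is the ideal
of `t = Y_1 = 0`. -/
def familyIdeal : Ideal (MvPolynomial (Fin 2) R) :=
  (lineIdeal k).comap (MvPolynomial.map φ)

instance : (familyIdeal φ).IsPrime := Ideal.IsPrime.comap _

/-- The local ring of `R[Y_1, Y_2]` at the ideal `familyIdeal φ`. -/
def FamilyRing : Type _ := Localization.AtPrime (familyIdeal φ)

instance : CommRing (FamilyRing φ) := inferInstanceAs (CommRing (Localization.AtPrime _))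

instance : IsLocalRing (FamilyRing φ) := inferInstanceAs (IsLocalRing (Localization.AtPrime _))

instance : Algebra (MvPolynomial (Fin 2) R) (FamilyRing φ) :=
  inferInstanceAs (Algebra _ (Localization.AtPrime (familyIdeal φ)))

instance : IsLocalization.AtPrime (FamilyRing φ) (familyIdeal φ) :=
  inferInstanceAs (IsLocalization.AtPrime (Localization.AtPrime (familyIdeal φ)) (familyIdeal φ))

instance [IsDomain R] : IsDomain (FamilyRing φ) := isDomain_localization (familyIdeal φ)

instance [IsNoetherianRing R] : IsNoetherianRing (FamilyRing φ) :=
  IsLocalization.isNoetherianRing (familyIdeal φ).primeCompl (Localization.AtPrime (familyIdeal φ))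
    inferInstance

/-- The localization map of `FamilyRing φ`. -/
def toFamilyRing : MvPolynomial (Fin 2) R →+* FamilyRing φ :=
  algebraMap _ (Localization.AtPrime (familyIdeal φ))

/-- Reduction of the local ring of the family to that of the special fiber. -/
def reduction : FamilyRing φ →+* LineRing k :=
  Localization.localRingHom (familyIdeal φ) (lineIdeal k) (MvPolynomial.map φ) rfl

theorem reduction_toFamilyRing (f : MvPolynomial (Fin 2) R) :
    reduction φ (toFamilyRing φ f) = algebraMap _ _ (MvPolynomial.map φ f) :=
  Localization.localRingHom_to_map _ _ _ _ _

theorem toFamilyRing_injective [IsDomain R] : Function.Injective (toFamilyRing φ) :=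
  algebraMap_localization_injective _

variable {φ}

theorem reduction_surjective (hφ : Function.Surjective φ) : Function.Surjective (reduction φ) :=
  localRingHom_surjective (map_surjective _ hφ) _ _ _

theorem ker_reduction {t : R} (ht : RingHom.ker φ = Ideal.span {t}) :
    RingHom.ker (reduction φ) = Ideal.span {toFamilyRing φ (C t)} := by
  refine ker_localRingHom ?_ _ _ _
  rw [ker_map, ht, Ideal.map_span, Set.image_singleton]

theorem isUnit_toFamilyRing {f : MvPolynomial (Fin 2) R} (hf : MvPolynomial.map φ f ∉ lineIdeal k) :
    IsUnit (toFamilyRing φ f) :=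
  IsLocalization.map_units (Localization.AtPrime (familyIdeal φ))
    (⟨f, hf⟩ : (familyIdeal φ).primeCompl)

end LocalRings

-- The localizations are used only through the instances and lemmas above.
attribute [irreducible] LineRing FamilyRing

/-! ### Coordinates adapted to a point -/

theorem eval_linearForm {R : Type*} [CommRing R] (a x : Fin 3 → R) :
    eval x (linearForm a) = dotProduct a x := by
  simp [linearForm, dotProduct]

theorem linearForm_ne_zero {R : Type*} [CommRing R] {a : Fin 3 → R} (ha : a ≠ 0) :
    linearForm a ≠ 0 := by
  intro h
  apply ha
  funext i
  have := congrArg (pderiv i) h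
  rwa [pderiv_linearForm, map_zero, C_eq_zero] at this

section Points
variable {k : Type*} [Field k]

theorem eval_eq_zero_iff_of_mk {n : ℕ} {x : Fin 3 → k} (hx : x ≠ 0) {P : Poly3 k}
    (hP : P.IsHomogeneous n) : eval (Projectivization.mk k x hx).rep P = 0 ↔ eval x P = 0 := by
  obtain ⟨c, hc⟩ := Projectivization.exists_smul_eq_mk_rep k x hx
  rw [← hc, ← coe_aeval_eq_eval, ← coe_aeval_eq_eval]
  change aeval (fun i => (c : k) * x i) P = 0 ↔ aeval x P = 0
  rw [IsHomogeneous_aeval_mul hP, mul_eq_zero, or_iff_right (pow_ne_zero _ c.ne_zero)]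

/-- A line `λ = 0` through `p` that avoids the other points of a finite scheme meets this scheme
only at `p`. -/
theorem HasBinaryForms.exists_pow_mem [IsAlgClosed k] {J : Ideal (Poly3 k)} (h : HasBinaryForms J) :
    ∃ Z : Set (ℙ k (Fin 3 → k)), Z.Finite ∧ ∀ (p : ℙ k (Fin 3 → k)) (lam nu : Fin 3 → k),
      (∀ q ∈ Z, q ≠ p → eval q.rep (linearForm lam) ≠ 0) → eval p.rep (linearForm nu) = 0 →
      ∃ c, linearForm nu ^ c ∈ J ⊔ Ideal.span {linearForm lam} := by
  let J' : Ideal (Poly3 k) := Ideal.span {g | g ∈ J ∧ ∃ n, g.IsHomogeneous n}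
  have hJ' : HasBinaryForms J' := fun i l hil => by
    obtain ⟨g, N, h0, hN, hg⟩ := h i l hil
    exact ⟨g, N, h0, hN, Ideal.subset_span ⟨hg, N, IsHomogeneous.rename_isHomogeneous hN⟩⟩
  refine ⟨_, hJ'.finite_points, fun p lam nu hlam hnu => ?_⟩
  have hle : J' ⊔ Ideal.span {linearForm lam} ≤ J ⊔ Ideal.span {linearForm lam} :=
    sup_le_sup_right (Ideal.span_le.mpr fun g hg => hg.1) _
  suffices linearForm nu ∈ (J' ⊔ Ideal.span {linearForm lam}).radical by
    obtain ⟨c, hc⟩ := this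
    exact ⟨c, hle hc⟩
  rw [← vanishingIdeal_zeroLocus_eq_radical (K := k)]
  intro x hx
  have hx' : ∀ P ∈ J' ⊔ Ideal.span {linearForm lam}, eval x P = 0 := fun P hP => by
    rw [← coe_aeval_eq_eval]; exact hx P hP
  suffices eval x (linearForm nu) = 0 by rwa [← coe_aeval_eq_eval] at this
  by_cases hx0 : x = 0
  · rw [hx0, eval_linearForm, dotProduct_zero]
  have hmem : J' ≤ pointIdeal (Projectivization.mk k x hx0) := by
    refine Ideal.span_le.mpr fun g hg => ?_
    obtain ⟨n, hn⟩ := hg.2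
    rw [SetLike.mem_coe, mem_pointIdeal_iff_of_isHomogeneous hn, eval_eq_zero_iff_of_mk hx0 hn]
    exact hx' g (Ideal.mem_sup_left (Ideal.subset_span hg))
  have hp : Projectivization.mk k x hx0 = p := by
    by_contra hne
    refine hlam _ hmem hne ((eval_eq_zero_iff_of_mk hx0 (linearForm_isHomogeneous _)).mpr ?_)
    exact hx' _ (Ideal.mem_sup_right (Ideal.mem_span_singleton_self _))
  rw [← hp] at hnu
  exact (eval_eq_zero_iff_of_mk hx0 (linearForm_isHomogeneous _)).mp hnu

theorem exists_eval_ne_zero [Infinite k] {P : Poly3 k} (hP : P ≠ 0) : ∃ x, eval x P ≠ 0 := by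
  by_contra! h
  exact hP (MvPolynomial.funext fun x => by rw [h, map_zero])

theorem exists_ne_zero_dotProduct_eq_zero (a : Fin 3 → k) : ∃ l : Fin 3 → k, l ≠ 0 ∧ l ⬝ᵥ a = 0 :=
    by
  by_cases h : a 0 = 0
  · refine ⟨![1, 0, 0], fun h' => one_ne_zero (congrFun h' 0), ?_⟩
    simp [dotProduct, Fin.sum_univ_three, h]
  · refine ⟨![-a 1, a 0, 0], fun h' => h (congrFun h' 1), ?_⟩
    simp [dotProduct, Fin.sum_univ_three]; ring

/-- Coordinates `X = M Y` with inverse `Y = M' X`, in which `p` is the point `Y_0 = Y_1 = 0`, while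
the point `Y_1 = Y_2 = 0` is not on the curve `H = 0`. -/
structure IsAdapted (M M' : Matrix (Fin 3) (Fin 3) k) (p : ℙ k (Fin 3 → k)) (H : Poly3 k) :
    Prop where
  mul_eq_one : M * M' = 1
  mul_eq_one' : M' * M = 1
  rep_eq : ∀ i, M i 2 = p.rep i
  eval_ne_zero : eval (fun i => M i 0) H ≠ 0

theorem linearIndependent_pair {a c l : Fin 3 → k} (ha : a ≠ 0) (hla : l ⬝ᵥ a = 0)
    (hlc : l ⬝ᵥ c ≠ 0) : LinearIndependent k ![a, c] := by
  rw [LinearIndependent.pair_iff' ha]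
  rintro s rfl
  exact hlc (by rw [dotProduct_smul, hla, smul_zero])

theorem linearIndependent_rep {p q : ℙ k (Fin 3 → k)} (h : q ≠ p) :
    LinearIndependent k ![p.rep, q.rep] := by
  rw [LinearIndependent.pair_iff' p.rep_nonzero]
  intro s hs
  apply h
  rw [← p.mk_rep, ← q.mk_rep, Projectivization.mk_eq_mk_iff']
  exact ⟨s, hs⟩

theorem exists_isAdapted_of_finite [Infinite k] (p : ℙ k (Fin 3 → k)) {H : Poly3 k} (hH : H ≠ 0)
    {Z : Set (ℙ k (Fin 3 → k))} (hZ : Z.Finite) : ∃ M M', IsAdapted M M' p H ∧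
      ∀ q ∈ Z, q ≠ p → eval q.rep (linearForm (M' 1)) ≠ 0 := by
  classical
  obtain ⟨l, hl0, hla⟩ := exists_ne_zero_dotProduct_eq_zero p.rep
  let T := hZ.toFinset.filter (· ≠ p)
  have hT : ∀ q, q ∈ T ↔ q ∈ Z ∧ q ≠ p := fun q => by simp [T]
  obtain ⟨c, hc⟩ := exists_eval_ne_zero (P := H * linearForm l *
    ∏ q ∈ T, linearForm (crossProduct p.rep q.rep)) (by
      refine mul_ne_zero (mul_ne_zero hH (linearForm_ne_zero hl0)) (Finset.prod_ne_zero_iff.mpr ?_)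
      intro q hq
      exact linearForm_ne_zero (crossProduct_ne_zero_iff_linearIndependent.mpr
        (linearIndependent_rep ((hT q).mp hq).2)))
  rw [map_mul, map_mul, map_prod, mul_ne_zero_iff, mul_ne_zero_iff, Finset.prod_ne_zero_iff,
    eval_linearForm] at hc
  obtain ⟨⟨hcH, hcl⟩, hcT⟩ := hc
  have hcross := crossProduct_ne_zero_iff_linearIndependent.mpr
    (linearIndependent_pair p.rep_nonzero hla hcl)
  obtain ⟨i, hi⟩ : ∃ i, crossProduct p.rep c i ≠ 0 := by
    by_contra! h
    exact hcross (funext h)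
  let M : Matrix (Fin 3) (Fin 3) k := Matrix.of fun s =>
      ![c s, (Pi.single i 1 : Fin 3 → k) s, p.rep s]
  have hdet : M.det = crossProduct p.rep c i := by
    rw [Matrix.det_fin_three, crossProduct]
    fin_cases i <;> simp [M] <;> ring
  have hu : IsUnit M.det := by rw [hdet]; exact isUnit_iff_ne_zero.mpr hi
  have h1 := Matrix.mul_nonsing_inv M hu
  have h2 := Matrix.nonsing_inv_mul M hu
  refine ⟨M, M⁻¹, ⟨h1, h2, fun s => rfl, hcH⟩, fun q hq hqp hlam => ?_⟩
  rw [eval_linearForm] at hlam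
  -- `q` would be a combination of `c` and `p`, and lie on the line through `c` and `p`
  have h3 : q.rep = Matrix.mulVec M (Matrix.mulVec M⁻¹ q.rep) := by
    rw [Matrix.mulVec_mulVec, h1, Matrix.one_mulVec]
  set y := Matrix.mulVec M⁻¹ q.rep
  have hy : y 1 = 0 := hlam
  have h4 : q.rep = y 0 • c + y 2 • p.rep := by
    rw [h3]
    funext s
    simp [Matrix.mulVec, dotProduct, Fin.sum_univ_three, M, hy]
    ring
  have h5 : y 0 = 0 := by
    have h6 := congrArg (fun v => v ⬝ᵥ crossProduct p.rep q.rep) h4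
    simp only [add_dotProduct, smul_dotProduct, dot_cross_self, dot_self_cross, smul_zero,
      add_zero] at h6
    have h7 := hcT q ((hT q).mpr ⟨hq, hqp⟩)
    rw [eval_linearForm, dotProduct_comm] at h7
    exact (smul_eq_zero.mp h6.symm).resolve_right h7
  have h6 := linearIndependent_rep hqp
  rw [LinearIndependent.pair_iff' p.rep_nonzero] at h6
  exact h6 (y 2) (by rw [h4, h5, zero_smul, zero_add])

/-- Adapted coordinates in which moreover the line `Y_1 = 0` meets finitely many given finite
schemes at most at `p`. -/
theorem exists_isAdapted [IsAlgClosed k] (p : ℙ k (Fin 3 → k)) {H : Poly3 k} (hH : H ≠ 0)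
    {S : Set (Ideal (Poly3 k))} (hS : S.Finite) (hJ : ∀ J ∈ S, HasBinaryForms J) :
    ∃ M M', IsAdapted M M' p H ∧
      ∀ J ∈ S, ∃ c, linearForm (M' 0) ^ c ∈ J ⊔ Ideal.span {linearForm (M' 1)} := by
  choose! Z hZ using fun J hJS => (hJ J hJS).exists_pow_mem
  obtain ⟨M, M', h, h1⟩ := exists_isAdapted_of_finite p hH (hS.biUnion fun J hJS => (hZ J hJS).1)
  refine ⟨M, M', h, fun J hJS => (hZ J hJS).2 p _ _ (fun q hq hqp => h1 q ?_ hqp) ?_⟩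
  · exact Set.mem_biUnion hJS hq
  · rw [eval_linearForm]
    have h2 := congrFun (congrFun h.mul_eq_one' 0) 2
    rw [Matrix.mul_apply, Matrix.one_apply, if_neg (by decide)] at h2
    simpa only [h.rep_eq, dotProduct] using h2

end Points

/-! ### The local ring at a point -/

theorem exists_mul_C_eq_map {A : Type*} [CommRing A] (p : Ideal A) [p.IsPrime] {L : Type*}
    [CommRing L] [Algebra A L] [IsLocalization.AtPrime L p] (f : Polynomial L) :
    ∃ s ∉ p, ∃ g : Polynomial A,
      f * Polynomial.C (algebraMap A _ s) = g.map (algebraMap A L) := by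
  let _ : Algebra (Polynomial A) (Polynomial L) := Polynomial.algebra A L
  have : IsLocalization (p.primeCompl.map (Polynomial.C : A →+* Polynomial A)) (Polynomial L) :=
      Polynomial.isLocalization _ _
  obtain ⟨⟨g, ⟨_, s, hs, rfl⟩⟩, h⟩ := IsLocalization.surj
    (p.primeCompl.map (Polynomial.C : A →+* Polynomial A)) f
  refine ⟨s, hs, g, ?_⟩
  rw [← Polynomial.map_C]
  exact h

theorem exists_C_mem_span_pair_of_isRelPrime {R : Type*} [CommRing R] [IsDomain R]
    [UniqueFactorizationMonoid R] {P Q : Polynomial R} (hP0 : P ≠ 0) (hPQ : IsRelPrime P Q) :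
    ∃ r : R, r ≠ 0 ∧ Polynomial.C r ∈ Ideal.span {P, Q} := by
  induction P using WfDvdMonoid.induction_on_irreducible with
  | zero => exact absurd rfl hP0
  | unit u hu =>
    refine ⟨1, one_ne_zero, ?_⟩
    rw [Ideal.eq_top_of_isUnit_mem _ (Ideal.subset_span (by simp)) hu]
    trivial
  | mul P G hP0' hG ih =>
    obtain ⟨r, hr, h1⟩ := exists_C_mem_span_pair hG.prime (Q := Q) fun h =>
      hG.not_isUnit (hPQ (Dvd.intro _ rfl) h)
    obtain ⟨s, hs, h2⟩ := ih hP0' hPQ.of_mul_left_right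
    refine ⟨r * s, mul_ne_zero hr hs, span_pair_mul_le _ _ _ ?_⟩
    rw [Polynomial.C_mul]
    exact Ideal.mul_mem_mul h1 h2

section PointHom
variable {k : Type*} [Field k]

/-- The map from `k[X_0, X_1, X_2]` to the polynomials in `Y_0` over the local ring of
`k[Y_1, Y_2]` at `Y_1 = 0`, where `X = M Y`. -/
def pointHom (M : Matrix (Fin 3) (Fin 3) k) : Poly3 k →+* Polynomial (LineRing k) :=
  (Polynomial.mapRingHom (algebraMap (MvPolynomial (Fin 2) k) (LineRing k))).comp
    (coordHom M : Poly3 k →+* Polynomial (MvPolynomial (Fin 2) k))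

theorem pointHom_apply (M : Matrix (Fin 3) (Fin 3) k) (P : Poly3 k) :
    pointHom M P = (coordHom M P).map (algebraMap (MvPolynomial (Fin 2) k) (LineRing k)) := rfl

theorem exists_pointHom {M M' : Matrix (Fin 3) (Fin 3) k} (h : M' * M = 1)
    (f : Polynomial (LineRing k)) :
    ∃ s m, IsUnit (pointHom M m) ∧ f * pointHom M m = pointHom M s := by
  obtain ⟨s, hs, g, hg⟩ := exists_mul_C_eq_map (lineIdeal k) f
  obtain ⟨m, hm⟩ := coordHom_surjective h (Polynomial.C s)
  obtain ⟨g', hg'⟩ := coordHom_surjective h g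
  have h1 : pointHom M m = Polynomial.C (algebraMap _ _ s) := by
    rw [pointHom_apply, hm, Polynomial.map_C]
  refine ⟨g', m, ?_, ?_⟩
  · rw [h1]
    exact (IsLocalization.map_units (LineRing k) (⟨s, hs⟩ : (lineIdeal k).primeCompl)).map _
  · rw [h1, hg, pointHom_apply, hg']

/-- The ideal of `p` is the contraction of that of the point `Y_0 = 0` of the special fiber of
`pointHom`. -/
theorem mem_pointIdeal_iff {M : Matrix (Fin 3) (Fin 3) k} {p : ℙ k (Fin 3 → k)}
    (h : ∀ i, M i 2 = p.rep i) (s : Poly3 k) :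
    s ∈ pointIdeal p ↔ (pointHom M s).coeff 0 ∈ IsLocalRing.maximalIdeal (LineRing k) := by
  rw [pointHom_apply, Polynomial.coeff_map,
    IsLocalization.AtPrime.to_map_mem_maximal_iff (LineRing k) (lineIdeal k), lineIdeal,
    RingHom.mem_ker, pointIdeal, RingHom.mem_ker]
  suffices (aeval fun i : Fin 3 => Polynomial.C (p.rep i) * (Polynomial.X : Polynomial k)) s =
      aeval ![(0 : Polynomial k), Polynomial.X] ((coordHom M s).coeff 0) by
    exact this ▸ Iff.rfl
  induction s using MvPolynomial.induction_on with
  | C r =>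
    rw [← algebraMap_eq, AlgHom.commutes, AlgHom.commutes,
      Polynomial.algebraMap_apply (R := k) (A := MvPolynomial (Fin 2) k), Polynomial.coeff_C_zero,
      AlgHom.commutes]
  | add P Q hP hQ => rw [map_add, map_add, hP, hQ, Polynomial.coeff_add, map_add]
  | mul_X P i hP =>
    rw [map_mul, map_mul, hP, Polynomial.mul_coeff_zero, map_mul]
    congr 1
    rw [aeval_X, coordHom_apply, linearSubst_X, linearForm, Fin.sum_univ_three, ← h i]
    have h1 : (1 : Fin 3) = Fin.succ 0 := rfl
    have h2 : (2 : Fin 3) = Fin.succ 1 := rfl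
    have h3 : ∀ c : k, MvPolynomial.finSuccEquiv k 2 (C c) = Polynomial.C (C c) := fun c => by
      rw [← algebraMap_eq, AlgEquiv.commutes]; rfl
    simp only [map_add, map_mul, h3, finSuccEquiv_X_zero]
    rw [h1, h2, finSuccEquiv_X_succ, finSuccEquiv_X_succ]
    simp

namespace IsAdapted
variable {M M' : Matrix (Fin 3) (Fin 3) k} {p : ℙ k (Fin 3 → k)} {H : Poly3 k}
    (h : IsAdapted M M' p H)
include h

theorem pointHom_injective : Function.Injective (pointHom M) :=
  (Polynomial.map_injective _ algebraMap_lineRing_injective).comp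
    (coordHom_injective h.mul_eq_one)

theorem pointHom_zero : pointHom M (linearForm (M' 0)) = Polynomial.X := by
  rw [pointHom_apply, coordHom_linearForm _ _ h.mul_eq_one', finSuccEquiv_X_zero, Polynomial.map_X]

theorem pointHom_one : pointHom M (linearForm (M' 1)) =
    Polynomial.C (algebraMap (MvPolynomial (Fin 2) k) (LineRing k) (X 0)) := by
  rw [pointHom_apply, coordHom_linearForm _ _ h.mul_eq_one']
  have h1 : (1 : Fin 3) = Fin.succ 0 := rfl
  rw [h1, finSuccEquiv_X_succ, Polynomial.map_C]

theorem isUnit_pointHom_two : IsUnit (pointHom M (linearForm (M' 2))) := by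
  rw [pointHom_apply, coordHom_linearForm _ _ h.mul_eq_one']
  have h2 : (2 : Fin 3) = Fin.succ 1 := rfl
  rw [h2, finSuccEquiv_X_succ, Polynomial.map_C]
  exact (IsLocalization.map_units (LineRing k)
    (⟨X 1, X_one_notMem_lineIdeal⟩ : (lineIdeal k).primeCompl)).map _

/-- The length at `p` is the length over the local ring of the line, since the line `Y_1 = 0` meets
the scheme at most at `p`. -/
theorem pointMultiplicity_eq {J : Ideal (Poly3 k)} {c : ℕ}
    (hc : linearForm (M' 0) ^ c ∈ J ⊔ Ideal.span {linearForm (M' 1)})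
    {P : Polynomial (LineRing k)} (hP : P.Monic) (hPJ : P ∈ J.map (pointHom M)) :
    pointMultiplicity J p = Module.length (LineRing k)
      (Polynomial (LineRing k) ⧸ J.map (pointHom M)) := by
  refine length_localization_eq (pointHom M) h.pointHom_injective (exists_pointHom h.mul_eq_one')
    (pointIdeal p) (mem_pointIdeal_iff h.rep_eq) J hP hPJ (e := c) ?_
  have h1 := Ideal.mem_map_of_mem (pointHom M) hc
  rw [map_pow, h.pointHom_zero, Ideal.map_sup, Ideal.map_span, Set.image_singleton,
    h.pointHom_one] at h1
  rwa [maximalIdeal_lineRing, Ideal.map_span, Set.image_singleton]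

/-- A factor of `H` becomes a monic polynomial in `Y_0`, up to a unit. -/
theorem exists_monic {e : ℕ} (hH : H.IsHomogeneous e) {G : Poly3 k} (hG : G ∣ H) :
    ∃ P : Polynomial (LineRing k), P.Monic ∧ Associated (pointHom M G) P := by
  have hH0 : H ≠ 0 := by
    rintro rfl
    exact h.eval_ne_zero (map_zero _)
  obtain ⟨g, hg⟩ := exists_isHomogeneous_of_dvd hH hH0 hG
  obtain ⟨h1, h2⟩ := coordHom_isHomogeneous M hg
  refine exists_monic_associated ((Polynomial.natDegree_map_le).trans h1) ?_
  rw [pointHom_apply, Polynomial.coeff_map, h2]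
  refine ((isUnit_iff_ne_zero.mpr ?_).map C).map _
  intro h3
  apply h.eval_ne_zero
  obtain ⟨u, rfl⟩ := hG
  rw [map_mul, h3, zero_mul]

theorem normMod_ne_zero {G x : Poly3 k} (hG : G ≠ 0) (hx : IsRelPrime G x)
    {P : Polynomial (LineRing k)} (hP : P.Monic) (hGP : Associated (pointHom M G) P) :
    normMod P (pointHom M x) ≠ 0 := by
  have hdvd : ∀ z, ∃ z', coordHom M z' = z := coordHom_surjective h.mul_eq_one'
  have hinj := coordHom_injective h.mul_eq_one
  have hrel : IsRelPrime (coordHom M G) (coordHom M x) := by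
    intro z h1 h2
    obtain ⟨z, rfl⟩ := hdvd z
    have h3 : ∀ y, coordHom M z ∣ coordHom M y → z ∣ y := by
      rintro y ⟨u, hu⟩
      obtain ⟨u, rfl⟩ := hdvd u
      exact ⟨u, hinj (by rw [hu, map_mul])⟩
    exact (hx (h3 _ h1) (h3 _ h2)).map _
  obtain ⟨r, hr, hrmem⟩ := exists_C_mem_span_pair_of_isRelPrime
    ((map_ne_zero_iff _ hinj).mpr hG) hrel
  obtain ⟨u, v, huv⟩ := Ideal.mem_span_pair.mp hrmem
  have h1 := congrArg (Polynomial.map (algebraMap _ (LineRing k))) huv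
  rw [Polynomial.map_add, Polynomial.map_mul, Polynomial.map_mul, Polynomial.map_C,
    ← pointHom_apply, ← pointHom_apply] at h1
  have h2 : normMod P (v.map (algebraMap _ (LineRing k)) * pointHom M x) =
      normMod P (Polynomial.C (algebraMap _ (LineRing k) r)) := by
    apply normMod_congr
    rw [← h1]
    refine (hGP.symm.dvd).trans ⟨- u.map (algebraMap _ (LineRing k)), ?_⟩
    ring
  intro h3
  rw [normMod_mul, h3, mul_zero, normMod_C hP] at h2
  exact hr (algebraMap_lineRing_injective
    ((eq_zero_of_pow_eq_zero h2.symm).trans (map_zero _).symm))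

/-- The multiplicity at `p` of the scheme cut out near `p` by a factor `G` of `H` and by `x`. -/
theorem pointMultiplicity_eq_ord {J : Ideal (Poly3 k)} {c : ℕ}
    (hc : linearForm (M' 0) ^ c ∈ J ⊔ Ideal.span {linearForm (M' 1)}) {G x : Poly3 k}
    (hJ : J.map (pointHom M) = Ideal.span {pointHom M G, pointHom M x}) (hG : G ≠ 0)
    (hx : IsRelPrime G x) {P : Polynomial (LineRing k)} (hP : P.Monic)
    (hGP : Associated (pointHom M G) P) :
    pointMultiplicity J p = Ring.ord (LineRing k) (normMod P (pointHom M x)) := by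
  have h1 : J.map (pointHom M) = Ideal.span {P, pointHom M x} := by
    rw [hJ, Ideal.span_insert, Ideal.span_insert, Ideal.span_singleton_eq_span_singleton.mpr hGP]
  rw [h.pointMultiplicity_eq hc hP (h1 ▸ Ideal.subset_span (by simp)), h1]
  exact length_quotient_span_pair hP _ (h.normMod_ne_zero hG hx hP hGP)

/-- Near `p`, where `Y_2` is invertible, the ramification scheme is given by the Wronskian of
`Y_2`. -/
theorem map_ramificationIdeal {G : Poly3 k} {V : Submodule k (Poly3 k)} {n g d : ℕ}
    (hG : G.IsHomogeneous g) (b : Module.Basis (Fin n) k V)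
    (hV : V ≤ homogeneousSubmodule (Fin 3) k d) :
    (ramificationIdeal G V).map (pointHom M) = Ideal.span {pointHom M G, pointHom M
      (wronskian (jacobianDerivation G (linearForm (M' 2))) (fun j => (b j : Poly3 k)))} := by
  apply le_antisymm
  · rw [Ideal.map_le_iff_le_comap]
    intro x hx
    obtain ⟨c, hc⟩ := exists_pow_mul_mem_span hG b hV (M' 2) hx
    have h1 := Ideal.mem_map_of_mem (pointHom M) hc
    rw [Ideal.map_span, Set.image_pair, map_mul, map_pow] at h1
    exact (Ideal.unit_mul_mem_iff_mem _ (h.isUnit_pointHom_two.pow c)).mp h1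
  · have h1 := Ideal.map_mono (f := pointHom M) (span_le_ramificationIdeal hG b hV (M' 2))
    rwa [Ideal.map_span, Set.image_pair] at h1

end IsAdapted

end PointHom

/-! ### The limit at a point -/

section FamilyHom
variable {R k : Type*} [CommRing R] [Field k] (φ : R →+* k)

/-- The analogue of `pointHom` for a family over `R`. -/
def familyHom (M : Matrix (Fin 3) (Fin 3) R) : Poly3 R →+* Polynomial (FamilyRing φ) :=
  (Polynomial.mapRingHom (toFamilyRing φ)).comp
    (coordHom M : Poly3 R →+* Polynomial (MvPolynomial (Fin 2) R))

theorem familyHom_apply (M : Matrix (Fin 3) (Fin 3) R) (P : Poly3 R) :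
    familyHom φ M P = (coordHom M P).map (toFamilyRing φ) := rfl

theorem map_familyHom (M : Matrix (Fin 3) (Fin 3) R) (P : Poly3 R) :
    (familyHom φ M P).map (reduction φ) = pointHom (M.map φ) (map φ P) := by
  rw [familyHom_apply, pointHom_apply, ← map_coordHom, Polynomial.map_map, Polynomial.map_map]
  congr 1
  exact RingHom.ext fun f => reduction_toFamilyRing φ f

theorem familyHom_C (M : Matrix (Fin 3) (Fin 3) R) (c : R) :
    familyHom φ M (C c) = Polynomial.C (toFamilyRing φ (C c)) := by
  rw [familyHom_apply, ← algebraMap_eq, AlgHom.commutes,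
    Polynomial.algebraMap_apply (R := R) (A := MvPolynomial (Fin 2) R), Polynomial.map_C,
    algebraMap_eq]

theorem familyHom_injective [IsDomain R] {M M' : Matrix (Fin 3) (Fin 3) R} (h : M * M' = 1) :
    Function.Injective (familyHom φ M) :=
  (Polynomial.map_injective _ (toFamilyRing_injective φ)).comp (coordHom_injective h)

theorem exists_familyHom {M M' : Matrix (Fin 3) (Fin 3) R} (h : M' * M = 1)
    (f : Polynomial (FamilyRing φ)) :
    ∃ s m, IsUnit (familyHom φ M m) ∧ f * familyHom φ M m = familyHom φ M s := by
  obtain ⟨s, hs, g, hg⟩ := exists_mul_C_eq_map (familyIdeal φ) f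
  obtain ⟨m, hm⟩ := coordHom_surjective h (Polynomial.C s)
  obtain ⟨g', hg'⟩ := coordHom_surjective h g
  have h1 : familyHom φ M m = Polynomial.C (toFamilyRing φ s) := by
    rw [familyHom_apply, hm, Polynomial.map_C]
  refine ⟨g', m, ?_, ?_⟩
  · rw [h1]
    exact (isUnit_toFamilyRing hs).map _
  · rw [h1, familyHom_apply, hg']
    exact hg

theorem isUnit_familyHom_two {M M' : Matrix (Fin 3) (Fin 3) R} (h : M' * M = 1) :
    IsUnit (familyHom φ M (linearForm (M' 2))) := by
  rw [familyHom_apply, coordHom_linearForm _ _ h]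
  have h2 : (2 : Fin 3) = Fin.succ 1 := rfl
  rw [h2, finSuccEquiv_X_succ, Polynomial.map_C]
  refine (isUnit_toFamilyRing ?_).map _
  rw [map_X]
  exact X_one_notMem_lineIdeal

theorem exists_monic_familyHom (M : Matrix (Fin 3) (Fin 3) R) {F : Poly3 R} {e : ℕ}
    (hF : F.IsHomogeneous e) (h0 : eval (fun i => φ (M i 0)) (map φ F) ≠ 0) :
    ∃ P : Polynomial (FamilyRing φ), P.Monic ∧ Associated (familyHom φ M F) P := by
  obtain ⟨h1, h2⟩ := coordHom_isHomogeneous M hF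
  refine exists_monic_associated ((Polynomial.natDegree_map_le).trans h1) ?_
  rw [familyHom_apply, Polynomial.coeff_map, h2]
  refine isUnit_toFamilyRing fun h3 => h0 ?_
  have h4 : φ (eval (fun i => M i 0) F) = eval (fun i => φ (M i 0)) (map φ F) := by
    rw [eval_map]
    exact eval₂_comp_left φ (RingHom.id R) _ F
  rw [map_C, h4, lineIdeal, RingHom.mem_ker] at h3
  simpa using h3

end FamilyHom

universe u v in
/-- The properties of the map `familyHom` that are needed, for a family over `R` whose special
fiber is given by `φ : R → k` with section `σ`. -/
theorem exists_familyHom_model {R : Type u} {k : Type v} [CommRing R] [Field k] [IsDomain R]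
    [IsNoetherianRing R] (φ : R →+* k) (hφ : Function.Surjective φ)
    {σ : k →+* R} (hσ : ∀ c, φ (σ c) = c) {t : R} (ht : RingHom.ker φ = Ideal.span {t})
    (ht0 : t ≠ 0) {M M' : Matrix (Fin 3) (Fin 3) k} (h : M * M' = 1) (h' : M' * M = 1) :
    ∃ (Λ : Type u) (_ : CommRing Λ) (_ : IsDomain Λ) (_ : IsLocalRing Λ) (_ : IsNoetherianRing Λ)
      (π : Λ →+* LineRing k) (s : Λ) (j : Poly3 R →+* Polynomial Λ),
      Function.Surjective π ∧ RingHom.ker π = Ideal.span {s} ∧ s ≠ 0 ∧ Function.Injective j ∧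
      (∀ P, (j P).map π = pointHom M (map φ P)) ∧ j (C t) = Polynomial.C s ∧
      IsUnit (j (linearForm fun i => σ (M' 2 i))) ∧
      (∀ f, ∃ x m, IsUnit (j m) ∧ f * j m = j x) ∧
      ∀ (F : Poly3 R) (e : ℕ), F.IsHomogeneous e → eval (fun i => M i 0) (map φ F) ≠ 0 →
        ∃ P : Polynomial Λ, P.Monic ∧ Associated (j F) P := by
  have hM : ∀ N N' : Matrix (Fin 3) (Fin 3) k, N * N' = 1 → N.map σ * N'.map σ = 1 := by
    intro N N' hN
    rw [← Matrix.map_mul, hN, Matrix.map_one _ (map_zero _) (map_one _)]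
  have hMφ : (M.map σ).map φ = M := by
    ext i l
    exact hσ _
  refine ⟨FamilyRing φ, inferInstance, inferInstance, inferInstance, inferInstance, reduction φ,
    toFamilyRing φ (C t), familyHom φ (M.map σ), ?_, ?_, ?_, ?_, ?_, ?_, ?_, ?_, ?_⟩
  · exact reduction_surjective hφ
  · exact ker_reduction ht
  · intro h0
    exact ht0 (C_eq_zero.mp (toFamilyRing_injective φ (h0.trans (map_zero _).symm)))
  · exact familyHom_injective φ (hM M M' h)
  · intro P
    rw [map_familyHom, hMφ]
  · exact familyHom_C φ _ _
  · have h3 : (linearForm fun i => σ (M' 2 i)) = linearForm ((M'.map σ) 2) := rfl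
    rw [h3]
    exact isUnit_familyHom_two φ (hM M' M h')
  · exact exists_familyHom φ (hM M' M h')
  · intro F e hF h0
    refine exists_monic_familyHom φ (M.map σ) hF ?_
    simpa only [Matrix.map_apply, hσ] using h0

section Orders
variable {D : Type*} [CommRing D] [IsDomain D] [IsDiscreteValuationRing D]

/-- The order of contact of `P = 0` and `x = 0` in the affine line over a discrete valuation ring:
the order of the norm of `x` modulo `P`. -/
def contactOrder (P x : Polynomial D) : ℕ := (Ring.ord D (normMod P x)).toNat

theorem toNat_ord_mul {a b : D} (ha : a ≠ 0) (hb : b ≠ 0) :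
    (Ring.ord D (a * b)).toNat = (Ring.ord D a).toNat + (Ring.ord D b).toNat := by
  rw [Ring.ord_mul D (mem_nonZeroDivisors_of_ne_zero hb), ENat.toNat_add
    (Ring.ord_ne_top (mem_nonZeroDivisors_of_ne_zero ha))
    (Ring.ord_ne_top (mem_nonZeroDivisors_of_ne_zero hb))]

theorem toNat_ord_pow {a : D} (ha : a ≠ 0) (n : ℕ) :
    (Ring.ord D (a ^ n)).toNat = n * (Ring.ord D a).toNat := by
  induction n with
  | zero => simp
  | succ n ih => rw [pow_succ, toNat_ord_mul (pow_ne_zero _ ha) ha, ih]; ring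

theorem toNat_ord_prod {ι : Type*} (s : Finset ι) (f : ι → D) (hf : ∀ i ∈ s, f i ≠ 0) :
    (Ring.ord D (∏ i ∈ s, f i)).toNat = ∑ i ∈ s, (Ring.ord D (f i)).toNat := by
  classical
  induction s using Finset.induction with
  | empty => simp
  | insert a s ha ih =>
    have h1 : ∀ i ∈ s, f i ≠ 0 := fun i hi => hf i (Finset.mem_insert_of_mem hi)
    rw [Finset.prod_insert ha, Finset.sum_insert ha, toNat_ord_mul
      (hf a (Finset.mem_insert_self _ _)) (Finset.prod_ne_zero_iff.mpr h1), ih h1]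

theorem contactOrder_mul {P x y : Polynomial D} (hx : normMod P x ≠ 0) (hy : normMod P y ≠ 0) :
    contactOrder P (x * y) = contactOrder P x + contactOrder P y := by
  rw [contactOrder, normMod_mul, toNat_ord_mul hx hy]; rfl

theorem contactOrder_pow {P x : Polynomial D} (hx : normMod P x ≠ 0) (n : ℕ) :
    contactOrder P (x ^ n) = n * contactOrder P x := by
  rw [contactOrder, normMod_pow, toNat_ord_pow hx]; rfl

omit [IsDomain D] [IsDiscreteValuationRing D] in
theorem normMod_isUnit {P x : Polynomial D} (hx : IsUnit x) : IsUnit (normMod P x) :=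
  (hx.map (AdjoinRoot.mk P)).map (Algebra.norm D)

omit [IsDomain D] [IsDiscreteValuationRing D] in
theorem contactOrder_isUnit {P x : Polynomial D} (hx : IsUnit x) : contactOrder P x = 0 := by
  rw [contactOrder, Ring.ord_of_isUnit (normMod_isUnit hx)]
  rfl

omit [IsDomain D] [IsDiscreteValuationRing D] in
theorem contactOrder_congr {P x y : Polynomial D} (h : P ∣ x - y) :
    contactOrder P x = contactOrder P y := by
  rw [contactOrder, normMod_congr h]; rfl

end Orders

/-- A square root of `t^c ω`, for a prime `t` not dividing `ω`. -/
theorem exists_eq_pow_mul_of_sq_eq {Λ D : Type*} [CommRing Λ] [IsDomain Λ] [IsNoetherianRing Λ]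
    [CommRing D] [IsDomain D] {π : Λ →+* D} {t : Λ} (ht : RingHom.ker π = Ideal.span {t})
    (ht0 : t ≠ 0) {z ω : Λ} {c : ℕ} (hz : z ^ 2 = t ^ c * ω) (hω : π ω ≠ 0) :
    ∃ (c' : ℕ) (ω' : Λ), z = t ^ c' * ω' ∧ π ω' ≠ 0 ∧ π ω' ^ 2 = π ω := by
  have hprime : (Ideal.span {t}).IsPrime := ht ▸ RingHom.ker_isPrime π
  have htp : Prime t := (Ideal.span_singleton_prime ht0).mp hprime
  have htπ : ∀ a, π a = 0 ↔ t ∣ a := fun a => by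
    rw [← RingHom.mem_ker, ht, Ideal.mem_span_singleton]
  have hz0 : z ≠ 0 := by
    rintro rfl
    have h1 : ω = 0 := by
      rw [zero_pow two_ne_zero] at hz
      exact (mul_eq_zero.mp hz.symm).resolve_left (pow_ne_zero _ ht0)
    exact hω (by rw [h1, map_zero])
  obtain ⟨c', ω', hω', rfl⟩ := WfDvdMonoid.max_power_factor hz0 htp.irreducible
  rw [mul_pow, ← pow_mul] at hz
  have h1 : ¬ t ∣ ω := fun h => hω ((htπ _).mpr h)
  have h2 : ¬ t ∣ ω' ^ 2 := fun h => hω' (htp.dvd_of_dvd_pow h)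
  have h3 : c' * 2 = c := by
    rcases lt_trichotomy (c' * 2) c with h | h | h
    · obtain ⟨d, rfl⟩ := Nat.exists_eq_add_of_lt h
      refine absurd ?_ h2
      rw [add_assoc, pow_add, mul_assoc] at hz
      rw [mul_left_cancel₀ (pow_ne_zero _ ht0) hz]
      exact Dvd.dvd.mul_right (dvd_pow_self _ (by omega)) _
    · exact h
    · obtain ⟨d, hd⟩ := Nat.exists_eq_add_of_lt h
      refine absurd ?_ h1
      rw [hd, add_assoc, pow_add, mul_assoc] at hz
      rw [← mul_left_cancel₀ (pow_ne_zero _ ht0) hz]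
      exact Dvd.dvd.mul_right (dvd_pow_self _ (by omega)) _
  rw [h3] at hz
  refine ⟨c', ω', rfl, fun h => hω' ((htπ _).mp h), ?_⟩
  rw [← map_pow, mul_left_cancel₀ (pow_ne_zero _ ht0) hz]

/-! ### The multiplicity of the limit at a point -/

/-- A local model, in adapted coordinates `X = M Y`, of the projection of the family from the point
`Y_1 = Y_2 = 0`: a map `j` from `k[[t]][X_0, X_1, X_2]` to the polynomials in `Y_0` over a local
ring `Λ`, whose reduction modulo the parameter `t` of `Λ` is `pointHom M`. -/
structure IsLocalModel {k Λ : Type*} [Field k] [CommRing Λ] (M M' : Matrix (Fin 3) (Fin 3) k)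
    (π : Λ →+* LineRing k) (t : Λ) (j : Poly3 k⟦X⟧ →+* Polynomial Λ) : Prop where
  surjective : Function.Surjective π
  ker_eq : RingHom.ker π = Ideal.span {t}
  ne_zero : t ≠ 0
  injective : Function.Injective j
  map_eq : ∀ P, (j P).map π = pointHom M (atZero P)
  parameter_eq : j (C PowerSeries.X) = Polynomial.C t
  isUnit : IsUnit (j (linearForm fun i => PowerSeries.C (M' 2 i)))
  exists_mul_eq : ∀ f, ∃ x m, IsUnit (j m) ∧ f * j m = j x
  exists_monic : ∀ (F : Poly3 k⟦X⟧) (e : ℕ), F.IsHomogeneous e →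
    eval (fun i => M i 0) (atZero F) ≠ 0 → ∃ P : Polynomial Λ, P.Monic ∧ Associated (j F) P

universe u in
theorem exists_isLocalModel {k : Type u} [Field k] {M M' : Matrix (Fin 3) (Fin 3) k}
    (h : M * M' = 1) (h' : M' * M = 1) :
    ∃ (Λ : Type u) (_ : CommRing Λ) (_ : IsDomain Λ) (_ : IsLocalRing Λ) (_ : IsNoetherianRing Λ)
      (π : Λ →+* LineRing k) (t : Λ) (j : Poly3 k⟦X⟧ →+* Polynomial Λ),
      IsLocalModel M M' π t j := by
  obtain ⟨Λ, i1, i2, i3, i4, π, t, j, h1, h2, h3, h4, h5, h6, h7, h8, h9⟩ :=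
    exists_familyHom_model (R := k⟦X⟧) (k := k) PowerSeries.constantCoeff
      PowerSeries.constantCoeff_surj (σ := PowerSeries.C) (fun c => PowerSeries.constantCoeff_C c)
      (t := PowerSeries.X)
      (by ext x; rw [RingHom.mem_ker, Ideal.mem_span_singleton, PowerSeries.X_dvd_iff])
      PowerSeries.X_ne_zero h h'
  exact ⟨Λ, i1, i2, i3, i4, π, t, j, ⟨h1, h2, h3, h4, h5, h6, h7, h8, h9⟩⟩

namespace IsDegeneration
variable {k : Type*} [Field k] {F : Poly3 k⟦X⟧} {e : ℕ} {E A : Poly3 k} {m : ℕ}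
    {G B : Fin m → Poly3 k} {n : Fin m → ℕ} (h : IsDegeneration F e E A G B n)
    {d r : ℕ} {V : Submodule k⟦X⟧ (Poly3 k⟦X⟧)}
    (hV : V ≤ homogeneousSubmodule (Fin 3) k⟦X⟧ d)
    (b : Module.Basis (Fin r) k⟦X⟧ V) (b0 : Module.Basis (Fin r) k (specialSystem V))
    (hb0 : ∀ j, (b0 j : Poly3 k) = atZero (b j : Poly3 k⟦X⟧))
    {M M' : Matrix (Fin 3) (Fin 3) k} {p : ℙ k (Fin 3 → k)} (hM : IsAdapted M M' p (atZero F))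

include h hV in
/-- Near `p` the limit of the ramification scheme is the special fiber of the `t`-saturation of the
ideal of `F` and of the Wronskian of `Y_2`. -/
theorem mem_map_limitIdeal_iff {Λ : Type*} [CommRing Λ] {π : Λ →+* LineRing k} {t : Λ}
    {j : Poly3 k⟦X⟧ →+* Polynomial Λ} (hj : IsLocalModel M M' π t j) (f : Polynomial (LineRing k)) :
    f ∈ (limitIdeal (ramificationIdeal (genericFiber F) (genericSystem V))).map (pointHom M) ↔
      ∃ (g : Polynomial Λ) (c : ℕ), g.map π = f ∧ Polynomial.C (t ^ c) * g ∈
          (Ideal.span {F, wronskian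
            (jacobianDerivation F (linearForm fun i => PowerSeries.C (M' 2 i)))
            (fun i => (b i : Poly3 k⟦X⟧))}).map j := by
  set J := Ideal.span {F, wronskian
            (jacobianDerivation F (linearForm fun i => PowerSeries.C (M' 2 i)))
            (fun i => (b i : Poly3 k⟦X⟧))}
  have hjt : ∀ c : ℕ, Polynomial.C (t ^ c) = j (C PowerSeries.X ^ c) := fun c => by
    rw [Polynomial.C_pow, ← hj.parameter_eq, ← map_pow]
  have hred := hj.map_eq
  constructor
  · intro hf
    induction hf using Submodule.span_induction with
    | mem x hx =>
      obtain ⟨y, hy, rfl⟩ := hx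
      obtain ⟨f, hf, rfl⟩ := mem_limitIdeal_iff.mp hy
      obtain ⟨c, c', hc⟩ := (h.genericFiber_mem_ramificationIdeal_iff hV b (M' 2) f).1 hf
      refine ⟨j f, c, hred f, ?_⟩
      have h1 := Ideal.mem_map_of_mem j hc
      rw [map_mul, map_mul, map_pow j (linearForm _), mul_left_comm] at h1
      rw [hjt]
      exact (Ideal.unit_mul_mem_iff_mem _ (hj.isUnit.pow c')).mp h1
    | zero => exact ⟨0, 0, by simp, by simp⟩
    | add x y _ _ hx hy =>
      obtain ⟨g, c, rfl, hg⟩ := hx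
      obtain ⟨g', c', rfl, hg'⟩ := hy
      refine ⟨g + g', c + c', Polynomial.map_add _, ?_⟩
      have h1 : Polynomial.C (t ^ (c + c')) * (g + g') = Polynomial.C (t ^ c') *
          (Polynomial.C (t ^ c) * g) + Polynomial.C (t ^ c) * (Polynomial.C (t ^ c') * g') := by
        rw [pow_add, Polynomial.C_mul]; ring
      rw [h1]
      exact Ideal.add_mem _ (Ideal.mul_mem_left _ _ hg) (Ideal.mul_mem_left _ _ hg')
    | smul a x _ hx =>
      obtain ⟨g, c, rfl, hg⟩ := hx
      obtain ⟨a, rfl⟩ := Polynomial.map_surjective _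
        hj.surjective a
      refine ⟨a * g, c, Polynomial.map_mul _, ?_⟩
      rw [mul_left_comm]
      exact Ideal.mul_mem_left _ _ hg
  · rintro ⟨g, c, rfl, hg⟩
    rw [Ideal.map_span, Set.image_pair] at hg
    obtain ⟨x, y, hxy⟩ := Ideal.mem_span_pair.mp hg
    obtain ⟨x', u, hu, hx⟩ := hj.exists_mul_eq x
    obtain ⟨y', v, hv, hy⟩ := hj.exists_mul_eq y
    obtain ⟨g', s, hs, hg'⟩ := hj.exists_mul_eq g
    have h1 : C PowerSeries.X ^ c * (u * v * g') ∈ J := by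
      refine Ideal.mem_span_pair.mpr ⟨v * s * x', u * s * y', hj.injective ?_⟩
      simp only [map_add, map_mul, ← hjt]
      change _ = Polynomial.C (t ^ c) * (j u * j v * j g')
      rw [← hx, ← hy, ← hg']
      change j v * j s * (x * j u) * _ + j u * j s * (y * j v) * _ =
        Polynomial.C (t ^ c) * (j u * j v * (g * j s))
      linear_combination (j u * j v * j s) * hxy
    have h2 := Ideal.mem_map_of_mem (pointHom M) (atZero_mem_limitIdeal
      ((h.genericFiber_mem_ramificationIdeal_iff hV b (M' 2) _).2 ⟨c, h1⟩))
    rw [← hred, map_mul, map_mul, ← hg', Polynomial.map_mul, Polynomial.map_mul,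
      Polynomial.map_mul] at h2
    have hunit : ∀ {z : Polynomial Λ}, IsUnit z → IsUnit (z.map π) := fun hz =>
      hz.map (Polynomial.mapRingHom π)
    rw [Ideal.unit_mul_mem_iff_mem _ ((hunit hu).mul (hunit hv))] at h2
    rwa [Ideal.mul_unit_mem_iff_mem _ (hunit hs)] at h2

section Multiplicity
variable [IsAlgClosed k] [CharZero k] (hnd : IsNondegenerateOn (specialSystem V) (E ^ 2 * A))

include h hM in
omit [IsAlgClosed k] [CharZero k] in
/-- The line `Y_2 = 0` contains the center of projection, so that it is not a component. -/
theorem not_dvd_linearForm_adapted (P : Poly3 k) (hP : Irreducible P) (hPF : P ∣ atZero F) :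
    ¬ P ∣ linearForm (M' 2) := by
  refine not_dvd_linearForm hP hPF h.atZero_isHomogeneous h.atZero_ne_zero hM.eval_ne_zero ?_ ?_
  · intro h0
    have h1 := congrFun (congrFun hM.mul_eq_one' 2) 2
    rw [Matrix.mul_apply, Matrix.one_apply_eq, h0] at h1
    simp at h1
  · rw [eval_linearForm]
    have h1 := congrFun (congrFun hM.mul_eq_one' 2) 0
    rwa [Matrix.mul_apply, Matrix.one_apply_ne (by decide)] at h1

include h hV hb0 hM hnd in
/-- The multiplicity of the limit at `p`, by comparing the norms of the square of the Wronskian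
modulo `F` and modulo the components of its special member. -/
theorem pointMultiplicity_limit {PG : Fin m → Polynomial (LineRing k)} (hPG : ∀ j, (PG j).Monic)
    (hGPG : ∀ j, Associated (pointHom M (G j)) (PG j)) {PA : Polynomial (LineRing k)}
    (hPA : PA.Monic) (hAPA : Associated (pointHom M A) PA) {c : ℕ}
    (hc : linearForm (M' 0) ^ c ∈
      limitIdeal (ramificationIdeal (genericFiber F) (genericSystem V)) ⊔
        Ideal.span {linearForm (M' 1)}) :
    ((pointMultiplicity (limitIdeal (ramificationIdeal (genericFiber F) (genericSystem V)))
        p).toNat : ℤ) =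
      r.choose 2 * contactOrder PA (pointHom M (E ^ 2)) + contactOrder PA (pointHom M
        (wronskian (jacobianDerivation A (linearForm (M' 2))) (fun i => (b0 i : Poly3 k)))) +
      ∑ j, (2 * (contactOrder (PG j) (pointHom M
          (wronskian (jacobianDerivation (G j) (linearForm (M' 2))) (fun i => (b0 i : Poly3 k)))) :
              ℤ) +
        r.choose 2 * (contactOrder (PG j)
          (pointHom M (discriminant F (B j) (G j) (n j))) : ℤ) -
        r.choose 2 * ((n j : ℤ) - 2) * contactOrder (PG j) (pointHom M (B j))) := by
  obtain ⟨Λ, _, _, _, _, π, t, j1, hj⟩ := exists_isLocalModel hM.mul_eq_one hM.mul_eq_one'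
  set N := r.choose 2
  set w := wronskian (jacobianDerivation F (linearForm fun i => PowerSeries.C (M' 2 i)))
            (fun i => (b i : Poly3 k⟦X⟧))
  set WG : Fin m → Poly3 k := fun j =>
    wronskian (jacobianDerivation (G j) (linearForm (M' 2))) (fun i => (b0 i : Poly3 k))
  set WA := wronskian (jacobianDerivation A (linearForm (M' 2))) (fun i => (b0 i : Poly3 k))
  have ha := h.not_dvd_linearForm_adapted hM
  have hred := hj.map_eq
  have hπ := hj.surjective
  have ht := hj.ker_eq
  have ht0 := hj.ne_zero
  obtain ⟨PF, hPF, hFPF⟩ := hj.exists_monic F e h.isHomogeneous hM.eval_ne_zero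
  have hrelG : ∀ j {x : Poly3 k}, ¬ G j ∣ x → normMod (PG j) (pointHom M x) ≠ 0 := fun j x hx =>
    hM.normMod_ne_zero (h.irreducible j).ne_zero ((h.irreducible j).isRelPrime_iff_not_dvd.mpr hx)
      (hPG j) (hGPG j)
  have hrelA : ∀ {x : Poly3 k}, IsRelPrime A x → normMod PA (pointHom M x) ≠ 0 := fun hx =>
    hM.normMod_ne_zero h.squarefree_right.ne_zero hx hPA hAPA
  have hsplit : PF.map π = ∏ o : Option (Fin m), (o.elim PA PG) ^ (o.elim 1 fun _ => 2) := by
    rw [Fintype.prod_option]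
    simp only [Option.elim, pow_one]
    refine Polynomial.eq_of_monic_of_associated (hPF.map _)
      (hPA.mul (Polynomial.monic_prod_of_monic _ _ fun j _ => (hPG j).pow 2)) ?_
    have h1 : Associated (PF.map π) (pointHom M (atZero F)) := by
      rw [← hred]
      exact (hFPF.map (Polynomial.mapRingHom π)).symm
    refine h1.trans ?_
    rw [h.atZero_eq, map_mul, map_pow, mul_comm]
    refine hAPA.mul_mul ?_
    rw [Finset.prod_pow]
    refine Associated.pow_pow ((h.associated.map (pointHom M)).symm.trans ?_)
    rw [map_prod]
    exact Associated.prod _ _ _ fun j _ => hGPG j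
  choose x y hrel hy hx using h.exists_relation b b0 hb0 (M' 2)
  have hwA : pointHom M A ∣ pointHom M (atZero w) - pointHom M ((E ^ 2) ^ N * WA) := by
    rw [← map_sub]
    refine map_dvd _ ?_
    rw [h.atZero_wronskian b b0 hb0]
    exact Ideal.mem_span_singleton.mp (wronskian_mul_sub_mem A (E ^ 2) (linearForm (M' 2)) _)
  have hE2 : normMod PA (pointHom M (E ^ 2)) ≠ 0 := hrelA h.isRelPrime.symm.pow_right
  have hWA : normMod PA (pointHom M WA) ≠ 0 := hrelA (h.isRelPrime_wronskian_right hV hnd b0 ha)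
  have hB : ∀ j, normMod (PG j) (pointHom M (B j)) ≠ 0 := fun j => hrelG j (h.not_dvd_cofactor j)
  have hΔ : ∀ j, normMod (PG j) (pointHom M (discriminant F (B j) (G j) (n j))) ≠ 0 := fun j =>
    hrelG j (h.isOfType j).2.2
  have hWG : ∀ j, normMod (PG j) (pointHom M (WG j)) ≠ 0 := fun j =>
    hrelG j (h.not_dvd_wronskian_component hV hnd b0 ha j)
  have hpow : ∀ {P z : Polynomial (LineRing k)} (i : ℕ), normMod P z ≠ 0 → normMod P (z ^ i) ≠ 0 :=
    fun i hz => by rw [normMod_pow]; exact pow_ne_zero _ hz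
  have hmul : ∀ {P z z' : Polynomial (LineRing k)}, normMod P z ≠ 0 → normMod P z' ≠ 0 →
      normMod P (z * z') ≠ 0 := fun hz hz' => by rw [normMod_mul]; exact mul_ne_zero hz hz'
  have hunit : ∀ {P z : Polynomial (LineRing k)}, IsUnit z → normMod P z ≠ 0 := fun hz =>
    (normMod_isUnit hz).ne_zero
  have h2 : IsUnit (pointHom M 2) := by
    rw [← map_ofNat C 2]
    exact ((isUnit_iff_ne_zero.mpr two_ne_zero).map C).map _
  have h1 : IsUnit (pointHom M (-1)) := isUnit_one.neg.map _
  -- the orders of contact on a double component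
  have hyG : ∀ j, normMod (PG j) ((j1 (y j)).map π) ≠ 0 ∧
      (contactOrder (PG j) ((j1 (y j)).map π) : ℤ) = N * contactOrder (PG j) (pointHom M (B j)) +
        2 * N * ((n j - 1) * contactOrder (PG j) (pointHom M (B j)) +
          contactOrder (PG j) (pointHom M (discriminant F (B j) (G j) (n j))) +
          (2 * n j - 2) * contactOrder (PG j) (pointHom M (B j))) := by
    intro j
    have hn := (h.isOfType j).1
    rw [hred, hy]
    simp only [map_mul, map_pow]
    have g1 := hmul (hpow (n j - 1) (hB j)) (hΔ j)
    have g2 := hmul g1 (hpow (2 * n j - 2) (hB j))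
    refine ⟨hmul (hpow N (hB j)) (hpow (2 * N) g2), ?_⟩
    rw [contactOrder_mul (hpow N (hB j)) (hpow _ g2), contactOrder_pow (hB j), contactOrder_pow g2,
      contactOrder_mul g1 (hpow _ (hB j)), contactOrder_mul (hpow _ (hB j)) (hΔ j),
      contactOrder_pow (hB j), contactOrder_pow (hB j)]
    push_cast [hn, show 2 ≤ 2 * n j by omega]
    ring
  have hxG : ∀ j, normMod (PG j) ((j1 (x j)).map π) ≠ 0 ∧
      (contactOrder (PG j) ((j1 (x j)).map π) : ℤ) =
        N * ((n j - 1) * contactOrder (PG j) (pointHom M (B j)) +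
          contactOrder (PG j) (pointHom M (discriminant F (B j) (G j) (n j)))) +
        2 * (N * (n j * contactOrder (PG j) (pointHom M (B j)) +
          ((n j - 1) * contactOrder (PG j) (pointHom M (B j)) +
          contactOrder (PG j) (pointHom M (discriminant F (B j) (G j) (n j))))) +
          contactOrder (PG j) (pointHom M (WG j))) := by
    intro j
    have hn := (h.isOfType j).1
    have hd : PG j ∣ (j1 (x j)).map π - pointHom M _ := (hGPG j).symm.dvd.trans (by
      rw [hred, ← map_sub]
      exact map_dvd _ (hx j))
    rw [normMod_congr hd, contactOrder_congr hd, neg_eq_neg_one_mul]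
    simp only [map_mul, map_pow]
    have g1 := hmul (hpow (n j - 1) (hB j)) (hΔ j)
    have g2 := hmul (hunit h1) g1
    have g3 := hmul (hunit (P := PG j) h2) (hpow (n j) (hB j))
    have g4 := hmul g3 g1
    have g5 := hmul (hpow N g4) (hWG j)
    refine ⟨hmul (hpow N g2) (hpow 2 g5), ?_⟩
    rw [contactOrder_mul (hpow N g2) (hpow 2 g5), contactOrder_pow g2, contactOrder_pow g5,
      contactOrder_mul (hunit h1) g1, contactOrder_mul (hpow N g4) (hWG j), contactOrder_pow g4,
      contactOrder_mul g3 g1, contactOrder_mul (hunit h2) (hpow _ (hB j)),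
      contactOrder_mul (hpow _ (hB j)) (hΔ j), contactOrder_pow (hB j), contactOrder_pow (hB j),
      contactOrder_isUnit h1, contactOrder_isUnit h2]
    push_cast [hn]
    ring
  have hwA' : PA ∣ pointHom M (atZero w) - pointHom M ((E ^ 2) ^ N * WA) :=
    hAPA.symm.dvd.trans hwA
  have hwA0 : normMod PA (pointHom M (atZero w)) ≠ 0 := by
    rw [normMod_congr hwA', map_mul, map_pow _ (E ^ 2)]
    exact hmul (hpow N hE2) hWA
  have hwAo : contactOrder PA (pointHom M (atZero w)) =
      N * contactOrder PA (pointHom M (E ^ 2)) + contactOrder PA (pointHom M WA) := by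
    rw [contactOrder_congr hwA', map_mul, map_pow _ (E ^ 2), contactOrder_mul (hpow N hE2) hWA,
      contactOrder_pow hE2]
  obtain ⟨c₁, ω, hω, hω0, hωeq⟩ := exists_norm_eq_pow_mul π hπ ht ht0 hPF
    (P := fun o : Option (Fin m) => o.elim PA PG) (by rintro (_ | j); exacts [hPA, hPG j])
    (fun o : Option (Fin m) => o.elim 1 fun _ => 2) hsplit (j1 w ^ 2)
    (fun o : Option (Fin m) => o.elim (j1 w ^ 2) fun j => j1 (x j)) (fun o : Option (Fin m) =>
        o.elim 1 fun j => j1 (y j))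
    (fun o : Option (Fin m) => o.elim 0 fun j => n j * N)
    (by
      rintro (_ | j)
      · simp
      · refine hFPF.symm.dvd.trans ?_
        have h3 := map_dvd j1 (hrel j)
        rw [map_sub, map_mul, map_mul, map_pow, map_pow, hj.parameter_eq, ← Polynomial.C_pow] at h3
        exact h3)
    (by
      rintro (_ | j)
      · simp only [Option.elim, Polynomial.map_pow, hred]
        exact hpow 2 hwA0
      · exact (hxG j).1)
    (by
      rintro (_ | j)
      · simp only [Option.elim, Polynomial.map_one]
        exact hunit isUnit_one
      · exact (hyG j).1)
  rw [normMod_pow] at hω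
  obtain ⟨c₂, ω', hω', hω0', hωsq⟩ := exists_eq_pow_mul_of_sq_eq ht ht0 hω hω0
  have hlength := length_quotient_saturation π hπ ht ht0 hPF (j1 w) hω' hω0'
    ((limitIdeal (ramificationIdeal (genericFiber F) (genericSystem V))).map (pointHom M)) (by
      intro f
      rw [h.mem_map_limitIdeal_iff hV b hj, Ideal.map_span, Set.image_pair,
        Ideal.span_insert, Ideal.span_singleton_eq_span_singleton.mpr hFPF, ← Ideal.span_insert])
  have hmonic : PF.map π ∈
      (limitIdeal (ramificationIdeal (genericFiber F) (genericSystem V))).map (pointHom M) := by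
    rw [h.mem_map_limitIdeal_iff hV b hj]
    refine ⟨PF, 0, rfl, ?_⟩
    rw [Ideal.map_span, Set.image_pair, pow_zero, Polynomial.C_1, one_mul,
      Ideal.span_insert, Ideal.span_singleton_eq_span_singleton.mpr hFPF, ← Ideal.span_insert]
    exact Ideal.subset_span (by simp)
  rw [hM.pointMultiplicity_eq hc (hPF.map _) hmonic, hlength]
  rw [← hωsq, Fintype.prod_option, Fintype.prod_option] at hωeq
  simp only [Option.elim, pow_one, Polynomial.map_one, Polynomial.map_pow, hred] at hωeq
  simp only [← hred (x _), ← hred (y _)] at hωeq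
  rw [normMod_pow] at hωeq
  have hN1 : normMod PA 1 ≠ 0 := hunit isUnit_one
  have hNy := Finset.prod_ne_zero_iff.mpr fun j (_ : j ∈ Finset.univ) => pow_ne_zero 2 (hyG j).1
  have hNx := Finset.prod_ne_zero_iff.mpr fun j (_ : j ∈ Finset.univ) => pow_ne_zero 2 (hxG j).1
  have hcount := congrArg (fun z => (Ring.ord (LineRing k) z).toNat) hωeq
  rw [toNat_ord_mul (pow_ne_zero 2 hω0') (mul_ne_zero hN1 hNy), toNat_ord_mul hN1 hNy,
    toNat_ord_mul (pow_ne_zero 2 hwA0) hNx, toNat_ord_pow hω0', toNat_ord_pow hwA0,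
    toNat_ord_prod _ _ (fun j _ => pow_ne_zero 2 (hyG j).1),
    toNat_ord_prod _ _ (fun j _ => pow_ne_zero 2 (hxG j).1),
    Finset.sum_congr rfl fun j _ => toNat_ord_pow (hyG j).1 2,
    Finset.sum_congr rfl fun j _ => toNat_ord_pow (hxG j).1 2] at hcount
  change _ + (contactOrder PA 1 + ∑ j, 2 * contactOrder (PG j) ((j1 (y j)).map π)) =
    2 * contactOrder PA (pointHom M (atZero w)) +
      ∑ j, 2 * contactOrder (PG j) ((j1 (x j)).map π) at hcount
  rw [contactOrder_isUnit isUnit_one, zero_add, hwAo] at hcount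
  zify at hcount
  simp only [(hyG _).2, (hxG _).2] at hcount
  rw [← eq_sub_iff_add_eq, add_sub_assoc, ← Finset.sum_sub_distrib] at hcount
  have hsum : ∀ s : ℤ, 2 * s = 2 * (N * contactOrder PA (pointHom M (E ^ 2)) +
      contactOrder PA (pointHom M WA)) + 2 * ∑ j,
          (2 * (contactOrder (PG j) (pointHom M (WG j)) : ℤ) +
        N * contactOrder (PG j) (pointHom M (discriminant F (B j) (G j) (n j))) -
        N * (n j - 2) * contactOrder (PG j) (pointHom M (B j))) →
      s = N * contactOrder PA (pointHom M (E ^ 2)) + contactOrder PA (pointHom M WA) +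
        ∑ j, (2 * (contactOrder (PG j) (pointHom M (WG j)) : ℤ) +
        N * contactOrder (PG j) (pointHom M (discriminant F (B j) (G j) (n j))) -
        N * (n j - 2) * contactOrder (PG j) (pointHom M (B j))) := fun s hs => by
    linarith
  refine hsum _ (hcount.trans ?_)
  congr 1
  rw [Finset.mul_sum]
  refine Finset.sum_congr rfl fun j _ => ?_
  ring

end Multiplicity

end IsDegeneration

/-! ### The limit cycle -/

namespace IsDegeneration
variable {k : Type*} [Field k] [IsAlgClosed k] [CharZero k] {F : Poly3 k⟦X⟧} {e : ℕ}
    {E A : Poly3 k} {m : ℕ} {G B : Fin m → Poly3 k} {n : Fin m → ℕ}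
    (h : IsDegeneration F e E A G B n) {d r : ℕ} {V : Submodule k⟦X⟧ (Poly3 k⟦X⟧)}
    (hV : V ≤ homogeneousSubmodule (Fin 3) k⟦X⟧ d)
    (hnd : IsNondegenerateOn (specialSystem V) (E ^ 2 * A))
    (b : Module.Basis (Fin r) k⟦X⟧ V) (b0 : Module.Basis (Fin r) k (specialSystem V))
    (hb0 : ∀ j, (b0 j : Poly3 k) = atZero (b j : Poly3 k⟦X⟧))

include h in
omit [IsAlgClosed k] in
/-- A line that is not a component of the special curve. -/
theorem exists_linearForm : ∃ a : Fin 3 → k,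
    ∀ P, Irreducible P → P ∣ atZero F → ¬ P ∣ linearForm a := by
  obtain ⟨x, hx⟩ := exists_eval_ne_zero h.atZero_ne_zero
  obtain ⟨l, hl, hlx⟩ := exists_ne_zero_dotProduct_eq_zero x
  exact ⟨l, fun P hP hPF => not_dvd_linearForm hP hPF h.atZero_isHomogeneous h.atZero_ne_zero hx hl
    (by rw [eval_linearForm, hlx])⟩

include h hV hnd b b0 hb0 in
/-- The formula for the limit cycle: at each point `p` it is `pointMultiplicity_limit`, in
coordinates that are adapted to `p` and to all the schemes involved. -/
theorem cycle_limit :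
    cycle (limitIdeal (ramificationIdeal (genericFiber F) (genericSystem V))) =
      (2 : ℤ) • ∑ j, cycle (ramificationIdeal (G j) (specialSystem V))
      + cycle (ramificationIdeal A (specialSystem V))
      + (r.choose 2 : ℤ) • cycle (intersectionIdeal (E ^ 2) A)
      + ∑ j, (r.choose 2 : ℤ) • cycle (intersectionIdeal (discriminant F (B j) (G j) (n j)) (G j))
      - ∑ j, ((r.choose 2 : ℤ) * ((n j : ℤ) - 2)) • cycle (intersectionIdeal (B j) (G j)) := by
  obtain ⟨a, ha⟩ := h.exists_linearForm
  have hlim := h.hasBinaryForms_limit hV hnd b b0 hb0 ha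
  have hRG := h.hasBinaryForms_component hV hnd b0 ha
  have hRA := h.hasBinaryForms_right hV hnd b0 ha
  have hEA := h.hasBinaryForms_left_right
  have hΔG := h.hasBinaryForms_discriminant
  have hBG := h.hasBinaryForms_cofactor
  ext p
  simp only [Finsupp.sub_apply, Finsupp.add_apply, Finsupp.smul_apply, Finsupp.finsetSum_apply,
    smul_eq_mul, cycle_apply hlim, cycle_apply hRA, cycle_apply hEA, cycle_apply (hRG _),
    cycle_apply (hΔG _), cycle_apply (hBG _)]
  let S : Set (Ideal (Poly3 k)) :=
    {limitIdeal (ramificationIdeal (genericFiber F) (genericSystem V)),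
      ramificationIdeal A (specialSystem V), intersectionIdeal (E ^ 2) A} ∪
    (Set.range (fun j => ramificationIdeal (G j) (specialSystem V)) ∪
      (Set.range (fun j => intersectionIdeal (discriminant F (B j) (G j) (n j)) (G j)) ∪
        Set.range fun j => intersectionIdeal (B j) (G j)))
  have hS : S.Finite := (Set.toFinite _).union ((Set.finite_range _).union
    ((Set.finite_range _).union (Set.finite_range _)))
  obtain ⟨M, M', hM, hc⟩ := exists_isAdapted p h.atZero_ne_zero hS (by
    rintro J ((rfl | rfl | rfl) | ⟨j, rfl⟩ | ⟨j, rfl⟩ | ⟨j, rfl⟩)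
    exacts [hlim, hRA, hEA, hRG j, hΔG j, hBG j])
  have ha' := h.not_dvd_linearForm_adapted hM
  choose PG hPG hGPG using fun j => hM.exists_monic h.atZero_isHomogeneous (h.dvd_atZero j)
  obtain ⟨PA, hPA, hAPA⟩ := hM.exists_monic h.atZero_isHomogeneous (G := A)
    (h.atZero_eq ▸ Dvd.intro_left _ rfl)
  have hGrel : ∀ j {x : Poly3 k}, ¬ G j ∣ x → IsRelPrime (G j) x := fun j x hx =>
    (h.irreducible j).isRelPrime_iff_not_dvd.mpr hx
  obtain ⟨c, hc1⟩ := hc _ (Or.inl (Or.inl rfl))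
  rw [h.pointMultiplicity_limit hV b b0 hb0 hM hnd hPG hGPG hPA hAPA hc1]
  have hmRA : (pointMultiplicity (ramificationIdeal A (specialSystem V)) p).toNat =
      contactOrder PA (pointHom M
        (wronskian (jacobianDerivation A (linearForm (M' 2))) (fun i => (b0 i : Poly3 k)))) := by
    obtain ⟨c, hc⟩ := hc _ (Or.inl (Or.inr (Or.inl rfl)))
    obtain ⟨g, hg⟩ := h.exists_isHomogeneous_right
    rw [hM.pointMultiplicity_eq_ord hc (hM.map_ramificationIdeal hg b0 (specialSystem_le hV))
      h.squarefree_right.ne_zero (h.isRelPrime_wronskian_right hV hnd b0 ha') hPA hAPA]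
    rfl
  have hmEA : (pointMultiplicity (intersectionIdeal (E ^ 2) A) p).toNat =
      contactOrder PA (pointHom M (E ^ 2)) := by
    obtain ⟨c, hc⟩ := hc _ (Or.inl (Or.inr (Or.inr rfl)))
    rw [hM.pointMultiplicity_eq_ord hc (G := A) (x := E ^ 2)
      (by rw [intersectionIdeal, Ideal.map_span, Set.image_pair, Set.pair_comm])
      h.squarefree_right.ne_zero h.isRelPrime.symm.pow_right hPA hAPA]
    rfl
  have hmRG : ∀ j, (pointMultiplicity (ramificationIdeal (G j) (specialSystem V)) p).toNat =
      contactOrder (PG j) (pointHom M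
        (wronskian (jacobianDerivation (G j) (linearForm (M' 2))) (fun i => (b0 i : Poly3 k)))) :=
            by
    intro j
    obtain ⟨c, hc⟩ := hc _ (Or.inr (Or.inl ⟨j, rfl⟩))
    obtain ⟨g, hg⟩ := h.exists_isHomogeneous_component j
    rw [hM.pointMultiplicity_eq_ord hc (hM.map_ramificationIdeal hg b0 (specialSystem_le hV))
      (h.irreducible j).ne_zero (hGrel j (h.not_dvd_wronskian_component hV hnd b0 ha' j)) (hPG j)
      (hGPG j)]
    rfl
  have hmΔ : ∀ j, (pointMultiplicity
      (intersectionIdeal (discriminant F (B j) (G j) (n j)) (G j)) p).toNat =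
      contactOrder (PG j) (pointHom M (discriminant F (B j) (G j) (n j))) := by
    intro j
    obtain ⟨c, hc⟩ := hc _ (Or.inr (Or.inr (Or.inl ⟨j, rfl⟩)))
    rw [hM.pointMultiplicity_eq_ord (J := intersectionIdeal (discriminant F (B j) (G j) (n j))
        (G j))
      hc (G := G j) (x := discriminant F (B j) (G j) (n j))
      (by rw [intersectionIdeal, Ideal.map_span, Set.image_pair, Set.pair_comm])
      (h.irreducible j).ne_zero (hGrel j (h.isOfType j).2.2) (hPG j) (hGPG j)]
    rfl
  have hmB : ∀ j, (pointMultiplicity (intersectionIdeal (B j) (G j)) p).toNat =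
      contactOrder (PG j) (pointHom M (B j)) := by
    intro j
    obtain ⟨c, hc⟩ := hc _ (Or.inr (Or.inr (Or.inr ⟨j, rfl⟩)))
    rw [hM.pointMultiplicity_eq_ord (J := intersectionIdeal (B j) (G j)) hc (G := G j) (x := B j)
      (by rw [intersectionIdeal, Ideal.map_span, Set.image_pair, Set.pair_comm])
      (h.irreducible j).ne_zero (hGrel j (h.not_dvd_cofactor j)) (hPG j) (hGPG j)]
    rfl
  simp only [hmRA, hmEA, hmRG, hmΔ, hmB, Finset.sum_sub_distrib, Finset.sum_add_distrib,
    Finset.mul_sum]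
  ring

end IsDegeneration

end Zeuthen
end

open Zeuthen

theorem theorem5p1p5 {k : Type*} [Field k] [IsAlgClosed k] [CharZero k]
    -- the family of curves `F(t) = E²A + F₁t + ⋯`
    (e : ℕ) (he : 0 < e) (F : Poly3 k⟦X⟧) (hF : F.IsHomogeneous e)
    (E A : Poly3 k) (hE : Squarefree E) (hA : Squarefree A) (hEA : IsRelPrime E A)
    (hF0 : atZero F = E ^ 2 * A)
    -- the decomposition of `E` in irreducible factors, and `B_j = E²A / E_j²`
    (m : ℕ) (Ej : Fin m → Poly3 k) (hEj : ∀ j, Irreducible (Ej j))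
    (hprod : Associated (∏ j, Ej j) E)
    (B : Fin m → Poly3 k) (hB : ∀ j, B j = exactQuotient (E ^ 2 * A) (Ej j ^ 2))
    -- the generic curve is geometrically reduced
    (hred : IsGeometricallyReducedSubscheme (Ideal.span {genericFiber F})) :
    ∃ n : Fin m → ℕ, (∀ j, IsOfType F (B j) (Ej j) (n j)) ∧
      ∀ (r d : ℕ) (V : Submodule k⟦X⟧ (Poly3 k⟦X⟧)),
        V ≤ MvPolynomial.homogeneousSubmodule (Fin 3) k⟦X⟧ d →
        IsSaturated V →
        Module.finrank k⟦X⟧ V = r + 1 →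
        IsNondegenerateOn (specialSystem V) (E ^ 2 * A) →
        -- the generic ramification scheme is finite
        IsFiniteSubscheme (ramificationIdeal (genericFiber F) (genericSystem V)) ∧
        -- all the schemes whose cycles appear in the formula are finite
        IsFiniteSubscheme (limitIdeal (ramificationIdeal (genericFiber F) (genericSystem V))) ∧
        (∀ j, IsFiniteSubscheme (ramificationIdeal (Ej j) (specialSystem V))) ∧
        IsFiniteSubscheme (ramificationIdeal A (specialSystem V)) ∧
        IsFiniteSubscheme (intersectionIdeal (E ^ 2) A) ∧
        (∀ j, IsFiniteSubscheme
          (intersectionIdeal (discriminant F (B j) (Ej j) (n j)) (Ej j))) ∧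
        (∀ j, IsFiniteSubscheme (intersectionIdeal (B j) (Ej j))) ∧
        -- the formula for the limit `0`-cycle
        cycle (limitIdeal (ramificationIdeal (genericFiber F) (genericSystem V))) =
          (2 : ℤ) • ∑ j, cycle (ramificationIdeal (Ej j) (specialSystem V))
          + cycle (ramificationIdeal A (specialSystem V))
          + ((r + 1).choose 2 : ℤ) • cycle (intersectionIdeal (E ^ 2) A)
          + ∑ j, ((r + 1).choose 2 : ℤ) •
              cycle (intersectionIdeal (discriminant F (B j) (Ej j) (n j)) (Ej j))
          - ∑ j, (((r + 1).choose 2 : ℤ) * ((n j : ℤ) - 2)) •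
              cycle (intersectionIdeal (B j) (Ej j)) := by

  have h0 : atZero F ≠ 0 := by
    rw [hF0]
    exact mul_ne_zero (pow_ne_zero _ hE.ne_zero) hA.ne_zero
  have hEjE : ∀ j, Ej j ∣ E := fun j =>
    (Finset.dvd_prod_of_mem Ej (Finset.mem_univ j)).trans hprod.dvd
  have hB' : ∀ j, Ej j ^ 2 * B j = E ^ 2 * A := fun j => by
    rw [hB j, mul_comm]
    exact exactQuotient_mul (Dvd.dvd.mul_right (pow_dvd_pow_of_dvd (hEjE j) 2) A)
  have hsq : ∀ (P : Poly3 k⟦X⟧) (p : ℕ), P.IsHomogeneous p → 0 < p → ¬ P ^ 2 ∣ F := by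
    intro P p hP hp hPF
    have hF' : F ≠ 0 := by
      rintro rfl
      exact h0 (map_zero _)
    refine not_sq_dvd_of_isGeometricallyReduced hred (hF.map _)
      ((map_ne_zero_iff _ genericFiber_injective).mpr hF') (P := genericFiber P) (hP.map _) hp ?_
    rw [genericFiber, genericFiber, ← map_pow]
    exact map_dvd _ hPF
  choose n hn using fun j => exists_isOfType hF (hEj j)
    (not_dvd_cofactor hE hEA (hEj j) (hEjE j) (hB' j)) (hF0.trans (hB' j).symm) hsq
  have h : IsDegeneration F e E A Ej B n := ⟨hF, hE, hA, hEA, hF0, hEj, hprod, hB', hn⟩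
  refine ⟨n, hn, fun r d V hV hsat hr hnd => ?_⟩
  obtain ⟨b⟩ := exists_basis_of_le_fg (MvPolynomial.homogeneousSubmodule_fg _ _ d) hV hr
  obtain ⟨b0, hb0⟩ := exists_basis_specialSystem b hsat
  obtain ⟨a, ha⟩ := h.exists_linearForm
  have : Infinite k⸨X⸩ := Infinite.of_injective (fun c => algebraMap k⟦X⟧ k⸨X⸩ (PowerSeries.C c))
    ((IsFractionRing.injective k⟦X⟧ k⸨X⸩).comp PowerSeries.C_injective)
  exact ⟨(h.hasBinaryForms_generic hV hnd b b0 hb0 ha).isFiniteSubscheme,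
    (h.hasBinaryForms_limit hV hnd b b0 hb0 ha).isFiniteSubscheme,
    fun j => (h.hasBinaryForms_component hV hnd b0 ha j).isFiniteSubscheme,
    (h.hasBinaryForms_right hV hnd b0 ha).isFiniteSubscheme,
    h.hasBinaryForms_left_right.isFiniteSubscheme,
    fun j => (h.hasBinaryForms_discriminant j).isFiniteSubscheme,
    fun j => (h.hasBinaryForms_cofactor j).isFiniteSubscheme,
    h.cycle_limit hV hnd b b0 hb0⟩
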